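/- Let $N,m$ be integers with $1\le m\le N$, and let $0<\gamma<N$, $0<\alpha<\frac{2}{\gamma+m}$, $a\in\{1,-1\}$ and $K\in\mathbb R$, $K\neq 0$. Put $$u_0=K(-1)^m\partial_1\partial_2\cdots\partial_m\big(|\cdot|^{-\gamma}\big)\in\mathcal S'(\mathbb R^N),\qquad \Omega=\{x\in\mathbb R^N:\ x_1>0,\dots,x_m>0\}.$$ Let $e^{t\Delta}f=G_t\star f$ with $G_t(x)=(4\pi t)^{-N/2}e^{-|x|^2/(4t)}$, let $C_0(\mathbb R^N)$ be the space of continuous real functions on $\mathbb R^N$ vanishing at infinity, with the sup norm, and consider the integral equation $$u(t)=e^{t\Delta}u_0+a\int_0^t e^{(t-\sigma)\Delta}\big[|u(\sigma)|^\alpha u(\sigma)\big]\,d\sigma ,\qquad(\ast)$$ where the integral is required to be absolutely convergent in $C_0(\mathbb R^N)$. A solution of $(\ast)$ on $(0,T]$ or $(0,T)$ is a continuous map from that interval to $C_0(\mathbb R^N)$ that satisfies $(\ast)$ there. 1. There exist $T>0$ and a solution $u:(0,T]\to C_0(\mathbb R^N)$ of $(\ast)$ such that $u(t)\to u_0$ in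 $\mathcal S'(\mathbb R^N)$ as $t\to0$. Moreover $u(t)$ is anti-symmetric in $x_1,\dots,x_m$ (it changes sign under $x_i\mapsto -x_i$, for each $1\le i\le m$), and $|u(t,x)|\le M|e^{t\Delta}u_0(x)|$ for all small $t>0$ and all $x\in\mathbb R^N$, with some constant $M$. If $K>0$, then $u(t,x)>0$ for all $t\in(0,T]$ and $x\in\Omega$. 2. This solution extends to a maximal solution $u:(0,T_{\max}(u_0))\to C_0(\mathbb R^N)$ of $(\ast)$, with $T<T_{\max}(u_0)\le\infty$, which is again anti-symmetric in $x_1,\dots,x_m$. Maximality means that every solution of $(\ast)$ on an interval $(0,T')$, $T'\le\infty$, that coincides with $u$ for small $t$ satisfies $T'\le T_{\max}(u_0)$ and is the restriction of $u$ to $(0,T')$. The maximal solution is determined by $u_0$: every solution $w$ of $(\ast)$ on an interval $(0,T')$ that is anti-symmetric in $x_1,\dots,x_m$ and satisfies $|w(t,x)|\le M'|e^{t\Delta}u_0(x)|$ for small $t$, with some constant $M'$, satisfies $T'\le T_{\max}(u_0)$ and is the restriction of $u$ to $(0,T')$. 3. If $a=-1$, then $T_{\max}(u_0)=\infty$. If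 $a=1$, then $T_{\max}(u_0)<\infty$, and $\|u(t)\|_\infty\to\infty$ as $t\nearrow T_{\max}(u_0)$. -/

import Mathlib

open MeasureTheory Set Filter Topology
open scoped SchwartzMap ZeroAtInfty LineDeriv ENNReal ContDiff

noncomputable section

namespace HeatSing

/-- Euclidean space of dimension `N`. -/
abbrev Eu (N : ℕ) : Type := EuclideanSpace ℝ (Fin N)

/-! ### The Gauss kernel -/

/-- The Gauss kernel `G_t(x) = (4πt)^(-N/2) exp(-|x|²/(4t))`. -/
def gaussKernel {N : ℕ} (t : ℝ) (x : Eu N) : ℝ :=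
  (4 * Real.pi * t) ^ (-(N : ℝ) / 2) * Real.exp (-(‖x‖ ^ 2 / (4 * t)))

theorem gaussKernel_contDiff {N : ℕ} (t : ℝ) (x : Eu N) :
    ContDiff ℝ ∞ (fun y : Eu N => gaussKernel t (x - y)) := by
  unfold gaussKernel
  have h : ContDiff ℝ ∞ (fun y : Eu N => ‖x - y‖ ^ 2) :=
    (contDiff_norm_sq ℝ).comp (contDiff_const.sub contDiff_id)
  exact contDiff_const.mul ((h.div_const _).neg.exp)

theorem gaussKernel_decay {N : ℕ} {t : ℝ} (ht : 0 < t) (x : Eu N) (k n : ℕ) :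
    ∃ C : ℝ, ∀ y : Eu N,
      ‖y‖ ^ k * ‖iteratedFDeriv ℝ n (fun y : Eu N => gaussKernel t (x - y)) y‖ ≤ C := by
  set c : ℝ := (4 * Real.pi * t) ^ (-(N : ℝ) / 2) with hc
  set q : Eu N → ℝ := fun y => -(‖x - y‖ ^ 2 / (4 * t)) with hq
  have hqT : q.HasTemperateGrowth := by
    have h1 : (fun y : Eu N => x - y).HasTemperateGrowth :=
      (Function.HasTemperateGrowth.const x).sub Function.HasTemperateGrowth.id'
    have h2 : (fun y : Eu N => ‖x - y‖ ^ 2).HasTemperateGrowth :=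
      (Function.hasTemperateGrowth_norm_sq (H := Eu N)).comp h1
    have h3 := (h2.mul (Function.HasTemperateGrowth.const (E := Eu N) ((4 * t)⁻¹))).neg
    convert! h3 using 1
  obtain ⟨l, B, hB0, hB⟩ := hqT.norm_iteratedFDeriv_le_uniform n
  -- polynomial times Gaussian is bounded
  have hpoly : ∃ A : ℝ, ∀ y : Eu N, (1 + ‖y‖) ^ (k + l * n) * Real.exp (q y) ≤ A := by
    set p := k + l * n
    set d : ℝ := 1 + ‖x‖ with hd
    have hd1 : 1 ≤ d := by simp [hd]
    -- `s ^ p ≤ p.factorial * exp s` with `s = ‖x - y‖`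
    refine ⟨d ^ p * ((p.factorial : ℝ) * Real.exp (1 + t)), fun y => ?_⟩
    set s : ℝ := ‖x - y‖ with hs
    have hs0 : 0 ≤ s := norm_nonneg _
    have h1 : 1 + ‖y‖ ≤ d * (1 + s) := by
      have : ‖y‖ ≤ ‖x‖ + s := by
        calc ‖y‖ = ‖x - (x - y)‖ := by simp
          _ ≤ _ := norm_sub_le _ _
      nlinarith [mul_nonneg (norm_nonneg x) hs0]
    have h2 : (1 + s) ^ p ≤ p.factorial * Real.exp (1 + s) := by
      have := Real.pow_div_factorial_le_exp (1 + s) (by positivity) p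
      rwa [div_le_iff₀ (by positivity), mul_comm] at this
    have h3 : 1 + s + q y ≤ 1 + t := by
      have : s ≤ s ^ 2 / (4 * t) + t := by
        rw [← sub_le_iff_le_add, le_div_iff₀ (by positivity)]
        nlinarith [sq_nonneg (s - 2 * t)]
      simp only [hq, ← hs]
      linarith
    calc (1 + ‖y‖) ^ p * Real.exp (q y) ≤ (d * (1 + s)) ^ p * Real.exp (q y) := by gcongr
      _ = d ^ p * ((1 + s) ^ p * Real.exp (q y)) := by rw [mul_pow]; ring
      _ ≤ d ^ p * ((p.factorial * Real.exp (1 + s)) * Real.exp (q y)) := by gcongr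
      _ = d ^ p * (p.factorial * Real.exp (1 + s + q y)) := by
          rw [Real.exp_add (1 + s)]; ring
      _ ≤ _ := by gcongr
  obtain ⟨A, hA⟩ := hpoly
  have hfun : (fun y : Eu N => gaussKernel t (x - y)) = c • (Real.exp ∘ q) := by
    ext y; simp [gaussKernel, hq, hc]
  have hqs : ContDiff ℝ ∞ q := hqT.1
  have hD1 : 1 ≤ 1 + B := by linarith
  refine ⟨|c| * ((n.factorial : ℝ) * (1 + B) ^ n * A), fun y => ?_⟩
  have hbound : ‖iteratedFDeriv ℝ n (Real.exp ∘ q) y‖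
      ≤ n.factorial * Real.exp (q y) * ((1 + B) * (1 + ‖y‖) ^ l) ^ n := by
    refine norm_iteratedFDeriv_comp_le (N := ∞) Real.contDiff_exp hqs
      (by exact_mod_cast le_top) y ?_ ?_
    · intro i _
      rw [norm_iteratedFDeriv_eq_norm_iteratedDeriv, iteratedDeriv_eq_iterate, Real.iter_deriv_exp]
      simp
    · intro i hi1 hin
      have hz : 1 ≤ (1 + B) * (1 + ‖y‖) ^ l := by
        have : 1 ≤ (1 + ‖y‖) ^ l := one_le_pow₀ (by simp)
        nlinarith
      calc _ ≤ B * (1 + ‖y‖) ^ l := hB i hin y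
        _ ≤ (1 + B) * (1 + ‖y‖) ^ l := by gcongr; linarith
        _ ≤ _ := le_self_pow₀ hz (by omega)
  rw [hfun, iteratedFDeriv_const_smul_apply
    ((Real.contDiff_exp.comp hqs).of_le (by exact_mod_cast le_top)).contDiffAt, norm_smul,
    Real.norm_eq_abs]
  calc ‖y‖ ^ k * (|c| * ‖iteratedFDeriv ℝ n (Real.exp ∘ q) y‖)
      ≤ (1 + ‖y‖) ^ k * (|c| * (n.factorial * Real.exp (q y) * ((1 + B) * (1 + ‖y‖) ^ l) ^ n)) := by
        gcongr
        linarith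
    _ = |c| * ((n.factorial : ℝ) * (1 + B) ^ n * ((1 + ‖y‖) ^ (k + l * n) * Real.exp (q y))) := by
        rw [mul_pow, ← pow_mul, pow_add]; ring
    _ ≤ _ := by gcongr; exact hA y

/-- For `t > 0`, the Schwartz function `y ↦ G_t(x - y)`. -/
def gaussSchwartz {N : ℕ} (t : ℝ) (ht : 0 < t) (x : Eu N) : 𝓢(Eu N, ℂ) where
  toFun y := ((gaussKernel t (x - y) : ℝ) : ℂ)
  smooth' := Complex.ofRealCLM.contDiff.comp (gaussKernel_contDiff t x)
  decay' k n := by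
    obtain ⟨C, hC⟩ := gaussKernel_decay ht x k n
    refine ⟨C, fun y => ?_⟩
    have h := Complex.ofRealLI.norm_iteratedFDeriv_comp_left (x := y)
      ((gaussKernel_contDiff t x).contDiffAt (x := y)) (i := n) (by exact_mod_cast le_top)
    have h' : ‖iteratedFDeriv ℝ n (fun y : Eu N => ((gaussKernel t (x - y) : ℝ) : ℂ)) y‖
        = ‖iteratedFDeriv ℝ n (fun y : Eu N => gaussKernel t (x - y)) y‖ := h
    rw [h']
    exact hC y

theorem gaussKernel_integrable {N : ℕ} {t : ℝ} (ht : 0 < t) :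
    Integrable (fun y : Eu N => gaussKernel t y) := by
  have h := (gaussSchwartz t ht (0 : Eu N)).integrable (μ := volume)
  refine h.re.congr (Eventually.of_forall fun y => ?_)
  change gaussKernel t (0 - y) = gaussKernel t y
  simp [gaussKernel]

/-! ### The heat semigroup -/

/-- `e^{tΔ} φ = G_t ⋆ φ` for a tempered distribution `φ` and `t > 0`, as the function
`x ↦ ⟨φ, G_t(x - ·)⟩` (for `t ≤ 0` the value is irrelevant and set to `0`). -/
def heatDistr {N : ℕ} (φ : 𝓢'(Eu N, ℂ)) (t : ℝ) (x : Eu N) : ℂ :=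
  if ht : 0 < t then φ (gaussSchwartz t ht x) else 0

theorem gaussConv_eq {N : ℕ} (t : ℝ) (f : C₀(Eu N, ℝ)) (x : Eu N) :
    ∫ y, gaussKernel t (x - y) * f y = ∫ y, gaussKernel t y * f (x - y) := by
  rw [← integral_sub_left_eq_self (fun y => gaussKernel t (x - y) * f y) volume x]
  simp

/-- `e^{tΔ} f = G_t ⋆ f` for `f ∈ C₀(ℝ^N)` and `t > 0`, as an element of `C₀(ℝ^N)`;
it is the identity for `t = 0` (and, irrelevantly, for `t < 0`). -/
def heatC0 {N : ℕ} (t : ℝ) (f : C₀(Eu N, ℝ)) : C₀(Eu N, ℝ) :=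
  if ht : 0 < t then
    { toFun := fun x => ∫ y, gaussKernel t (x - y) * f y
      continuous_toFun := by
        simp_rw [gaussConv_eq]
        refine continuous_of_dominated (bound := fun y => |gaussKernel t y| * ‖f‖) ?_ ?_ ?_ ?_
        · intro x
          exact (gaussKernel_integrable ht).1.mul
            (f.continuous.comp (continuous_const.sub continuous_id)).aestronglyMeasurable
        · intro x
          refine Eventually.of_forall fun y => ?_
          rw [norm_mul, Real.norm_eq_abs]
          gcongr
          exact f.toBCF.norm_coe_le_norm _
        · exact (gaussKernel_integrable ht).abs.mul_const _
        · refine Eventually.of_forall fun y => ?_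
          exact continuous_const.mul (f.continuous.comp (continuous_id.sub continuous_const))
      zero_at_infty' := by
        simp_rw [gaussConv_eq]
        have : (cocompact (Eu N)).IsCountablyGenerated := by
          rw [← Metric.cobounded_eq_cocompact, ← comap_norm_atTop]
          infer_instance
        have h := tendsto_integral_filter_of_dominated_convergence (μ := (volume : Measure (Eu N)))
          (l := cocompact (Eu N)) (F := fun x y => gaussKernel t y * f (x - y)) (f := fun _ => 0)
          (fun y => |gaussKernel t y| * ‖f‖) ?_ ?_ ?_ ?_
        · simpa using h
        · refine Eventually.of_forall fun x => ?_
          exact (gaussKernel_integrable ht).1.mul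
            (f.continuous.comp (continuous_const.sub continuous_id)).aestronglyMeasurable
        · refine Eventually.of_forall fun x => Eventually.of_forall fun y => ?_
          rw [norm_mul, Real.norm_eq_abs]
          gcongr
          exact f.toBCF.norm_coe_le_norm _
        · exact (gaussKernel_integrable ht).abs.mul_const _
        · refine Eventually.of_forall fun y => ?_
          have h1 : Tendsto (fun x : Eu N => x - y) (cocompact _) (cocompact _) :=
            (Homeomorph.subRight y).isClosedEmbedding.tendsto_cocompact
          simpa using (f.zero_at_infty'.comp h1).const_mul (gaussKernel t y) }
  else f

/-- The nonlinearity `f ↦ |f|^α f` on `C₀(ℝ^N)`, `α > 0`. -/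
def nonlin {N : ℕ} (α : ℝ) (hα : 0 < α) (f : C₀(Eu N, ℝ)) : C₀(Eu N, ℝ) where
  toFun x := |f x| ^ α * f x
  continuous_toFun := by
    have hf := f.continuous
    exact (hf.abs.rpow_const fun _ => Or.inr hα.le).mul hf
  zero_at_infty' := by
    have hf : Tendsto f (cocompact (Eu N)) (𝓝 0) := f.zero_at_infty'
    have h := ((hf.abs).rpow_const (p := α) (Or.inr hα.le)).mul hf
    simpa using h

/-! ### Solutions of the integral equation -/

/-- `u : I → C₀(ℝ^N)` is a continuous solution of the integral equation
`u(t) = e^{tΔ} u₀ + a ∫₀ᵗ e^{(t-σ)Δ} [|u(σ)|^α u(σ)] dσ` for `t ∈ I`, the integral being absolutely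
convergent in `C₀(ℝ^N)`. Here `I` is an interval `(0,T]` or `(0,T)`. -/
def IsSolution {N : ℕ} (a α : ℝ) (hα : 0 < α) (u₀ : 𝓢'(Eu N, ℂ)) (I : Set ℝ)
    (u : ℝ → C₀(Eu N, ℝ)) : Prop :=
  ContinuousOn u I ∧
  ∀ t ∈ I,
    IntervalIntegrable (fun σ => heatC0 (t - σ) (nonlin α hα (u σ))) volume 0 t ∧
    ∀ x : Eu N, ((u t x : ℝ) : ℂ) = heatDistr u₀ t x +
      ((a * (∫ σ in (0 : ℝ)..t, heatC0 (t - σ) (nonlin α hα (u σ))) x : ℝ) : ℂ)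

/-- The interval `(0,T)`, where `T` may be infinite. -/
def openInterval (T : EReal) : Set ℝ := {t : ℝ | 0 < t ∧ (t : EReal) < T}

/-- `v` is a maximal solution of the integral equation, with existence time `Tmax ∈ (0,∞]`: it is a
solution on `(0,Tmax)`, and any solution on an interval `(0,T')` which coincides with `v` for small
times has `T' ≤ Tmax` and is the restriction of `v`. -/
def IsMaximalSolution {N : ℕ} (a α : ℝ) (hα : 0 < α) (u₀ : 𝓢'(Eu N, ℂ)) (Tmax : EReal)
    (v : ℝ → C₀(Eu N, ℝ)) : Prop :=
  0 < Tmax ∧ IsSolution a α hα u₀ (openInterval Tmax) v ∧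
  ∀ (T' : EReal) (w : ℝ → C₀(Eu N, ℝ)), IsSolution a α hα u₀ (openInterval T') w →
    (∃ ε > 0, ∀ t ∈ openInterval T', t < ε → w t = v t) →
    T' ≤ Tmax ∧ ∀ t ∈ openInterval T', w t = v t

/-! ### Tempered distributions -/

theorem c0_memLp {N : ℕ} (f : C₀(Eu N, ℝ)) :
    MemLp (fun x => ((f x : ℝ) : ℂ)) ∞ (volume : Measure (Eu N)) := by
  refine memLp_top_of_bound
    (Complex.continuous_ofReal.comp f.continuous).aestronglyMeasurable ‖f‖
    (Eventually.of_forall fun x => ?_)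
  rw [Complex.norm_real]
  exact f.toBCF.norm_coe_le_norm x

/-- A function in `C₀(ℝ^N)` as a tempered distribution `φ ↦ ∫ f φ`. -/
def c0Distr {N : ℕ} (f : C₀(Eu N, ℝ)) : 𝓢'(Eu N, ℂ) :=
  Lp.toTemperedDistribution ((c0_memLp f).toLp _)

/-- The measure `|x|^{-γ} dx` on `ℝ^N`. -/
def powMeasure (N : ℕ) (γ : ℝ) : Measure (Eu N) :=
  volume.withDensity fun x => ENNReal.ofReal (‖x‖ ^ (-γ))

theorem powMeasure_temperate {N : ℕ} {γ : ℝ} (h0 : 0 < γ) (hN : γ < N) :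
    (powMeasure N γ).HasTemperateGrowth := by
  have hN1 : 1 ≤ N := by
    rcases Nat.eq_zero_or_pos N with h | h
    · subst h; simp at hN; linarith
    · exact h
  have hmeas : Measurable fun x : Eu N => ‖x‖ ^ (-γ) := measurable_norm.pow_const _
  refine ⟨⟨N + 1, ?_⟩⟩
  unfold powMeasure
  rw [integrable_withDensity_iff_integrable_smul' hmeas.ennreal_ofReal
    (Eventually.of_forall fun _ => ENNReal.ofReal_lt_top)]
  have hexp : Integrable (fun x : Eu N => (1 + ‖x‖) ^ (-((N + 1 : ℕ) : ℝ))) := by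
    apply integrable_one_add_norm
    simp
  have hm : AEStronglyMeasurable (fun x : Eu N =>
      (ENNReal.ofReal (‖x‖ ^ (-γ))).toReal • (1 + ‖x‖) ^ (-((N + 1 : ℕ) : ℝ))) volume := by
    refine Measurable.aestronglyMeasurable ?_
    exact hmeas.ennreal_ofReal.ennreal_toReal.smul ((measurable_const.add measurable_norm).pow_const _)
  rw [← integrableOn_univ, ← union_compl_self (Metric.ball (0 : Eu N) 1)]
  refine IntegrableOn.union ?_ ?_
  · refine integrableOn_ball_of_norm_le_rpow (C := 1) (α := γ) (by simpa using hN1)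
      (by simpa using hN) (Eventually.of_forall fun x => ?_) hm
    rw [norm_smul, ENNReal.toReal_ofReal (by positivity), mul_comm,
      Real.norm_of_nonneg (by positivity), Real.norm_of_nonneg (by positivity)]
    gcongr
    exact Real.rpow_le_one_of_one_le_of_nonpos (by simp) (by simp only [Left.neg_nonpos_iff]; positivity)
  · refine Integrable.mono' hexp.integrableOn hm.restrict ?_
    refine (ae_restrict_iff' Metric.isOpen_ball.measurableSet.compl).2
      (Eventually.of_forall fun x hx => ?_)
    have hx1 : 1 ≤ ‖x‖ := by simpa using hx
    rw [norm_smul, ENNReal.toReal_ofReal (by positivity),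
      Real.norm_of_nonneg (by positivity), Real.norm_of_nonneg (by positivity)]
    refine mul_le_of_le_one_left (by positivity) ?_
    exact Real.rpow_le_one_of_one_le_of_nonpos hx1 (by linarith)

/-- The tempered distribution `|·|^{-γ}` on `ℝ^N`, `0 < γ < N`, i.e. `φ ↦ ∫ φ(x) |x|^{-γ} dx`. -/
def powDistr (N : ℕ) (γ : ℝ) (h0 : 0 < γ) (hN : γ < N) : 𝓢'(Eu N, ℂ) :=
  haveI := powMeasure_temperate h0 hN
  (powMeasure N γ).toTemperedDistribution

/-- The tempered distribution `K (-1)^m ∂₁ ∂₂ ⋯ ∂ₘ (|·|^{-γ})`. -/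
def initialDatum (N m : ℕ) (hm : m ≤ N) (γ : ℝ) (h0 : 0 < γ) (hN : γ < N) (K : ℝ) :
    𝓢'(Eu N, ℂ) :=
  ((K * (-1) ^ m : ℝ) : ℂ) •
    ∂^{fun i : Fin m => (EuclideanSpace.single (Fin.castLE hm i) (1 : ℝ) : Eu N)}
      (powDistr N γ h0 hN)

/-! ### Anti-symmetry and the sector -/

/-- The reflection `x ↦ (x₁, …, -xᵢ, …, x_N)`. -/
def reflect {N : ℕ} (i : Fin N) (x : Eu N) : Eu N :=
  WithLp.toLp 2 (Function.update x.ofLp i (-(x i)))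

/-- `f` is anti-symmetric in `x₁, …, xₘ`. -/
def AntiSymm {N : ℕ} (m : ℕ) (f : Eu N → ℝ) : Prop :=
  ∀ i : Fin N, i.val < m → ∀ x, f (reflect i x) = -f x

/-- The sector `Ω = {x : x₁ > 0, …, xₘ > 0}`. -/
def sector (N m : ℕ) : Set (Eu N) := {x | ∀ i : Fin N, i.val < m → 0 < x i}

/-- For `t` in `I`, `u(t)` is anti-symmetric in `x₁, …, xₘ`, and for small `t` in `I` it is bounded
by a constant multiple of the solution `e^{tΔ} u₀` of the linear heat equation. -/
def InUniquenessClass {N : ℕ} (m : ℕ) (u₀ : 𝓢'(Eu N, ℂ)) (I : Set ℝ)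
    (u : ℝ → C₀(Eu N, ℝ)) : Prop :=
  (∀ t ∈ I, AntiSymm m (u t)) ∧
  ∃ δ > 0, ∃ M : ℝ, ∀ t ∈ I, t < δ → ∀ x, |u t x| ≤ M * ‖heatDistr u₀ t x‖

end HeatSing

end

/-! The linear solution is explicit. Since `|x|^{-γ} = ∫₀^∞ ρ(τ) G_τ(x) dτ` with `ρ` a power of `τ`,
the function `e^{tΔ} u₀` equals `K * linSol`, where `linSol` at time `t` is `∫₀^∞ ρ(τ) ψ(t+τ) dτ`
and `ψ(s) = (-1)^m ∂₁⋯∂ₘ G_s = ∏_{i≤m} x_i/(2s) · G_s`. Hence `linSol` is anti-symmetric, has the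
sign of `x₁⋯xₘ`, follows the heat flow and is self-similar, so that its sup norm is at most a
constant times `t^{-(γ+m)/2}` (`norm_linSol_le`).

On anti-symmetric functions the heat semigroup acts on the sector through the Dirichlet kernel,
which is positive. A bound `|f| ≤ c |linSol(σ)|` therefore propagates to `|e^{(t-σ)Δ} f| ≤ c
|linSol(t)|` (`abs_heatC0_le`). Among functions bounded by `M |linSol(σ)|` the nonlinearity is
Lipschitz for this pointwise gauge, with constant of order `σ^{-α(γ+m)/2}`, integrable at `0`
because `α < 2/(γ+m)` (`isGauge_linBound`). Picard iteration in the gauge (`IsGauge.exists_isMild`,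
`IsGauge.eq_of_isMild`) gives existence, uniqueness in the class, and `|u - K linSol| ≤ o(1)
|linSol|`, hence positivity on the sector.

For the convergence to `u₀`, an anti-symmetric function only sees the anti-symmetric part of a test
function. That part is `O(|x₁⋯xₘ|)` with fast decay, and the corresponding weighted integral of
`linSol` is bounded uniformly in `t` (`norm_pairC0_le_of_abs_le_linSol`).

Away from `t = 0` the equation is an ordinary locally Lipschitz evolution equation in `C₀`, with a
maximal solution and the blow-up alternative (`exists_maximal`). For `a = -1` the sup norm does not
increase (`IsMild.norm_le_of_dissipative`), so the solution is global. For `a = 1`, fix `t` and a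
point `x` of the sector and take `K > 0`: by Jensen's inequality `y(s) = (e^{(t-s)Δ} u(s))(x)`
satisfies `y' ≥ y^{1+α}` in integrated form, with `y(0) = K linSol(t, x)`, which forces `α t ≤ (K
linSol(t, x))^{-α}`. At `x = √t (1,…,1)` the right side is a constant times `t^{α(γ+m)/2}`, with
exponent below `1`, which fails for large `t` (`not_isMild_Ioi`). -/

noncomputable section

namespace HeatSing

section

/-! ### Mild solutions for contraction semigroups -/

/-- A strongly continuous contraction semigroup, extended by the identity to negative times. -/
structure ContrSemigroup (X : Type*) [NormedAddCommGroup X] [NormedSpace ℝ X] where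
  toFun : ℝ → X →L[ℝ] X
  map_zero : ∀ x, toFun 0 x = x
  map_add : ∀ s t, 0 ≤ s → 0 ≤ t → ∀ x, toFun (s + t) x = toFun s (toFun t x)
  norm_le : ∀ t x, ‖toFun t x‖ ≤ ‖x‖
  continuous_apply : ∀ x, Continuous fun t => toFun t x

variable {X : Type*} [NormedAddCommGroup X] [NormedSpace ℝ X]

namespace ContrSemigroup

instance : CoeFun (ContrSemigroup X) fun _ => ℝ → X →L[ℝ] X := ⟨toFun⟩

/-- Contractions are equicontinuous, so strong continuity upgrades to joint continuity. -/
theorem continuous_uncurry (S : ContrSemigroup X) : Continuous fun q : ℝ × X => S q.1 q.2 := by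
  rw [continuous_iff_continuousAt]
  rintro ⟨t, x⟩
  rw [ContinuousAt, tendsto_iff_norm_sub_tendsto_zero]
  have h1 : Tendsto (fun q : ℝ × X => ‖q.2 - x‖ + ‖S q.1 x - S t x‖) (𝓝 (t, x)) (𝓝 0) := by
    have hc : Continuous fun q : ℝ × X => ‖q.2 - x‖ + ‖S q.1 x - S t x‖ := by
      have := (S.continuous_apply x).comp (continuous_fst (X := ℝ) (Y := X))
      have h2 : Continuous fun q : ℝ × X => S q.1 x := this
      fun_prop
    simpa using hc.tendsto (t, x)
  refine squeeze_zero (fun _ => norm_nonneg _) (fun q => ?_) h1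
  calc ‖S q.1 q.2 - S t x‖ = ‖S q.1 (q.2 - x) + (S q.1 x - S t x)‖ := by rw [map_sub]; abel_nf
    _ ≤ _ := (norm_add_le _ _).trans (by gcongr; exact S.norm_le _ _)

end ContrSemigroup

/-- `u` is a continuous solution of `u(t) = F(t) + ∫₀ᵗ S(t-σ) f(u(σ)) dσ` on `I`. -/
def IsMild (S : ContrSemigroup X) (f : X → X) (F : ℝ → X) (I : Set ℝ) (u : ℝ → X) : Prop :=
  ContinuousOn u I ∧ ∀ t ∈ I, IntervalIntegrable (fun σ => S (t - σ) (f (u σ))) volume 0 t ∧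
    u t = F t + ∫ σ in (0 : ℝ)..t, S (t - σ) (f (u σ))

/-- The open interval matters: at `σ = 0` solutions are singular and their value there carries no
information. -/
theorem intervalIntegrable_of_continuousOn_Ioo {X : Type*} [NormedAddCommGroup X]
    {g : ℝ → X} {b : ℝ → ℝ} {s t : ℝ} (hst : s ≤ t)
    (hg : ContinuousOn g (Ioo s t)) (hb : IntervalIntegrable b volume s t)
    (h : ∀ σ ∈ Ioo s t, ‖g σ‖ ≤ b σ) : IntervalIntegrable g volume s t := by
  rw [intervalIntegrable_iff_integrableOn_Ioo_of_le hst] at hb ⊢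
  refine hb.mono' (hg.aestronglyMeasurable measurableSet_Ioo) ?_
  exact (ae_restrict_iff' measurableSet_Ioo).2 (Eventually.of_forall h)

theorem integral_congr_Ioo {g h : ℝ → X} {s t : ℝ} (hst : s ≤ t) (H : ∀ σ ∈ Ioo s t, g σ = h σ) :
    ∫ σ in s..t, g σ = ∫ σ in s..t, h σ := by
  rw [intervalIntegral.integral_of_le hst, intervalIntegral.integral_of_le hst,
    integral_Ioc_eq_integral_Ioo, integral_Ioc_eq_integral_Ioo]
  exact setIntegral_congr_fun measurableSet_Ioo H

theorem intervalIntegrable_congr_Ioo {X : Type*} [NormedAddCommGroup X]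
    {g h : ℝ → X} {s t : ℝ} (hst : s ≤ t)
    (H : ∀ σ ∈ Ioo s t, g σ = h σ) (hg : IntervalIntegrable g volume s t) :
    IntervalIntegrable h volume s t := by
  rw [intervalIntegrable_iff_integrableOn_Ioo_of_le hst] at hg ⊢
  exact hg.congr_fun H measurableSet_Ioo

/-- A time-dependent gauge `B t c x` (`x` is bounded by `c` at time `t`) that is compatible with
the semigroup and for which `f` is Lipschitz with the integrable constant `ℓ`. -/
structure IsGauge (S : ContrSemigroup X) (f : X → X) (T M : ℝ) (ℓ Λ : ℝ → ℝ)
    (B : ℝ → ℝ → X → Prop) : Prop where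
  -- `Λ` converts the gauge into the norm and may be unbounded near `t = 0`. Two gauges are used:
  -- the linear solution near the singular time and the norm itself afterwards.
  norm_le : ∀ t ∈ Ioc 0 T, ∀ c x, B t c x → ‖x‖ ≤ c * Λ t
  cont_bound : ContinuousOn Λ (Ioc 0 T)
  mono : ∀ t ∈ Ioc 0 T, ∀ c d x, c ≤ d → B t c x → B t d x
  add : ∀ t ∈ Ioc 0 T, ∀ c d x y, B t c x → B t d y → B t (c + d) (x + y)
  neg : ∀ t ∈ Ioc 0 T, ∀ c x, B t c x → B t c (-x)
  closed : ∀ t ∈ Ioc 0 T, ∀ c, IsClosed {x | B t c x}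
  zero : ∀ t ∈ Ioc 0 T, B t 0 0
  heat : ∀ σ t c x, 0 < σ → σ ≤ t → t ≤ T → B σ c x → B t c (S (t - σ) x)
  integral : ∀ t ∈ Ioc 0 T, ∀ (g : ℝ → X) (c : ℝ), 0 ≤ c → IntervalIntegrable g volume 0 t →
    (∀ σ ∈ Ioo 0 t, B t (ℓ σ * c) (g σ)) → B t ((∫ σ in (0 : ℝ)..t, ℓ σ) * c) (∫ σ in (0 : ℝ)..t, g σ)
  lip_nonneg : ∀ σ ∈ Ioc 0 T, 0 ≤ ℓ σ
  lip_integrable : IntervalIntegrable ℓ volume 0 T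
  lip : ∀ σ ∈ Ioc 0 T, ∀ x y d, 0 ≤ d → B σ M x → B σ M y → B σ d (x - y) → B σ (ℓ σ * d) (f x - f y)
  map_zero : f 0 = 0

/-! ### Contraction argument in a gauge -/

namespace IsGauge

variable {S : ContrSemigroup X} {f : X → X} {T M : ℝ} {ℓ Λ : ℝ → ℝ} {B : ℝ → ℝ → X → Prop}

theorem sub (hG : IsGauge S f T M ℓ Λ B) {t c d : ℝ} {x y : X} (ht : t ∈ Ioc 0 T) (hx : B t c x)
    (hy : B t d y) : B t (c + d) (x - y) := by
  rw [sub_eq_add_neg]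
  exact hG.add t ht _ _ _ _ hx (hG.neg t ht _ _ hy)

theorem lip_integrable' (hG : IsGauge S f T M ℓ Λ B) {t : ℝ} (ht : t ∈ Ioc 0 T) :
    IntervalIntegrable ℓ volume 0 t :=
  hG.lip_integrable.mono_set (by
    rw [uIcc_of_le ht.1.le, uIcc_of_le (ht.1.le.trans ht.2)]; exact Icc_subset_Icc_right ht.2)

theorem integral_lip_le (hG : IsGauge S f T M ℓ Λ B) {t : ℝ} (ht : t ∈ Ioc 0 T) :
    ∫ σ in (0 : ℝ)..t, ℓ σ ≤ ∫ σ in (0 : ℝ)..T, ℓ σ := by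
  have hT : 0 ≤ T := ht.1.le.trans ht.2
  rw [intervalIntegral.integral_of_le ht.1.le, intervalIntegral.integral_of_le hT]
  refine setIntegral_mono_set ((intervalIntegrable_iff_integrableOn_Ioc_of_le hT).1
    hG.lip_integrable) ?_ (Ioc_subset_Ioc_right ht.2).eventuallyLE
  exact (ae_restrict_iff' measurableSet_Ioc).2 (Eventually.of_forall fun σ hσ => hG.lip_nonneg σ hσ)

/-- Comparison with `0`, where `f` vanishes, turns the Lipschitz bound into a growth bound. -/
theorem integrand_bound {u : ℝ → X} (hG : IsGauge S f T M ℓ Λ B) (hM : 0 ≤ M)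
    (hBu : ∀ t ∈ Ioc 0 T, B t M (u t)) {σ t : ℝ} (h0 : 0 < σ) (hσ : σ ≤ t) (ht : t ≤ T) :
    B t (ℓ σ * M) (S (t - σ) (f (u σ))) := by
  have hσT : σ ∈ Ioc 0 T := ⟨h0, hσ.trans ht⟩
  refine hG.heat σ t _ _ h0 hσ ht ?_
  have h := hG.lip σ hσT (u σ) 0 M hM (hBu σ hσT) (hG.mono σ hσT _ _ _ hM (hG.zero σ hσT))
    (by simpa using hBu σ hσT)
  simpa [hG.map_zero] using h

theorem integrand_continuousOn {u : ℝ → X} (hf : Continuous f) (hu : ContinuousOn u (Ioc 0 T)) {t : ℝ} (ht : t ≤ T) :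
    ContinuousOn (fun σ => S (t - σ) (f (u σ))) (Ioo 0 t) := by
  have h1 : ContinuousOn (fun σ => ((t - σ, f (u σ)) : ℝ × X)) (Ioo 0 t) :=
    (continuous_const.sub continuous_id).continuousOn.prodMk
      (hf.comp_continuousOn (hu.mono fun σ hσ => ⟨hσ.1, hσ.2.le.trans ht⟩))
  exact S.continuous_uncurry.comp_continuousOn h1

theorem integrand_integrable {u : ℝ → X} (hG : IsGauge S f T M ℓ Λ B) (hf : Continuous f)
    (hM : 0 ≤ M) (hu : ContinuousOn u (Ioc 0 T)) (hBu : ∀ t ∈ Ioc 0 T, B t M (u t))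
    {t : ℝ} (ht : t ∈ Ioc 0 T) :
    IntervalIntegrable (fun σ => S (t - σ) (f (u σ))) volume 0 t := by
  refine intervalIntegrable_of_continuousOn_Ioo ht.1.le (integrand_continuousOn hf hu ht.2)
    (((hG.lip_integrable' ht).mul_const M).mul_const (Λ t)) fun σ hσ => ?_
  exact hG.norm_le t ht _ _ (hG.integrand_bound hM hBu hσ.1 hσ.2.le ht.2)

theorem duhamel_bound {u : ℝ → X} (hG : IsGauge S f T M ℓ Λ B) (hf : Continuous f)
    (hM : 0 ≤ M) (hu : ContinuousOn u (Ioc 0 T)) (hBu : ∀ t ∈ Ioc 0 T, B t M (u t))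
    {t : ℝ} (ht : t ∈ Ioc 0 T) :
    B t ((∫ σ in (0 : ℝ)..t, ℓ σ) * M) (∫ σ in (0 : ℝ)..t, S (t - σ) (f (u σ))) :=
  hG.integral t ht _ _ hM (hG.integrand_integrable hf hM hu hBu ht)
    fun _ hσ => hG.integrand_bound hM hBu hσ.1 hσ.2.le ht.2

theorem duhamel_sub_bound {u w : ℝ → X} (hG : IsGauge S f T M ℓ Λ B) (hf : Continuous f)
    (hM : 0 ≤ M) (hu : ContinuousOn u (Ioc 0 T)) (hBu : ∀ t ∈ Ioc 0 T, B t M (u t))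
    (hw : ContinuousOn w (Ioc 0 T)) (hBw : ∀ t ∈ Ioc 0 T, B t M (w t))
    {d : ℝ} (hd : 0 ≤ d) (huw : ∀ t ∈ Ioc 0 T, B t d (u t - w t)) {t : ℝ} (ht : t ∈ Ioc 0 T) :
    B t ((∫ σ in (0 : ℝ)..t, ℓ σ) * d) ((∫ σ in (0 : ℝ)..t, S (t - σ) (f (u σ))) -
      ∫ σ in (0 : ℝ)..t, S (t - σ) (f (w σ))) := by
  have hiu := hG.integrand_integrable hf hM hu hBu ht
  have hiw := hG.integrand_integrable hf hM hw hBw ht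
  rw [← intervalIntegral.integral_sub hiu hiw]
  refine hG.integral t ht _ _ hd (hiu.sub hiw) fun σ hσ => ?_
  have hσT : σ ∈ Ioc 0 T := ⟨hσ.1, hσ.2.le.trans ht.2⟩
  rw [← map_sub]
  exact hG.heat σ t _ _ hσ.1 hσ.2.le ht.2
    (hG.lip σ hσT _ _ d hd (hBu σ hσT) (hBw σ hσT) (huw σ hσT))

/-- Dominated convergence, after the integrand is cut off at `σ = t` so that all integrals run over
the same interval. Only the null set `σ = t₀` escapes pointwise convergence, and `Λ ≤ |Λ t₀| + 1`
near `t₀` supplies the majorant. -/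
theorem duhamel_continuousOn {u : ℝ → X} (hG : IsGauge S f T M ℓ Λ B) (hf : Continuous f)
    (hM : 0 ≤ M) (hu : ContinuousOn u (Ioc 0 T)) (hBu : ∀ t ∈ Ioc 0 T, B t M (u t)) :
    ContinuousOn (fun t => ∫ σ in (0 : ℝ)..t, S (t - σ) (f (u σ))) (Ioc 0 T) := by
  intro t₀ ht₀
  set I : ℝ → ℝ → X := fun t => (Iio t).indicator fun σ => S (t - σ) (f (u σ)) with hI
  have hin : ∀ t σ, σ < t → I t σ = S (t - σ) (f (u σ)) := fun t σ h =>
    indicator_of_mem (show σ ∈ Iio t from h) _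
  have hout : ∀ t σ, t ≤ σ → I t σ = 0 := fun t σ h =>
    indicator_of_notMem (show σ ∉ Iio t from not_lt.2 h) _
  have heq : ∀ t ∈ Ioc 0 T, ∫ σ in (0 : ℝ)..t, S (t - σ) (f (u σ)) = ∫ σ in Ioo 0 T, I t σ := by
    intro t ht
    rw [intervalIntegral.integral_of_le ht.1.le, integral_Ioc_eq_integral_Ioo,
      setIntegral_indicator measurableSet_Iio]
    congr 2
    ext σ
    simp only [mem_Ioo, mem_inter_iff, mem_Iio]
    constructor
    · rintro ⟨h1, h2⟩; exact ⟨⟨h1, h2.trans_le ht.2⟩, h2⟩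
    · rintro ⟨⟨h1, _⟩, h2⟩; exact ⟨h1, h2⟩
  have hΛ : ∀ᶠ t in 𝓝[Ioc 0 T] t₀, Λ t ≤ |Λ t₀| + 1 := by
    have h1 := (hG.cont_bound t₀ ht₀).eventually
      (eventually_lt_nhds (show Λ t₀ < |Λ t₀| + 1 by linarith [le_abs_self (Λ t₀)]))
    exact h1.mono fun _ h => h.le
  have key : Tendsto (fun t => ∫ σ in Ioo 0 T, I t σ) (𝓝[Ioc 0 T] t₀)
      (𝓝 (∫ σ in Ioo 0 T, I t₀ σ)) := by
    refine tendsto_integral_filter_of_dominated_convergence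
      (fun σ => ℓ σ * M * (|Λ t₀| + 1)) ?_ ?_ ?_ ?_
    · filter_upwards [self_mem_nhdsWithin] with t ht
      rw [hI]
      rw [aestronglyMeasurable_indicator_iff measurableSet_Iio, Measure.restrict_restrict
        measurableSet_Iio]
      refine ContinuousOn.aestronglyMeasurable ?_ (measurableSet_Iio.inter measurableSet_Ioo)
      exact (integrand_continuousOn hf hu ht.2).mono fun σ hσ => ⟨hσ.2.1, hσ.1⟩
    · filter_upwards [self_mem_nhdsWithin, hΛ] with t ht hΛt
      refine (ae_restrict_iff' measurableSet_Ioo).2 (Eventually.of_forall fun σ hσ => ?_)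
      have hnn : 0 ≤ ℓ σ * M := mul_nonneg (hG.lip_nonneg σ ⟨hσ.1, hσ.2.le⟩) hM
      by_cases hσt : σ < t
      · rw [hin t σ hσt]
        refine (hG.norm_le t ht _ _ (hG.integrand_bound hM hBu hσ.1 hσt.le ht.2)).trans ?_
        gcongr
      · rw [hout t σ (not_lt.1 hσt), norm_zero]
        positivity
    · have := (intervalIntegrable_iff_integrableOn_Ioo_of_le (ht₀.1.le.trans ht₀.2)).1
        ((hG.lip_integrable.mul_const M).mul_const (|Λ t₀| + 1))
      exact this
    · have hne : ∀ᵐ σ ∂(volume.restrict (Ioo 0 T)), σ ≠ t₀ :=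
        ae_restrict_of_ae (by simp [ae_iff, measure_singleton])
      filter_upwards [hne] with σ hσ
      rcases lt_or_gt_of_ne hσ with h | h
      · have hc : Tendsto (fun t => S (t - σ) (f (u σ))) (𝓝[Ioc 0 T] t₀)
            (𝓝 (S (t₀ - σ) (f (u σ)))) :=
          (((S.continuous_apply (f (u σ))).comp (continuous_id.sub continuous_const)).tendsto
            t₀).mono_left nhdsWithin_le_nhds
        rw [hin t₀ σ h]
        refine hc.congr' ?_
        filter_upwards [nhdsWithin_le_nhds (eventually_gt_nhds h)] with t ht
        rw [hin t σ ht]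
      · rw [hout t₀ σ h.le]
        refine tendsto_const_nhds.congr' ?_
        filter_upwards [nhdsWithin_le_nhds (eventually_lt_nhds h)] with t ht
        rw [hout t σ ht.le]
  rw [ContinuousWithinAt, heq t₀ ht₀]
  refine key.congr' ?_
  filter_upwards [self_mem_nhdsWithin] with t ht
  exact (heq t ht).symm

/-- Each use of the equation halves the gauge distance, which is at most `2 * M` at the outset. No
initial condition enters: the gauge bound near `t = 0` replaces it. -/
theorem eq_of_isMild (hG : IsGauge S f T M ℓ Λ B) (hf : Continuous f) (hM : 0 ≤ M)
    (hℓ : ∫ σ in (0 : ℝ)..T, ℓ σ ≤ 1 / 2) {F u w : ℝ → X} (hu : IsMild S f F (Ioc 0 T) u)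
    (hw : IsMild S f F (Ioc 0 T) w) (hBu : ∀ t ∈ Ioc 0 T, B t M (u t))
    (hBw : ∀ t ∈ Ioc 0 T, B t M (w t)) : ∀ t ∈ Ioc 0 T, u t = w t := by
  have key : ∀ n : ℕ, ∀ t ∈ Ioc 0 T, B t (2 * M * (1 / 2) ^ n) (u t - w t) := by
    intro n
    induction n with
    | zero =>
      intro t ht
      exact hG.mono t ht _ _ _ (by simp; linarith) (hG.sub ht (hBu t ht) (hBw t ht))
    | succ n ih =>
      intro t ht
      have hd : 0 ≤ 2 * M * (1 / 2 : ℝ) ^ n := by positivity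
      have h := hG.duhamel_sub_bound hf hM hu.1 hBu hw.1 hBw hd ih ht
      have e : u t - w t = (∫ σ in (0 : ℝ)..t, S (t - σ) (f (u σ))) -
          ∫ σ in (0 : ℝ)..t, S (t - σ) (f (w σ)) := by
        rw [(hu.2 t ht).2, (hw.2 t ht).2]; abel
      rw [e]
      refine hG.mono t ht _ _ _ ?_ h
      have := (hG.integral_lip_le ht).trans hℓ
      calc _ ≤ 1 / 2 * (2 * M * (1 / 2 : ℝ) ^ n) := by gcongr
        _ = _ := by rw [pow_succ]; ring
  intro t ht
  have hlim : Tendsto (fun n : ℕ => 2 * M * (1 / 2 : ℝ) ^ n * Λ t) atTop (𝓝 0) := by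
    have := ((tendsto_pow_atTop_nhds_zero_of_lt_one (r := (1 / 2 : ℝ)) (by norm_num)
      (by norm_num)).const_mul (2 * M)).mul_const (Λ t)
    simpa using this
  have h0 : ‖u t - w t‖ ≤ 0 :=
    ge_of_tendsto' hlim fun n => hG.norm_le t ht _ _ (key n t ht)
  exact sub_eq_zero.1 (norm_le_zero_iff.1 h0)

/-- Picard iteration from `0` in the gauge ball of radius `2 * M₀`: the free term takes `M₀` and the
Duhamel term at most `1 / 2 * (2 * M₀)`. A closed set `D` stable under the iteration also contains
the limit; this is how symmetry and sign are inherited. -/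
theorem exists_isMild [CompleteSpace X] {M₀ : ℝ} (hG : IsGauge S f T (2 * M₀) ℓ Λ B)
    (hf : Continuous f) (hM : 0 ≤ M₀) (hℓ : ∫ σ in (0 : ℝ)..T, ℓ σ ≤ 1 / 2) {F : ℝ → X}
    (hF : ContinuousOn F (Ioc 0 T)) (hBF : ∀ t ∈ Ioc 0 T, B t M₀ (F t)) {D : Set X}
    (hDc : IsClosed D) (hD0 : (0 : X) ∈ D)
    (hD : ∀ t ∈ Ioc 0 T, ∀ u : ℝ → X, (∀ σ ∈ Ioo 0 t, u σ ∈ D) →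
      IntervalIntegrable (fun σ => S (t - σ) (f (u σ))) volume 0 t →
      F t + ∫ σ in (0 : ℝ)..t, S (t - σ) (f (u σ)) ∈ D) :
    ∃ u : ℝ → X, IsMild S f F (Ioc 0 T) u ∧ ∀ t ∈ Ioc 0 T, u t ∈ D ∧ B t (2 * M₀) (u t) ∧
      B t ((∫ σ in (0 : ℝ)..t, ℓ σ) * (2 * M₀)) (u t - F t) := by
  have hM2 : 0 ≤ 2 * M₀ := by linarith
  set Φ : (ℝ → X) → ℝ → X := fun u t => F t + ∫ σ in (0 : ℝ)..t, S (t - σ) (f (u σ)) with hΦ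
  set U : ℕ → ℝ → X := fun n => Φ^[n] (fun _ => 0) with hU
  have hUs : ∀ n, U (n + 1) = Φ (U n) := fun n => by
    simp only [hU]; rw [Function.iterate_succ_apply']
  have hhalf : ∀ t ∈ Ioc 0 T, ∫ σ in (0 : ℝ)..t, ℓ σ ≤ 1 / 2 := fun t ht =>
    (hG.integral_lip_le ht).trans hℓ
  have hstep : ∀ n, ContinuousOn (U n) (Ioc 0 T) ∧ (∀ t ∈ Ioc 0 T, B t (2 * M₀) (U n t)) ∧
      ∀ t ∈ Ioc 0 T, U n t ∈ D := by
    intro n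
    induction n with
    | zero => exact ⟨continuousOn_const, fun t ht => hG.mono t ht _ _ _ hM2 (hG.zero t ht),
        fun t _ => hD0⟩
    | succ n ih =>
      obtain ⟨h1, h2, h3⟩ := ih
      rw [hUs]
      refine ⟨hF.add (hG.duhamel_continuousOn hf hM2 h1 h2), fun t ht => ?_, fun t ht => ?_⟩
      · have h := hG.add t ht _ _ _ _ (hBF t ht) (hG.duhamel_bound hf hM2 h1 h2 ht)
        refine hG.mono t ht _ _ _ ?_ h
        nlinarith [hhalf t ht]
      · exact hD t ht _ (fun σ hσ => h3 σ ⟨hσ.1, hσ.2.le.trans ht.2⟩)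
          (hG.integrand_integrable hf hM2 h1 h2 ht)
  have hdiff : ∀ n, ∀ t ∈ Ioc 0 T, B t (2 * M₀ * (1 / 2) ^ n) (U (n + 1) t - U n t) := by
    intro n
    induction n with
    | zero =>
      intro t ht
      have := (hstep 1).2.1 t ht
      simpa [hU] using this
    | succ n ih =>
      intro t ht
      have hd : 0 ≤ 2 * M₀ * (1 / 2 : ℝ) ^ n := by positivity
      have h := hG.duhamel_sub_bound hf hM2 (hstep (n + 1)).1 (hstep (n + 1)).2.1 (hstep n).1
        (hstep n).2.1 hd ih ht
      have e : U (n + 1 + 1) t - U (n + 1) t = (∫ σ in (0 : ℝ)..t, S (t - σ) (f (U (n + 1) σ))) -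
          ∫ σ in (0 : ℝ)..t, S (t - σ) (f (U n σ)) := by
        rw [hUs (n + 1)]
        conv_lhs => rw [show U (n + 1) t = Φ (U n) t by rw [hUs n]]
        simp only [hΦ]; abel
      rw [e]
      refine hG.mono t ht _ _ _ ?_ h
      calc _ ≤ 1 / 2 * (2 * M₀ * (1 / 2 : ℝ) ^ n) := by gcongr; exact hhalf t ht
        _ = _ := by rw [pow_succ]; ring
  -- The factor `2 - 2 * (1 / 2) ^ k` is the partial geometric sum, kept exact so that the induction
  -- on `k` closes.
  have hdiff' : ∀ n k, ∀ t ∈ Ioc 0 T,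
      B t (2 * M₀ * (1 / 2) ^ n * (2 - 2 * (1 / 2) ^ k)) (U (n + k) t - U n t) := by
    intro n k t ht
    induction k with
    | zero => simpa using hG.zero t ht
    | succ k ih =>
      have h := hG.add t ht _ _ _ _ (hdiff (n + k) t ht) ih
      rw [show U (n + k + 1) t - U (n + k) t + (U (n + k) t - U n t) = U (n + (k + 1)) t - U n t by
        rw [← add_assoc]; abel] at h
      refine hG.mono t ht _ _ _ (le_of_eq ?_) h
      rw [pow_add, pow_succ]; ring
  have hcau : ∀ t ∈ Ioc 0 T, CauchySeq fun n => U n t := by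
    intro t ht
    refine cauchySeq_of_le_geometric (1 / 2) (2 * M₀ * Λ t) (by norm_num) fun n => ?_
    rw [dist_comm, dist_eq_norm]
    exact (hG.norm_le t ht _ _ (hdiff n t ht)).trans (le_of_eq (by ring))
  choose! u hu using fun t (ht : t ∈ Ioc 0 T) => cauchySeq_tendsto_of_complete (hcau t ht)
  have huU : ∀ n, ∀ t ∈ Ioc 0 T, B t (2 * M₀ * (1 / 2) ^ n * 2) (u t - U n t) := by
    intro n t ht
    have h1 : Tendsto (fun k => U (n + k) t - U n t) atTop (𝓝 (u t - U n t)) := by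
      have := (hu t ht).comp (tendsto_add_atTop_nat n)
      refine Tendsto.sub_const ?_ _
      simpa [Function.comp_def, add_comm] using this
    refine (hG.closed t ht _).mem_of_tendsto h1 (Eventually.of_forall fun k => ?_)
    refine hG.mono t ht _ _ _ ?_ (hdiff' n k t ht)
    gcongr
    have : (0 : ℝ) ≤ (1 / 2) ^ k := by positivity
    linarith
  have hlim0 : Tendsto (fun n : ℕ => 2 * M₀ * (1 / 2 : ℝ) ^ n * 2) atTop (𝓝 0) := by
    have := ((tendsto_pow_atTop_nhds_zero_of_lt_one (r := (1 / 2 : ℝ)) (by norm_num)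
      (by norm_num)).const_mul (2 * M₀)).mul_const 2
    simpa using this
  have huc : ContinuousOn u (Ioc 0 T) := by
    intro t₀ ht₀
    have hΛ : ∀ᶠ t in 𝓝[Ioc 0 T] t₀, Λ t ≤ |Λ t₀| + 1 := by
      have h1 := (hG.cont_bound t₀ ht₀).eventually
        (eventually_lt_nhds (show Λ t₀ < |Λ t₀| + 1 by linarith [le_abs_self (Λ t₀)]))
      exact h1.mono fun _ h => h.le
    -- The convergence is uniform only where `Λ` is bounded, hence locally in `(0, T]`; this
    -- suffices for continuity.
    refine continuousWithinAt_of_locally_uniform_approx_of_continuousWithinAt ht₀ fun V hV => ?_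
    obtain ⟨ε, hε, hεV⟩ := Metric.mem_uniformity_dist.1 hV
    have h2 : ∀ᶠ n : ℕ in atTop, 2 * M₀ * (1 / 2 : ℝ) ^ n * 2 * (|Λ t₀| + 1) < ε := by
      have := hlim0.mul_const (|Λ t₀| + 1)
      rw [zero_mul] at this
      exact this.eventually (eventually_lt_nhds hε)
    obtain ⟨n, hn⟩ := h2.exists
    refine ⟨{t | t ∈ Ioc 0 T ∧ Λ t ≤ |Λ t₀| + 1}, ?_, U n, (hstep n).1 t₀ ht₀, ?_⟩
    · filter_upwards [self_mem_nhdsWithin, hΛ] with t h1 h2 using ⟨h1, h2⟩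
    · rintro t ⟨ht, hΛt⟩
      apply hεV
      rw [dist_eq_norm]
      refine lt_of_le_of_lt ((hG.norm_le t ht _ _ (huU n t ht)).trans ?_) hn
      gcongr
  have huB : ∀ t ∈ Ioc 0 T, B t (2 * M₀) (u t) := fun t ht =>
    (hG.closed t ht _).mem_of_tendsto (hu t ht) (Eventually.of_forall fun n => (hstep n).2.1 t ht)
  have hueq : ∀ t ∈ Ioc 0 T, u t = Φ u t := by
    intro t ht
    have h1 : Tendsto (fun n => U (n + 1) t) atTop (𝓝 (Φ u t)) := by
      rw [tendsto_iff_norm_sub_tendsto_zero]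
      have hl : Tendsto (fun n : ℕ => 2 * M₀ * (1 / 2 : ℝ) ^ n * 2 * Λ t) atTop (𝓝 0) := by
        simpa using hlim0.mul_const (Λ t)
      refine squeeze_zero (fun _ => norm_nonneg _) (fun n => ?_) hl
      have hd : 0 ≤ 2 * M₀ * (1 / 2 : ℝ) ^ n * 2 := by positivity
      have h := hG.duhamel_sub_bound hf hM2 huc huB (hstep n).1 (hstep n).2.1 hd (huU n) ht
      rw [norm_sub_rev]
      refine hG.norm_le t ht _ _ ?_
      have e : Φ u t - U (n + 1) t = (∫ σ in (0 : ℝ)..t, S (t - σ) (f (u σ))) -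
          ∫ σ in (0 : ℝ)..t, S (t - σ) (f (U n σ)) := by
        rw [hUs]; simp only [hΦ]; abel
      rw [e]
      refine hG.mono t ht _ _ _ ?_ h
      have := hhalf t ht
      nlinarith
    exact tendsto_nhds_unique ((hu t ht).comp (tendsto_add_atTop_nat 1)) h1
  refine ⟨u, ⟨huc, fun t ht => ⟨hG.integrand_integrable hf hM2 huc huB ht, hueq t ht⟩⟩,
    fun t ht => ⟨?_, huB t ht, ?_⟩⟩
  · exact hDc.mem_of_tendsto (hu t ht) (Eventually.of_forall fun n => (hstep n).2.2 t ht)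
  · have e : u t - F t = ∫ σ in (0 : ℝ)..t, S (t - σ) (f (u σ)) := by
      rw [hueq t ht]; simp only [hΦ]; abel
    rw [e]
    exact hG.duhamel_bound hf hM2 huc huB ht

end IsGauge

end

/-! ### Regular mild solutions: restarting, gluing, uniqueness, dissipation, maximality -/

section

variable {X : Type*} [NormedAddCommGroup X] [NormedSpace ℝ X]

/-- `f` vanishes at the origin and is Lipschitz on bounded sets. -/
structure IsLocLip (f : X → X) : Prop where
  map_zero : f 0 = 0
  lip : ∀ R, ∃ L, 0 ≤ L ∧ ∀ x y, ‖x‖ ≤ R → ‖y‖ ≤ R → ‖f x - f y‖ ≤ L * ‖x - y‖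

theorem IsLocLip.continuous {X : Type*} [NormedAddCommGroup X] {f : X → X} (hf : IsLocLip f) : Continuous f := by
  rw [continuous_iff_continuousAt]
  intro x
  obtain ⟨L, hL0, hL⟩ := hf.lip (‖x‖ + 1)
  rw [ContinuousAt, tendsto_iff_norm_sub_tendsto_zero]
  have h1 : Tendsto (fun y => L * ‖y - x‖) (𝓝 x) (𝓝 0) := by
    have : Continuous fun y => L * ‖y - x‖ := by fun_prop
    simpa using this.tendsto x
  refine squeeze_zero' (Eventually.of_forall fun _ => norm_nonneg _) ?_ h1
  have h2 : ∀ᶠ y in 𝓝 x, ‖y‖ < ‖x‖ + 1 :=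
    continuous_norm.continuousAt.eventually (eventually_lt_nhds (by linarith))
  filter_upwards [h2] with y hy
  exact hL y x hy.le (by linarith)

/-- A closed cone preserved by the semigroup, by `f` and by integration in time. -/
structure IsInvariantCone (S : ContrSemigroup X) (f : X → X) (D : Set X) : Prop where
  closed : IsClosed D
  zero : (0 : X) ∈ D
  add : ∀ x ∈ D, ∀ y ∈ D, x + y ∈ D
  heat : ∀ t, ∀ x ∈ D, S t x ∈ D
  map : ∀ x ∈ D, f x ∈ D
  integral : ∀ (g : ℝ → X) (t : ℝ), 0 ≤ t → IntervalIntegrable g volume 0 t →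
    (∀ σ ∈ Ioo 0 t, g σ ∈ D) → ∫ σ in (0 : ℝ)..t, g σ ∈ D

theorem IsInvariantCone.duhamel_mem {S : ContrSemigroup X} {f : X → X} {D : Set X}
    (hD : IsInvariantCone S f D) {F : ℝ → X} {t : ℝ} (ht : 0 ≤ t) (hF : F t ∈ D) (u : ℝ → X)
    (hu : ∀ σ ∈ Ioo 0 t, u σ ∈ D)
    (hi : IntervalIntegrable (fun σ => S (t - σ) (f (u σ))) volume 0 t) :
    F t + ∫ σ in (0 : ℝ)..t, S (t - σ) (f (u σ)) ∈ D :=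
  hD.add _ hF _ (hD.integral _ t ht hi fun σ hσ => hD.heat _ _ (hD.map _ (hu σ hσ)))

namespace IsMild

variable {S : ContrSemigroup X} {f : X → X} {F u w : ℝ → X} {I : Set ℝ}

theorem mono (h : IsMild S f F I u) {J : Set ℝ} (hJ : J ⊆ I) : IsMild S f F J u :=
  ⟨h.1.mono hJ, fun t ht => h.2 t (hJ ht)⟩

theorem eq_at_congr {t : ℝ} (ht : 0 ≤ t) (H : ∀ σ ∈ Ioc 0 t, w σ = u σ) (h0 : w t = u t)
    (h : IntervalIntegrable (fun σ => S (t - σ) (f (u σ))) volume 0 t ∧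
      u t = F t + ∫ σ in (0 : ℝ)..t, S (t - σ) (f (u σ))) :
    IntervalIntegrable (fun σ => S (t - σ) (f (w σ))) volume 0 t ∧
      w t = F t + ∫ σ in (0 : ℝ)..t, S (t - σ) (f (w σ)) := by
  have e : ∀ σ ∈ Ioo 0 t, S (t - σ) (f (u σ)) = S (t - σ) (f (w σ)) := fun σ hσ => by
    rw [H σ ⟨hσ.1, hσ.2.le⟩]
  exact ⟨intervalIntegrable_congr_Ioo ht e h.1, by rw [h0, h.2, integral_congr_Ioo ht e]⟩

theorem congr (h : IsMild S f F I u) (h0 : ∀ t ∈ I, 0 < t) (hI : ∀ t ∈ I, Ioc 0 t ⊆ I)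
    (H : ∀ t ∈ I, w t = u t) : IsMild S f F I w :=
  ⟨h.1.congr H, fun t ht => eq_at_congr (h0 t ht).le (fun σ hσ => H σ (hI t ht hσ)) (H t ht)
    (h.2 t ht)⟩

/-- By the semigroup law the past part of the integral is `S (t - t₀)` applied to the Duhamel term
at time `t₀`. -/
theorem integral_split [CompleteSpace X] {t₀ t : ℝ} (h0 : 0 < t₀) (hle : t₀ ≤ t)
    (hi₀ : IntervalIntegrable (fun σ => S (t₀ - σ) (f (u σ))) volume 0 t₀)
    (hi : IntervalIntegrable (fun σ => S (t - σ) (f (u σ))) volume t₀ t) :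
    IntervalIntegrable (fun σ => S (t - σ) (f (u σ))) volume 0 t ∧
    ∫ σ in (0 : ℝ)..t, S (t - σ) (f (u σ)) = S (t - t₀) (∫ σ in (0 : ℝ)..t₀, S (t₀ - σ) (f (u σ))) +
      ∫ σ in t₀..t, S (t - σ) (f (u σ)) := by
  have e : ∀ σ ∈ Ioo 0 t₀, S (t - t₀) (S (t₀ - σ) (f (u σ))) = S (t - σ) (f (u σ)) := fun σ hσ => by
    rw [← S.map_add _ _ (sub_nonneg.2 hle) (sub_nonneg.2 hσ.2.le)]; congr 2; ring
  have hi1 : IntervalIntegrable (fun σ => S (t - t₀) (S (t₀ - σ) (f (u σ)))) volume 0 t₀ :=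
    ⟨(S (t - t₀)).integrable_comp hi₀.1, (S (t - t₀)).integrable_comp hi₀.2⟩
  have hi2 := intervalIntegrable_congr_Ioo h0.le e hi1
  refine ⟨hi2.trans hi, ?_⟩
  rw [← intervalIntegral.integral_add_adjacent_intervals hi2 hi,
    ← integral_congr_Ioo h0.le e, ContinuousLinearMap.intervalIntegral_comp_comm _ hi₀]

variable [CompleteSpace X]

/-- By `hF` the free term itself evolves by the semigroup, so from `t₀` on the singular datum can be
forgotten and `u t₀` takes its place. -/
theorem restart (h : IsMild S f F I u) (hF : ∀ s t, 0 ≤ s → 0 < t → S s (F t) = F (s + t))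
    {t₀ t : ℝ} (h0 : 0 < t₀) (ht₀ : t₀ ∈ I) (ht : t ∈ I) (hle : t₀ ≤ t) :
    IntervalIntegrable (fun σ => S (t - σ) (f (u σ))) volume t₀ t ∧
    u t = S (t - t₀) (u t₀) + ∫ σ in t₀..t, S (t - σ) (f (u σ)) := by
  have hi : IntervalIntegrable (fun σ => S (t - σ) (f (u σ))) volume t₀ t :=
    (h.2 t ht).1.mono_set (by
      rw [uIcc_of_le hle, uIcc_of_le (h0.le.trans hle)]; exact Icc_subset_Icc_left h0.le)
  refine ⟨hi, ?_⟩
  rw [(h.2 t ht).2, (integral_split h0 hle (h.2 t₀ ht₀).1 hi).2, (h.2 t₀ ht₀).2, map_add,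
    hF _ _ (sub_nonneg.2 hle) h0]
  simp [add_assoc]

/-- Concatenation of a solution on `(0,t₀]` with one starting from `u(t₀)`. -/
theorem glue (hF : ∀ s t, 0 ≤ s → 0 < t → S s (F t) = F (s + t))
    {t₀ τ : ℝ} (h0 : 0 < t₀) (hu : IsMild S f F (Ioc 0 t₀) u)
    (hw : IsMild S f (fun s => S s (u t₀)) (Ioc 0 τ) w) (hw0 : Tendsto w (𝓝[>] 0) (𝓝 (u t₀))) :
    IsMild S f F (Ioc 0 (t₀ + τ)) (fun t => if t ≤ t₀ then u t else w (t - t₀)) := by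
  set v : ℝ → X := fun t => if t ≤ t₀ then u t else w (t - t₀) with hv
  have hvu : ∀ t, t ≤ t₀ → v t = u t := fun t ht => if_pos ht
  have hvw : ∀ t, t₀ < t → v t = w (t - t₀) := fun t ht => if_neg (not_le.2 ht)
  have hlim : Tendsto (fun t => w (t - t₀)) (𝓝[>] t₀) (𝓝 (u t₀)) := by
    refine hw0.comp (tendsto_nhdsWithin_iff.2 ⟨?_, ?_⟩)
    · have : Tendsto (fun t => t - t₀) (𝓝 t₀) (𝓝 (t₀ - t₀)) := tendsto_id.sub_const t₀
      rw [sub_self] at this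
      exact this.mono_left nhdsWithin_le_nhds
    · filter_upwards [self_mem_nhdsWithin] with t ht
      exact sub_pos.2 (mem_Ioi.1 ht)
  refine ⟨fun t ht => ?_, fun t ht => ?_⟩
  · rcases lt_trichotomy t t₀ with h | h | h
    · have h1 : ContinuousWithinAt u (Ioc 0 (t₀ + τ)) t := by
        refine (hu.1 t ⟨ht.1, h.le⟩).mono_of_mem_nhdsWithin ?_
        filter_upwards [self_mem_nhdsWithin, nhdsWithin_le_nhds (eventually_lt_nhds h)] with s hs1 hs2
        exact ⟨hs1.1, hs2.le⟩
      refine h1.congr_of_eventuallyEq ?_ (hvu t h.le)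
      filter_upwards [nhdsWithin_le_nhds (eventually_lt_nhds h)] with s hs using hvu s hs.le
    -- At the junction the left limit comes from `u` and the right limit from `hw0`; the equation
    -- for `w` alone says nothing about its value at `0`.
    · subst h
      have h1 : ContinuousWithinAt v (Ioc 0 t) t :=
        (hu.1 t ⟨h0, le_rfl⟩).congr (fun s hs => hvu s hs.2) (hvu t le_rfl)
      have h2 : ContinuousWithinAt v (Ioi t) t := by
        rw [ContinuousWithinAt, hvu t le_rfl]
        refine hlim.congr' ?_
        filter_upwards [self_mem_nhdsWithin] with s hs using (hvw s hs).symm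
      refine (h1.union h2).mono fun s hs => ?_
      rcases le_or_gt s t with h | h
      · exact Or.inl ⟨hs.1, h⟩
      · exact Or.inr h
    · have hs : t - t₀ ∈ Ioc 0 τ := ⟨sub_pos.2 h, by linarith [ht.2]⟩
      have h1 : ContinuousWithinAt (fun s => w (s - t₀)) (Ioc t₀ (t₀ + τ)) t :=
        ContinuousWithinAt.comp (f := fun s => s - t₀) (hw.1 _ hs)
          (continuous_id.sub continuous_const).continuousWithinAt
          fun s hs => ⟨sub_pos.2 hs.1, by linarith [hs.2]⟩
      have h2 : ContinuousWithinAt (fun s => w (s - t₀)) (Ioc 0 (t₀ + τ)) t := by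
        refine h1.mono_of_mem_nhdsWithin ?_
        filter_upwards [self_mem_nhdsWithin, nhdsWithin_le_nhds (eventually_gt_nhds h)] with s hs1 hs2
        exact ⟨hs2, hs1.2⟩
      refine h2.congr_of_eventuallyEq ?_ (hvw t h)
      filter_upwards [nhdsWithin_le_nhds (eventually_gt_nhds h)] with s hs using hvw s hs
  · rcases le_or_gt t t₀ with h | h
    · exact eq_at_congr ht.1.le (fun σ hσ => hvu σ (hσ.2.trans h)) (hvu t h) (hu.2 t ⟨ht.1, h⟩)
    · have hs : t - t₀ ∈ Ioc 0 τ := ⟨sub_pos.2 h, by linarith [ht.2]⟩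
      obtain ⟨hiw, hew⟩ := hw.2 _ hs
      obtain ⟨hiu, heu⟩ := hu.2 t₀ ⟨h0, le_rfl⟩
      have e1 : ∀ σ ∈ Ioo t₀ t, S (t - t₀ - (σ - t₀)) (f (w (σ - t₀))) = S (t - σ) (f (v σ)) :=
        fun σ hσ => by rw [hvw σ hσ.1]; congr 2; ring
      have hi1 : IntervalIntegrable (fun σ => S (t - t₀ - (σ - t₀)) (f (w (σ - t₀)))) volume t₀ t := by
        have := hiw.comp_sub_right t₀
        simpa using this
      have hi2 := intervalIntegrable_congr_Ioo h.le e1 hi1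
      have hint : ∫ σ in t₀..t, S (t - σ) (f (v σ)) =
          ∫ σ in (0 : ℝ)..(t - t₀), S (t - t₀ - σ) (f (w σ)) := by
        rw [← integral_congr_Ioo h.le e1,
          intervalIntegral.integral_comp_sub_right (fun σ => S (t - t₀ - σ) (f (w σ))) t₀, sub_self]
      have hv0 := eq_at_congr (w := v) h0.le (fun σ hσ => hvu σ hσ.2) (hvu t₀ le_rfl) ⟨hiu, heu⟩
      obtain ⟨r1, r2⟩ := integral_split (S := S) (f := f) h0 h.le hv0.1 hi2
      refine ⟨r1, ?_⟩
      rw [r2, hvw t h, hew, hint, ← hvu t₀ le_rfl, hv0.2]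
      dsimp only
      rw [map_add,
        hF _ _ (sub_nonneg.2 h.le) h0]
      simp [add_assoc]

/-- Gronwall's inequality after a restart at `t₀`; both solutions are bounded on the compact
interval `[t₀, t]`, so a single Lipschitz constant serves. -/
theorem eq_of_eq_at (hu : IsMild S f F I u) (hw : IsMild S f F I w) (hf : IsLocLip f)
    (hF : ∀ s t, 0 ≤ s → 0 < t → S s (F t) = F (s + t)) {t₀ t : ℝ} (h0 : 0 < t₀) (hle : t₀ ≤ t)
    (hI : Icc t₀ t ⊆ I) (he : u t₀ = w t₀) : u t = w t := by
  have hcu := hu.1.mono hI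
  have hcw := hw.1.mono hI
  obtain ⟨R₁, hR₁⟩ := isCompact_Icc.exists_bound_of_continuousOn hcu
  obtain ⟨R₂, hR₂⟩ := isCompact_Icc.exists_bound_of_continuousOn hcw
  obtain ⟨L, hL0, hL⟩ := hf.lip (max R₁ R₂)
  set φ : ℝ → ℝ := fun s => ‖u s - w s‖ with hφ
  have hφc : ContinuousOn φ (Icc t₀ t) := (hcu.sub hcw).norm
  set Φ : ℝ → ℝ := fun s => ∫ σ in t₀..s, φ σ with hΦ
  have hφi : ∀ s ∈ Icc t₀ t, IntervalIntegrable φ volume t₀ s := fun s hs =>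
    (hφc.mono (by rw [uIcc_of_le hs.1]; exact Icc_subset_Icc_right hs.2)).intervalIntegrable
  have hφle : ∀ s ∈ Icc t₀ t, φ s ≤ L * Φ s := by
    intro s hs
    obtain ⟨i1, e1⟩ := hu.restart hF h0 (hI ⟨le_rfl, hle⟩) (hI hs) hs.1
    obtain ⟨i2, e2⟩ := hw.restart hF h0 (hI ⟨le_rfl, hle⟩) (hI hs) hs.1
    have e : u s - w s = ∫ σ in t₀..s, (S (s - σ) (f (u σ)) - S (s - σ) (f (w σ))) := by
      rw [intervalIntegral.integral_sub i1 i2, e1, e2, he]; abel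
    simp only [hφ, hΦ]
    rw [e, ← intervalIntegral.integral_const_mul]
    refine intervalIntegral.norm_integral_le_of_norm_le hs.1 (Eventually.of_forall fun σ hσ => ?_)
      ((hφi s hs).const_mul L)
    have hσI : σ ∈ Icc t₀ t := ⟨hσ.1.le, hσ.2.trans hs.2⟩
    rw [← map_sub]
    exact (S.norm_le _ _).trans (hL _ _ ((hR₁ σ hσI).trans (le_max_left _ _))
      ((hR₂ σ hσI).trans (le_max_right _ _)))
  have hΦ0 : ∀ s ∈ Icc t₀ t, ‖Φ s‖ ≤ gronwallBound 0 L 0 (s - t₀) := by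
    refine norm_le_gronwallBound_of_norm_deriv_right_le (f' := φ) ?_ ?_ ?_ ?_
    · exact intervalIntegral.continuousOn_primitive_interval'
        (hφi t ⟨hle, le_rfl⟩) left_mem_uIcc |>.mono (by rw [uIcc_of_le hle])
    · intro s hs
      refine intervalIntegral.integral_hasDerivWithinAt_right (hφi s ⟨hs.1, hs.2.le⟩) (t := Ioi s) ?_ ?_
      · refine ⟨Ioc s t, Ioc_mem_nhdsGT hs.2, ?_⟩
        exact (hφc.mono fun σ hσ => ⟨hs.1.trans hσ.1.le, hσ.2⟩).aestronglyMeasurable measurableSet_Ioc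
      · exact (hφc s ⟨hs.1, hs.2.le⟩).mono_of_mem_nhdsWithin
          (mem_of_superset (Ioc_mem_nhdsGT hs.2) fun σ hσ => ⟨hs.1.trans hσ.1.le, hσ.2⟩)
    · simp [hΦ]
    · intro s hs
      rw [Real.norm_of_nonneg (norm_nonneg _), Real.norm_eq_abs, add_zero]
      exact (hφle s ⟨hs.1, hs.2.le⟩).trans (by gcongr; exact le_abs_self _)
  have h1 := hΦ0 t ⟨hle, le_rfl⟩
  rw [gronwallBound_ε0_δ0] at h1
  have h2 : Φ t = 0 := norm_le_zero_iff.1 h1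
  have h3 := hφle t ⟨hle, le_rfl⟩
  rw [h2, mul_zero] at h3
  exact sub_eq_zero.1 (norm_le_zero_iff.1 h3)

/-- If `‖x + h f(x)‖ ≤ ‖x‖` for small `h`, the norm does not increase along solutions. -/
theorem norm_le_of_dissipative (hu : IsMild S f F I u) (hfc : Continuous f)
    (hF : ∀ s t, 0 ≤ s → 0 < t → S s (F t) = F (s + t))
    (hdis : ∀ x, ∀ᶠ h in 𝓝[>] (0 : ℝ), ‖x + h • f x‖ ≤ ‖x‖) {t₀ t : ℝ} (h0 : 0 < t₀) (hle : t₀ ≤ t)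
    (hI : Icc t₀ t ⊆ I) : ‖u t‖ ≤ ‖u t₀‖ := by
  have hc := hu.1.mono hI
  refine image_le_of_liminf_slope_right_le_deriv_boundary (f := fun s => ‖u s‖)
    (B := fun _ => ‖u t₀‖) (B' := fun _ => 0) (a := t₀) (b := t) hc.norm le_rfl continuousOn_const
    (fun _ _ => hasDerivWithinAt_const ..) ?_ ⟨hle, le_rfl⟩
  intro s hs r hr
  refine Eventually.frequently ?_
  set y := f (u s) with hy
  have hsI : s ∈ Icc t₀ t := ⟨hs.1, hs.2.le⟩
  have hS : ∀ᶠ a in 𝓝 (0 : ℝ), ‖S a y - y‖ < r / 4 := by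
    have hcy : Continuous fun a => ‖S a y - y‖ := ((S.continuous_apply y).sub continuous_const).norm
    have := hcy.tendsto 0
    rw [S.map_zero, sub_self, norm_zero] at this
    exact this.eventually (eventually_lt_nhds (by positivity))
  obtain ⟨δ₁, hδ₁, hS⟩ := Metric.eventually_nhds_iff.1 hS
  have hfu : ∀ᶠ σ in 𝓝[Icc t₀ t] s, ‖f (u σ) - y‖ < r / 4 := by
    have h1 : ContinuousWithinAt (fun σ => ‖f (u σ) - y‖) (Icc t₀ t) s :=
      ((hfc.continuousAt.comp_continuousWithinAt (hc s hsI)).sub continuousWithinAt_const).norm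
    have h2 := h1.tendsto
    rw [hy, sub_self, norm_zero, ← hy] at h2
    exact h2.eventually (eventually_lt_nhds (by positivity))
  obtain ⟨δ₂, hδ₂, hfu⟩ := Metric.mem_nhdsWithin_iff.1 hfu
  have hd := (hdis (u s))
  have hshift : Tendsto (fun z => z - s) (𝓝[>] s) (𝓝[>] 0) := by
    refine tendsto_nhdsWithin_iff.2 ⟨?_, ?_⟩
    · have : Tendsto (fun z => z - s) (𝓝 s) (𝓝 (s - s)) := tendsto_id.sub_const s
      rw [sub_self] at this
      exact this.mono_left nhdsWithin_le_nhds
    · filter_upwards [self_mem_nhdsWithin] with z hz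
      exact sub_pos.2 (mem_Ioi.1 hz)
  filter_upwards [hshift.eventually hd, self_mem_nhdsWithin, Ioc_mem_nhdsGT hs.2,
    Ioo_mem_nhdsGT (show s < s + δ₁ by linarith), Ioo_mem_nhdsGT (show s < s + δ₂ by linarith)]
    with z hz1 hz2 hz3 hz4 hz5
  have hzs : 0 < z - s := sub_pos.2 hz2
  have hzI : z ∈ Icc t₀ t := ⟨hs.1.trans hz3.1.le, hz3.2⟩
  obtain ⟨i1, e1⟩ := hu.restart hF (h0.trans_le hs.1) (hI hsI) (hI hzI) hz3.1.le
  -- Over a short step `u z` is `S (z - s)` applied to the explicit Euler step `u s + (z - s) • f (u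
  -- s)`, which is no longer than `u s`, up to an error. Three contributions of `r / 4` keep the
  -- error below `r * (z - s)`, so the upper right derivative of the norm is nonpositive.
  have e2 : u z - S (z - s) (u s + (z - s) • y) =
      ∫ σ in s..z, (S (z - σ) (f (u σ)) - S (z - s) y) := by
    rw [intervalIntegral.integral_sub i1 (by simp), e1, map_add, map_smul]
    simp
  have h3 : ‖u z - S (z - s) (u s + (z - s) • y)‖ ≤ 3 / 4 * r * |z - s| := by
    rw [e2]
    refine intervalIntegral.norm_integral_le_of_norm_le_const fun σ hσ => ?_
    rw [uIoc_of_le hz3.1.le] at hσ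
    have a1 : ‖f (u σ) - y‖ < r / 4 := by
      refine hfu ⟨?_, ⟨hs.1.trans hσ.1.le, hσ.2.trans hz3.2⟩⟩
      rw [Metric.mem_ball, Real.dist_eq, abs_of_pos (sub_pos.2 hσ.1)]
      linarith [hσ.2, hz5.2]
    have a2 : ‖S (z - σ) y - y‖ < r / 4 := by
      apply hS
      rw [Real.dist_eq, sub_zero, abs_of_nonneg (sub_nonneg.2 hσ.2)]
      linarith [hσ.1, hz4.2]
    have a3 : ‖S (z - s) y - y‖ < r / 4 := by
      apply hS
      rw [Real.dist_eq, sub_zero, abs_of_pos hzs]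
      linarith [hz4.2]
    calc ‖S (z - σ) (f (u σ)) - S (z - s) y‖
        = ‖S (z - σ) (f (u σ) - y) + (S (z - σ) y - y) - (S (z - s) y - y)‖ := by
          rw [map_sub]; congr 1; abel
      _ ≤ ‖S (z - σ) (f (u σ) - y)‖ + ‖S (z - σ) y - y‖ + ‖S (z - s) y - y‖ :=
          (norm_sub_le _ _).trans (by gcongr; exact norm_add_le _ _)
      _ ≤ r / 4 + r / 4 + r / 4 := by
          gcongr
          exact (S.norm_le _ _).trans a1.le
      _ = _ := by ring
  have h4 : ‖u z‖ ≤ ‖u s‖ + 3 / 4 * r * (z - s) := by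
    rw [abs_of_pos hzs] at h3
    calc ‖u z‖ = ‖S (z - s) (u s + (z - s) • y) + (u z - S (z - s) (u s + (z - s) • y))‖ := by
          congr 1; abel
      _ ≤ _ := (norm_add_le _ _).trans (add_le_add ((S.norm_le _ _).trans hz1) h3)
  rw [slope_def_field, div_lt_iff₀ hzs]
  nlinarith

end IsMild

/-- With the norm as gauge the abstract contraction argument also covers regular data. -/
theorem isGauge_norm (S : ContrSemigroup X) {f : X → X} (h0 : f 0 = 0) {R L T : ℝ} (hL0 : 0 ≤ L)
    (hL : ∀ x y, ‖x‖ ≤ R → ‖y‖ ≤ R → ‖f x - f y‖ ≤ L * ‖x - y‖) :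
    IsGauge S f T R (fun _ => L) (fun _ => 1) (fun _ c x => ‖x‖ ≤ c) where
  norm_le t _ c x h := by simpa using h
  cont_bound := continuousOn_const
  mono t _ c d x h h' := h'.trans h
  add t _ c d x y h h' := (norm_add_le _ _).trans (add_le_add h h')
  neg t _ c x h := by rwa [norm_neg]
  closed t _ c := isClosed_le continuous_norm continuous_const
  zero t _ := by simp
  heat σ t c x _ _ _ h := (S.norm_le _ _).trans h
  integral t ht g c hc hg h := by
    have := intervalIntegral.norm_integral_le_of_norm_le (g := fun _ => L * c) ht.1.le
      (f := g) (μ := volume) ?_ (by simp)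
    · refine this.trans (le_of_eq ?_)
      simp; ring
    · have hne : ∀ᵐ σ : ℝ, σ ≠ t := by simp [ae_iff, measure_singleton]
      filter_upwards [hne] with σ hσ hσ2
      exact h σ ⟨hσ2.1, lt_of_le_of_ne hσ2.2 hσ⟩
  lip_nonneg _ _ := hL0
  lip_integrable := by simp
  lip σ _ x y d hd hx hy hxy := (hL x y hx hy).trans (by gcongr)
  map_zero := h0

/-- The existence time depends on the datum only through `R`; the blow-up alternative rests on this.
With `L` the Lipschitz constant on the ball of radius `2 * R`, the choice of `τ` gives `τ * L ≤ 1 /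
2`, and `L + 1` avoids division by zero. -/
theorem exists_isMild_of_norm_le [CompleteSpace X] {S : ContrSemigroup X} {f : X → X}
    (hf : IsLocLip f) {D : Set X} (hD : IsInvariantCone S f D) (R : ℝ) :
    ∃ τ > 0, ∀ x ∈ D, ‖x‖ ≤ R → ∃ w : ℝ → X, IsMild S f (fun s => S s x) (Ioc 0 τ) w ∧
      Tendsto w (𝓝[>] 0) (𝓝 x) ∧ ∀ t ∈ Ioc 0 τ, w t ∈ D := by
  obtain ⟨L, hL0, hL⟩ := hf.lip (2 * R)
  refine ⟨1 / (2 * (L + 1)), by positivity, fun x hx hxR => ?_⟩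
  have hR : 0 ≤ R := (norm_nonneg _).trans hxR
  set τ := 1 / (2 * (L + 1)) with hτ
  have hτ0 : 0 < τ := by positivity
  have hG := isGauge_norm S hf.map_zero (T := τ) hL0 hL
  have hℓ : ∫ _ in (0 : ℝ)..τ, L ≤ 1 / 2 := by
    simp only [intervalIntegral.integral_const, sub_zero, smul_eq_mul]
    rw [hτ, div_mul_eq_mul_div, one_mul, div_le_div_iff₀ (by positivity) (by norm_num)]
    linarith
  obtain ⟨w, hw, hw2⟩ := hG.exists_isMild (F := fun s => S s x) hf.continuous hR hℓ
    (S.continuous_apply x).continuousOn (fun t _ => (S.norm_le t x).trans hxR) hD.closed hD.zero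
    (fun t ht u hu hi => hD.duhamel_mem (F := fun s => S s x) ht.1.le (hD.heat t x hx) u hu hi)
  refine ⟨w, hw, ?_, fun t ht => (hw2 t ht).1⟩
  have h1 : Tendsto (fun t => ‖w t - S t x‖) (𝓝[>] 0) (𝓝 0) := by
    have hb : Tendsto (fun t : ℝ => t * L * (2 * R)) (𝓝[>] 0) (𝓝 0) := by
      have : Continuous fun t : ℝ => t * L * (2 * R) := by fun_prop
      simpa using (this.tendsto 0).mono_left nhdsWithin_le_nhds
    refine squeeze_zero' (Eventually.of_forall fun _ => norm_nonneg _) ?_ hb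
    filter_upwards [Ioc_mem_nhdsGT hτ0] with t ht
    have := (hw2 t ht).2.2
    simpa using this
  have h2 : Tendsto (fun t => S t x) (𝓝[>] 0) (𝓝 x) := by
    have := ((S.continuous_apply x).tendsto 0).mono_left (nhdsWithin_le_nhds (s := Ioi (0 : ℝ)))
    rwa [S.map_zero] at this
  have h3 := (tendsto_zero_iff_norm_tendsto_zero.2 h1).add h2
  simpa using h3

/-- The maximal solution is the union of all extensions of `u` inside `D`, which agree wherever they
coexist by `IsMild.eq_of_eq_at`. -/
theorem exists_maximal [CompleteSpace X] {S : ContrSemigroup X} {f : X → X}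
    (hf : IsLocLip f) {D : Set X} (hD : IsInvariantCone S f D) {F : ℝ → X}
    (hF : ∀ s t, 0 ≤ s → 0 < t → S s (F t) = F (s + t)) {T : ℝ} (hT : 0 < T) {u : ℝ → X}
    (hu : IsMild S f F (Ioc 0 T) u) (huD : ∀ t ∈ Ioc 0 T, u t ∈ D) :
    ∃ (Tm : EReal) (v : ℝ → X), (T : EReal) < Tm ∧ (∀ t ∈ Ioc 0 T, v t = u t) ∧
      IsMild S f F (openInterval Tm) v ∧ (∀ t ∈ openInterval Tm, v t ∈ D) ∧
      (∀ (T' : EReal) (w : ℝ → X), IsMild S f F (openInterval T') w →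
        (∃ ε > 0, ∀ t ∈ openInterval T', t < ε → w t = v t) →
        T' ≤ Tm ∧ ∀ t ∈ openInterval T', w t = v t) ∧
      ∀ Ts : ℝ, Tm = Ts → Tendsto (fun t => ‖v t‖) (𝓝[<] Ts) atTop := by
  classical
  set P : ℝ → (ℝ → X) → Prop := fun T' w => T < T' ∧ IsMild S f F (Ioo 0 T') w ∧
    (∀ t ∈ Ioo 0 T', w t ∈ D) ∧ ∀ t ∈ Ioc 0 T, w t = u t with hP
  have hext : ∀ R : ℝ, ∃ τ > 0, ∀ (t₀ : ℝ) (w : ℝ → X), T ≤ t₀ → IsMild S f F (Ioc 0 t₀) w →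
      (∀ t ∈ Ioc 0 t₀, w t ∈ D) → (∀ t ∈ Ioc 0 T, w t = u t) → ‖w t₀‖ ≤ R →
      ∃ w', P (t₀ + τ) w' := by
    intro R
    obtain ⟨τ, hτ, H⟩ := exists_isMild_of_norm_le hf hD R
    refine ⟨τ, hτ, fun t₀ w hTt hw hwD hwu hR => ?_⟩
    have h0 : 0 < t₀ := hT.trans_le hTt
    obtain ⟨z, hz1, hz2, hz3⟩ := H (w t₀) (hwD t₀ ⟨h0, le_rfl⟩) hR
    refine ⟨_, by linarith, (IsMild.glue hF h0 hw hz1 hz2).mono Ioo_subset_Ioc_self,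
      fun t ht => ?_, fun t ht => ?_⟩
    · split_ifs with h
      · exact hwD t ⟨ht.1, h⟩
      · exact hz3 _ ⟨sub_pos.2 (not_le.1 h), by linarith [ht.2]⟩
    · rw [if_pos (ht.2.trans hTt)]
      exact hwu t ht
  have huniq : ∀ {T₁ T₂ : ℝ} {w₁ w₂ : ℝ → X}, P T₁ w₁ → P T₂ w₂ → ∀ t, 0 < t → t < T₁ → t < T₂ →
      w₁ t = w₂ t := by
    intro T₁ T₂ w₁ w₂ h1 h2 t ht0 ht1 ht2
    rcases le_or_gt t T with h | h
    · rw [h1.2.2.2 t ⟨ht0, h⟩, h2.2.2.2 t ⟨ht0, h⟩]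
    · have hs : Ioc 0 t ⊆ Ioo 0 T₁ := fun s hs => ⟨hs.1, hs.2.trans_lt ht1⟩
      have hs' : Ioc 0 t ⊆ Ioo 0 T₂ := fun s hs => ⟨hs.1, hs.2.trans_lt ht2⟩
      refine IsMild.eq_of_eq_at (h1.2.1.mono hs) (h2.2.1.mono hs') hf hF hT h.le
        (fun s hs => ⟨hT.trans_le hs.1, hs.2⟩) ?_
      rw [h1.2.2.2 T ⟨hT, le_rfl⟩, h2.2.2.2 T ⟨hT, le_rfl⟩]
  set A : Set ℝ := {T' | ∃ w, P T' w} with hA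
  set Tm : EReal := sSup ((fun x : ℝ => (x : EReal)) '' A) with hTm
  have hle : ∀ T' ∈ A, (T' : EReal) ≤ Tm := fun T' h => le_sSup ⟨T', h, rfl⟩
  have hlt : ∀ t : ℝ, (t : EReal) < Tm → ∃ T' ∈ A, t < T' := by
    intro t ht
    obtain ⟨_, ⟨T', hT', rfl⟩, h⟩ := lt_sSup_iff.1 ht
    exact ⟨T', hT', EReal.coe_lt_coe_iff.1 h⟩
  have hTTm : (T : EReal) < Tm := by
    obtain ⟨τ, hτ, H⟩ := hext ‖u T‖
    obtain ⟨w', hw'⟩ := H T u le_rfl hu huD (fun _ _ => rfl) le_rfl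
    exact (EReal.coe_lt_coe_iff.2 (by linarith)).trans_le (hle _ ⟨w', hw'⟩)
  set v : ℝ → X := fun t => if h : ∃ q : ℝ × (ℝ → X), P q.1 q.2 ∧ t < q.1 then h.choose.2 t else 0
    with hv
  have hveq : ∀ {T' : ℝ} {w : ℝ → X}, P T' w → ∀ t ∈ Ioo 0 T', v t = w t := by
    intro T' w h t ht
    have hex : ∃ q : ℝ × (ℝ → X), P q.1 q.2 ∧ t < q.1 := ⟨(T', w), h, ht.2⟩
    simp only [hv]
    rw [dif_pos hex]
    exact huniq hex.choose_spec.1 h t ht.1 hex.choose_spec.2 ht.2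
  have hvm : IsMild S f F (openInterval Tm) v := by
    have hloc : ∀ t ∈ openInterval Tm, ∃ T' : ℝ, t < T' ∧ IsMild S f F (Ioo 0 T') v := by
      intro t ht
      obtain ⟨T', ⟨w, hw⟩, h⟩ := hlt t ht.2
      exact ⟨T', h, hw.2.1.congr (fun s hs => hs.1)
        (fun s hs r hr => ⟨hr.1, hr.2.trans_lt hs.2⟩) (fun s hs => hveq hw s hs)⟩
    refine ⟨fun t ht => ?_, fun t ht => ?_⟩
    · obtain ⟨T', h, hm⟩ := hloc t ht
      exact (hm.1.continuousAt (Ioo_mem_nhds ht.1 h)).continuousWithinAt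
    · obtain ⟨T', h, hm⟩ := hloc t ht
      exact hm.2 t ⟨ht.1, h⟩
  have hvD : ∀ t ∈ openInterval Tm, v t ∈ D := by
    intro t ht
    obtain ⟨T', ⟨w, hw⟩, h⟩ := hlt t ht.2
    rw [hveq hw t ⟨ht.1, h⟩]
    exact hw.2.2.1 t ⟨ht.1, h⟩
  have hvu : ∀ t ∈ Ioc 0 T, v t = u t := by
    intro t ht
    obtain ⟨T', ⟨w, hw⟩, h⟩ := hlt T hTTm
    rw [hveq hw t ⟨ht.1, ht.2.trans_lt h⟩, hw.2.2.2 t ht]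
  have hblow : ∀ Ts : ℝ, Tm = Ts → Tendsto (fun t => ‖v t‖) (𝓝[<] Ts) atTop := by
    intro Ts hTs
    have hTTs : T < Ts := by rw [hTs] at hTTm; exact EReal.coe_lt_coe_iff.1 hTTm
    rw [tendsto_atTop]
    intro R
    obtain ⟨τ, hτ, H⟩ := hext R
    -- If the norm stayed below `R` at times approaching `Ts`, a restart at some `t₀ > Ts - τ` would
    -- extend the solution beyond `Ts`.
    by_contra hcon
    rw [not_eventually] at hcon
    obtain ⟨t₀, h1, h2⟩ := (hcon.and_eventually
      (Ioo_mem_nhdsLT (show max T (Ts - τ) < Ts from max_lt hTTs (by linarith)))).exists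
    have hTt : T < t₀ := (le_max_left _ _).trans_lt h2.1
    have hs : Ioc 0 t₀ ⊆ openInterval Tm := fun s hs =>
      ⟨hs.1, by rw [hTs]; exact EReal.coe_lt_coe_iff.2 (hs.2.trans_lt h2.2)⟩
    obtain ⟨w', hw'⟩ := H t₀ v hTt.le (hvm.mono hs) (fun t ht => hvD t (hs ht)) hvu
      (not_le.1 h1).le
    have h3 := hle _ ⟨w', hw'⟩
    rw [hTs, EReal.coe_le_coe_iff] at h3
    linarith [(le_max_right T (Ts - τ)).trans_lt h2.1]
  refine ⟨Tm, v, hTTm, hvu, hvm, hvD, ?_, hblow⟩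
  rintro T' w hw ⟨ε, hε, hwv⟩
  have hcoin : ∀ t, t ∈ openInterval T' → t ∈ openInterval Tm → w t = v t := by
    intro t h1 h2
    by_cases hte : t < ε
    · exact hwv t h1 hte
    · have hs1 : Ioc 0 t ⊆ openInterval T' := fun s hs =>
        ⟨hs.1, (EReal.coe_le_coe_iff.2 hs.2).trans_lt h1.2⟩
      have hs2 : Ioc 0 t ⊆ openInterval Tm := fun s hs =>
        ⟨hs.1, (EReal.coe_le_coe_iff.2 hs.2).trans_lt h2.2⟩
      have hε2 : ε / 2 ≤ t := by linarith
      refine IsMild.eq_of_eq_at (hw.mono hs1) (hvm.mono hs2) hf hF (half_pos hε) hε2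
        (fun s hs => ⟨(half_pos hε).trans_le hs.1, hs.2⟩) ?_
      exact hwv _ (hs1 ⟨half_pos hε, hε2⟩) (half_lt_self hε)
  -- `w` need not take values in `D`, so it does not compete in the supremum that defines `Tm`.
  -- Instead, its continuity at `Ts` would give `‖v t‖` a finite limit there, against the blow-up.
  have hT' : T' ≤ Tm := by
    by_contra hcon
    rw [not_le] at hcon
    have hTm_ne : Tm ≠ ⊤ := (hcon.trans_le le_top).ne
    have hTm_bot : Tm ≠ ⊥ := (bot_lt_iff_ne_bot.1 ((EReal.bot_lt_coe T).trans hTTm))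
    obtain ⟨Ts, hTs⟩ : ∃ Ts : ℝ, Tm = Ts := ⟨Tm.toReal, (EReal.coe_toReal hTm_ne hTm_bot).symm⟩
    have hTTs : T < Ts := by rw [hTs] at hTTm; exact EReal.coe_lt_coe_iff.1 hTTm
    have hTs0 : 0 < Ts := hT.trans hTTs
    rw [hTs] at hcon
    have hcw : ContinuousWithinAt w (openInterval T') Ts := hw.1 Ts ⟨hTs0, hcon⟩
    have hlim : Tendsto (fun t => ‖v t‖) (𝓝[<] Ts) (𝓝 ‖w Ts‖) := by
      have hmem : ∀ t ∈ Ioo 0 Ts, t ∈ openInterval T' := fun t ht =>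
        ⟨ht.1, (EReal.coe_lt_coe_iff.2 ht.2).trans hcon⟩
      have h1 : Tendsto w (𝓝[<] Ts) (𝓝 (w Ts)) := by
        refine hcw.tendsto.mono_left ?_
        refine le_inf nhdsWithin_le_nhds (le_principal_iff.2 ?_)
        exact mem_of_superset (Ioo_mem_nhdsLT hTs0) hmem
      refine h1.norm.congr' ?_
      filter_upwards [Ioo_mem_nhdsLT hTs0] with t ht
      rw [hcoin t (hmem t ht) ⟨ht.1, by rw [hTs]; exact EReal.coe_lt_coe_iff.2 ht.2⟩]
    exact not_tendsto_nhds_of_tendsto_atTop (hblow Ts hTs) _ hlim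
  exact ⟨hT', fun t ht => hcoin t ht ⟨ht.1, ht.2.trans_le hT'⟩⟩

end

section

/-! ### Gaussian convolutions -/

/-- The one-dimensional Gauss kernel. -/
def gauss (t z : ℝ) : ℝ := (4 * Real.pi * t) ^ (-(1 : ℝ) / 2) * Real.exp (-(z ^ 2 / (4 * t)))

theorem gauss_pos {t : ℝ} (ht : 0 < t) (z : ℝ) : 0 < gauss t z := by unfold gauss; positivity

theorem gauss_neg (t z : ℝ) : gauss t (-z) = gauss t z := by simp [gauss]

theorem continuous_gauss (t : ℝ) : Continuous (gauss t) := by unfold gauss; fun_prop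

theorem gauss_eq (t z : ℝ) :
    gauss t z = (4 * Real.pi * t) ^ (-(1 : ℝ) / 2) * Real.exp (-(1 / (4 * t)) * z ^ 2) := by
  unfold gauss; congr 2; ring

theorem integrable_gauss {t : ℝ} (ht : 0 < t) : Integrable (gauss t) := by
  have : gauss t = fun z => (4 * Real.pi * t) ^ (-(1 : ℝ) / 2) * Real.exp (-(1 / (4 * t)) * z ^ 2) :=
    funext (gauss_eq t)
  rw [this]
  exact (integrable_exp_neg_mul_sq (by positivity)).const_mul _

theorem integrable_mul_gauss {t : ℝ} (ht : 0 < t) : Integrable fun z => z * gauss t z := by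
  have : (fun z => z * gauss t z) =
      fun z => (4 * Real.pi * t) ^ (-(1 : ℝ) / 2) * (z * Real.exp (-(1 / (4 * t)) * z ^ 2)) := by
    funext z; rw [gauss_eq]; ring
  rw [this]
  exact (integrable_mul_exp_neg_mul_sq (by positivity)).const_mul _

theorem integral_gauss {t : ℝ} (ht : 0 < t) : ∫ z, gauss t z = 1 := by
  simp_rw [gauss_eq]
  rw [integral_const_mul, integral_gaussian, Real.sqrt_eq_rpow,
    show Real.pi / (1 / (4 * t)) = 4 * Real.pi * t by field_simp, ← Real.rpow_add (by positivity)]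
  norm_num

theorem integral_mul_gauss (t : ℝ) : ∫ z, z * gauss t z = 0 := by
  have h := integral_neg_eq_self (fun z => z * gauss t z) volume
  simp only [gauss_neg, neg_mul, integral_neg] at h
  linarith

/-- Completing the square: as a function of `y` the product is a Gaussian of variance parameter `s *
t / (s + t)` centred at `x * s / (s + t)`. -/
theorem gauss_mul_gauss {s t : ℝ} (hs : 0 < s) (ht : 0 < t) (x y : ℝ) :
    gauss s y * gauss t (x - y) =
      gauss (s + t) x * gauss (s * t / (s + t)) (y - x * s / (s + t)) := by
  have hst : 0 < s + t := by positivity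
  unfold gauss
  have h : ∀ {a b c d a' b' c' d' : ℝ}, a * c = a' * c' → b * d = b' * d' →
      a * b * (c * d) = a' * b' * (c' * d') := fun h1 h2 => by
    rw [mul_mul_mul_comm, h1, h2, mul_mul_mul_comm]
  refine h ?_ ?_
  · rw [← Real.mul_rpow (by positivity) (by positivity),
      ← Real.mul_rpow (by positivity) (by positivity)]
    congr 1
    field_simp
  · rw [← Real.exp_add, ← Real.exp_add]
    congr 1
    field_simp
    ring

theorem integral_gauss_mul_gauss {s t : ℝ} (hs : 0 < s) (ht : 0 < t) (x : ℝ) :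
    ∫ y, gauss s y * gauss t (x - y) = gauss (s + t) x := by
  simp_rw [gauss_mul_gauss hs ht]
  rw [integral_const_mul, integral_sub_right_eq_self (gauss (s * t / (s + t))),
    integral_gauss (by positivity), mul_one]

/-- After the square is completed, the first moment is the centre `μ`, and `μ / (2 * s) = x / (2 *
(s + t))`. -/
theorem integral_mul_gauss_mul_gauss {s t : ℝ} (hs : 0 < s) (ht : 0 < t) (x : ℝ) :
    ∫ y, y / (2 * s) * gauss s y * gauss t (x - y) = x / (2 * (s + t)) * gauss (s + t) x := by
  have hst : 0 < s + t := by positivity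
  set r := s * t / (s + t) with hr
  have hr0 : 0 < r := by positivity
  set μ := x * s / (s + t) with hμ
  have e : ∀ y, y / (2 * s) * gauss s y * gauss t (x - y) =
      gauss (s + t) x / (2 * s) * (fun z => z * gauss r z + μ * gauss r z) (y - μ) := fun y => by
    rw [mul_assoc, gauss_mul_gauss hs ht, ← hr, ← hμ]; ring
  simp_rw [e]
  rw [integral_const_mul, integral_sub_right_eq_self (fun z => z * gauss r z + μ * gauss r z),
    integral_add (integrable_mul_gauss hr0) ((integrable_gauss hr0).const_mul _),
    integral_mul_gauss, integral_const_mul, integral_gauss hr0, hμ]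
  field_simp
  ring

/-- Doubling the time gives up half of the exponent, which pays for polynomial factors. The exact
constant is `√2`. -/
theorem gauss_le {t : ℝ} (ht : 0 < t) (z : ℝ) :
    gauss t z * Real.exp (z ^ 2 / (8 * t)) ≤ 2 * gauss (2 * t) z := by
  have h2 : (4 * Real.pi * (2 * t)) ^ (-(1 : ℝ) / 2) =
      2 ^ (-(1 : ℝ) / 2) * (4 * Real.pi * t) ^ (-(1 : ℝ) / 2) := by
    rw [← Real.mul_rpow (by norm_num) (by positivity)]; congr 1; ring
  have h3 : (1 : ℝ) / 2 ≤ 2 ^ (-(1 : ℝ) / 2) := by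
    rw [show (1 : ℝ) / 2 = 2 ^ (-1 : ℝ) by rw [Real.rpow_neg_one]; norm_num]
    exact Real.rpow_le_rpow_of_exponent_le (by norm_num) (by norm_num)
  unfold gauss
  rw [h2, mul_assoc, ← Real.exp_add,
    show -(z ^ 2 / (4 * t)) + z ^ 2 / (8 * t) = -(z ^ 2 / (4 * (2 * t))) by field_simp; ring]
  have h4 : 0 ≤ (4 * Real.pi * t) ^ (-(1 : ℝ) / 2) * Real.exp (-(z ^ 2 / (4 * (2 * t)))) := by
    positivity
  nlinarith

theorem gauss_le_two_mul {t : ℝ} (ht : 0 < t) (z : ℝ) : gauss t z ≤ 2 * gauss (2 * t) z := by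
  refine le_trans ?_ (gauss_le ht z)
  exact le_mul_of_one_le_right (gauss_pos ht z).le (Real.one_le_exp (by positivity))

theorem sq_div_mul_gauss_le {t : ℝ} (ht : 0 < t) (z : ℝ) :
    z ^ 2 / (2 * t) * gauss t z ≤ 8 * gauss (2 * t) z := by
  have h1 : z ^ 2 / (2 * t) ≤ 4 * Real.exp (z ^ 2 / (8 * t)) := by
    have := Real.add_one_le_exp (z ^ 2 / (8 * t))
    have e : z ^ 2 / (2 * t) = 4 * (z ^ 2 / (8 * t)) := by field_simp; ring
    rw [e]; linarith
  calc _ ≤ 4 * Real.exp (z ^ 2 / (8 * t)) * gauss t z := by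
        gcongr; exact (gauss_pos ht z).le
    _ ≤ _ := by linarith [gauss_le ht z]

theorem abs_div_mul_gauss_le {t : ℝ} (ht : 0 < t) (z : ℝ) :
    |z| / (2 * t) * gauss t z ≤ (1 + 1 / t) * (4 * gauss (2 * t) z) := by
  have h0 := gauss_pos ht z
  have h1 : |z| / (2 * t) ≤ (1 + 1 / t) * (1 / 2 + z ^ 2 / (2 * t) / 4) := by
    rw [← sq_abs z]
    have hz := abs_nonneg z
    set a := |z|
    -- Over the common denominator `8 * t ^ 2` the difference is a sum of nonnegative terms.
    have h2 : (1 + 1 / t) * (1 / 2 + a ^ 2 / (2 * t) / 4) - a / (2 * t) =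
        (a ^ 2 * t + (a - 2 * t) ^ 2 + 4 * t) /
          (8 * t ^ 2) := by
      field_simp; ring
    have h3 : 0 ≤ (a ^ 2 * t + (a - 2 * t) ^ 2 + 4 * t) / (8 * t ^ 2) := by positivity
    linarith
  have h4 : (1 / 2 + z ^ 2 / (2 * t) / 4) * gauss t z ≤ 4 * gauss (2 * t) z := by
    have := gauss_le_two_mul ht z
    have := sq_div_mul_gauss_le ht z
    have := gauss_pos (show 0 < 2 * t by positivity) z
    nlinarith
  calc _ ≤ (1 + 1 / t) * (1 / 2 + z ^ 2 / (2 * t) / 4) * gauss t z := by gcongr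
    _ ≤ _ := by rw [mul_assoc]; gcongr

variable {N : ℕ}

theorem gaussKernel_eq_prod {t : ℝ} (ht : 0 < t) (x : Eu N) :
    gaussKernel t x = ∏ i, gauss t (x i) := by
  unfold gaussKernel gauss
  rw [Finset.prod_mul_distrib, Finset.prod_const, Finset.card_univ, Fintype.card_fin,
    ← Real.exp_sum, ← Real.rpow_mul_natCast (by positivity), EuclideanSpace.norm_sq_eq]
  congr 2
  · ring
  · simp only [Real.norm_eq_abs, sq_abs, Finset.sum_neg_distrib, Finset.sum_div]

theorem gaussKernel_pos {t : ℝ} (ht : 0 < t) (x : Eu N) : 0 < gaussKernel t x := by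
  unfold gaussKernel; positivity

theorem gaussKernel_nonneg {t : ℝ} (ht : 0 < t) (x : Eu N) : 0 ≤ gaussKernel t x :=
  (gaussKernel_pos ht x).le

theorem gaussKernel_neg (t : ℝ) (x : Eu N) : gaussKernel t (-x) = gaussKernel t x := by
  simp [gaussKernel]

theorem integral_prod_coord (f : Fin N → ℝ → ℝ) :
    ∫ y : Eu N, ∏ i, f i (y i) = ∏ i, ∫ z, f i z := by
  rw [← (PiLp.volume_preserving_toLp (Fin N)).integral_comp
    (MeasurableEquiv.toLp 2 _).measurableEmbedding]
  exact integral_fintype_prod_volume_eq_prod f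

theorem integral_gaussKernel {t : ℝ} (ht : 0 < t) : ∫ y : Eu N, gaussKernel t y = 1 := by
  simp_rw [gaussKernel_eq_prod ht]
  rw [integral_prod_coord (fun _ => gauss t)]
  simp [integral_gauss ht]

theorem integral_gaussKernel_sub {t : ℝ} (ht : 0 < t) (x : Eu N) :
    ∫ y : Eu N, gaussKernel t (x - y) = 1 := by
  rw [integral_sub_left_eq_self (fun y => gaussKernel t y) volume x, integral_gaussKernel ht]

theorem integrable_gaussKernel_sub {t : ℝ} (ht : 0 < t) (x : Eu N) :
    Integrable fun y : Eu N => gaussKernel t (x - y) :=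
  (gaussKernel_integrable ht).comp_sub_left x

/-- `∏_{i<m} x_i / (2 t) · G_t(x)`, i.e. `(-1)^m ∂₁⋯∂ₘ G_t`. -/
def psi (m : ℕ) (t : ℝ) (x : Eu N) : ℝ :=
  ∏ i : Fin N, (if i.val < m then x i / (2 * t) else 1) * gauss t (x i)

/-- Everything factors over the coordinates, so only the one-dimensional zeroth and first moments
occur. -/
theorem integral_psi_mul_gaussKernel (m : ℕ) {s t : ℝ} (hs : 0 < s) (ht : 0 < t) (x : Eu N) :
    ∫ y, gaussKernel t (x - y) * psi m s y = psi m (s + t) x := by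
  set φ : Fin N → ℝ → ℝ := fun i z =>
    (if i.val < m then z / (2 * s) else 1) * gauss s z * gauss t (x i - z) with hφ
  have e : ∀ y : Eu N, gaussKernel t (x - y) * psi m s y = ∏ i : Fin N, φ i (y i) := fun y => by
    rw [gaussKernel_eq_prod ht, psi, mul_comm, ← Finset.prod_mul_distrib]
    rfl
  rw [integral_congr_ae (Eventually.of_forall e), integral_prod_coord φ]
  unfold psi
  refine Finset.prod_congr rfl fun i _ => ?_
  simp only [hφ]
  split_ifs
  · exact integral_mul_gauss_mul_gauss hs ht _
  · simp_rw [one_mul]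
    exact integral_gauss_mul_gauss hs ht _

theorem psi_zero {t : ℝ} (ht : 0 < t) (x : Eu N) : psi 0 t x = gaussKernel t x := by
  simp [psi, gaussKernel_eq_prod ht]

theorem integral_gaussKernel_mul_gaussKernel {s t : ℝ} (hs : 0 < s) (ht : 0 < t) (x : Eu N) :
    ∫ y, gaussKernel t (x - y) * gaussKernel s y = gaussKernel (s + t) x := by
  simpa only [psi_zero hs, psi_zero (add_pos hs ht)] using integral_psi_mul_gaussKernel 0 hs ht x

/-! ### The heat semigroup on `C₀` -/

theorem C0_abs_le (f : C₀(Eu N, ℝ)) (x : Eu N) : |f x| ≤ ‖f‖ := f.toBCF.norm_coe_le_norm x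

theorem C0_norm_le {f : C₀(Eu N, ℝ)} {c : ℝ} (hc : 0 ≤ c) (h : ∀ x, |f x| ≤ c) : ‖f‖ ≤ c := by
  rw [← ZeroAtInftyContinuousMap.norm_toBCF_eq_norm]
  exact (BoundedContinuousFunction.norm_le hc).2 h

theorem heatC0_apply {t : ℝ} (ht : 0 < t) (f : C₀(Eu N, ℝ)) (x : Eu N) :
    heatC0 t f x = ∫ y, gaussKernel t (x - y) * f y := by
  unfold heatC0; rw [dif_pos ht]; rfl

theorem heatC0_of_nonpos {t : ℝ} (ht : t ≤ 0) (f : C₀(Eu N, ℝ)) : heatC0 t f = f := by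
  unfold heatC0; rw [dif_neg (not_lt.2 ht)]

theorem integrable_gaussKernel_mul {t : ℝ} (ht : 0 < t) (f : C₀(Eu N, ℝ)) (x : Eu N) :
    Integrable fun y => gaussKernel t (x - y) * f y := by
  have := (integrable_gaussKernel_sub ht x).bdd_mul (c := ‖f‖)
    (f.continuous.aestronglyMeasurable) (Eventually.of_forall fun y => C0_abs_le f y)
  simpa [mul_comm] using this

theorem heatC0_norm_le (t : ℝ) (f : C₀(Eu N, ℝ)) : ‖heatC0 t f‖ ≤ ‖f‖ := by
  rcases le_or_gt t 0 with ht | ht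
  · rw [heatC0_of_nonpos ht]
  refine C0_norm_le (norm_nonneg _) fun x => ?_
  rw [heatC0_apply ht, ← Real.norm_eq_abs]
  calc _ ≤ ∫ y, gaussKernel t (x - y) * ‖f‖ := by
        refine norm_integral_le_of_norm_le ((integrable_gaussKernel_sub ht x).mul_const _)
          (Eventually.of_forall fun y => ?_)
        rw [norm_mul, Real.norm_of_nonneg (gaussKernel_nonneg ht _)]
        exact mul_le_mul_of_nonneg_left (C0_abs_le f y) (gaussKernel_nonneg ht _)
    _ = ‖f‖ := by rw [integral_mul_const, integral_gaussKernel_sub ht, one_mul]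

/-- Fubini reduces the semigroup law to the convolution identity for Gauss kernels. -/
theorem heatC0_add {s t : ℝ} (hs : 0 ≤ s) (ht : 0 ≤ t) (f : C₀(Eu N, ℝ)) :
    heatC0 (s + t) f = heatC0 s (heatC0 t f) := by
  rcases hs.eq_or_lt with rfl | hs
  · rw [zero_add, heatC0_of_nonpos (f := heatC0 t f) le_rfl]
  rcases ht.eq_or_lt with rfl | ht
  · rw [add_zero, heatC0_of_nonpos (f := f) le_rfl]
  ext x
  rw [heatC0_apply (add_pos hs ht), heatC0_apply hs]
  simp_rw [heatC0_apply ht, ← integral_const_mul]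
  have hint : Integrable (Function.uncurry fun y z : Eu N =>
      gaussKernel s (x - y) * (gaussKernel t (y - z) * f z)) := by
    have h1 := (Integrable.convolution_integrand (ContinuousLinearMap.mul ℝ ℝ)
      (integrable_gaussKernel_sub hs x) (gaussKernel_integrable (N := N) ht)).swap
    have h2 := h1.bdd_mul (c := ‖f‖) (f := fun q : Eu N × Eu N => f q.2)
      (f.continuous.comp continuous_snd).aestronglyMeasurable
      (Eventually.of_forall fun q => C0_abs_le f q.2)
    refine h2.congr (Eventually.of_forall fun q => ?_)
    simp only [Function.comp_apply, Prod.swap, ContinuousLinearMap.mul_apply', Function.uncurry]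
    rw [← gaussKernel_neg t (q.2 - q.1), neg_sub]; ring
  rw [integral_integral_swap hint]
  refine integral_congr_ae (Eventually.of_forall fun z => ?_)
  have e : ∀ y, gaussKernel s (x - y) * (gaussKernel t (y - z) * f z) =
      (fun w => gaussKernel s (x - z - w) * gaussKernel t w) (y - z) * f z := fun y => by
    simp only [sub_sub_sub_cancel_right]; ring
  simp_rw [e]
  rw [integral_mul_const, integral_sub_right_eq_self
    (fun w => gaussKernel s (x - z - w) * gaussKernel t w),
    integral_gaussKernel_mul_gaussKernel ht hs, add_comm]

theorem norm_sq_mul_gaussKernel_le {t : ℝ} (ht : 0 < t) (y : Eu N) :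
    ‖y‖ ^ 2 * gaussKernel t y ≤ 8 * t * 2 ^ N * gaussKernel (2 * t) y := by
  have h1 : gaussKernel t y * Real.exp (‖y‖ ^ 2 / (8 * t)) ≤ 2 ^ N * gaussKernel (2 * t) y := by
    rw [gaussKernel_eq_prod ht, gaussKernel_eq_prod (by positivity), EuclideanSpace.norm_sq_eq,
      Finset.sum_div, Real.exp_sum, ← Finset.prod_mul_distrib]
    have : (2 : ℝ) ^ N * ∏ i, gauss (2 * t) (y i) = ∏ i, 2 * gauss (2 * t) (y i) := by
      simp [Finset.prod_mul_distrib]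
    rw [this]
    refine Finset.prod_le_prod (fun i _ => mul_nonneg (gauss_pos ht _).le (Real.exp_pos _).le)
      fun i _ => ?_
    simpa using gauss_le ht (y i)
  have h2 : ‖y‖ ^ 2 ≤ 8 * t * Real.exp (‖y‖ ^ 2 / (8 * t)) := by
    have := Real.add_one_le_exp (‖y‖ ^ 2 / (8 * t))
    have h3 : ‖y‖ ^ 2 / (8 * t) ≤ Real.exp (‖y‖ ^ 2 / (8 * t)) := by linarith
    rwa [div_le_iff₀ (by positivity), mul_comm] at h3
  calc _ ≤ 8 * t * Real.exp (‖y‖ ^ 2 / (8 * t)) * gaussKernel t y := by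
        gcongr; exact gaussKernel_nonneg ht y
    _ = 8 * t * (gaussKernel t y * Real.exp (‖y‖ ^ 2 / (8 * t))) := by ring
    _ ≤ 8 * t * (2 ^ N * gaussKernel (2 * t) y) := by gcongr
    _ = _ := by ring

/-- A Chebyshev argument: by uniform continuity `|f y - f x|` is at most `ε / 2` plus a multiple of
`‖x - y‖ ^ 2`, and the second moment of the Gauss kernel is `O(t)`, uniformly in `x`. -/
theorem tendsto_heatC0_sub (f : C₀(Eu N, ℝ)) :
    Tendsto (fun t => ‖heatC0 t f - f‖) (𝓝 0) (𝓝 0) := by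
  rw [Metric.tendsto_nhds]
  intro ε hε
  obtain ⟨δ, hδ, hf⟩ := Metric.uniformContinuous_iff.1 (ZeroAtInftyContinuousMap.uniformContinuous f)
    (ε / 2) (half_pos hε)
  set C : ℝ := 2 * ‖f‖ / δ ^ 2 * (8 * 2 ^ N) with hC
  have hC0 : 0 ≤ C := by positivity
  have hbound : ∀ x y : Eu N, |f y - f x| ≤ ε / 2 + 2 * ‖f‖ / δ ^ 2 * ‖x - y‖ ^ 2 := by
    intro x y
    by_cases h : ‖x - y‖ < δ
    · have h1 := hf (a := y) (b := x) (by rwa [dist_comm, dist_eq_norm])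
      rw [Real.dist_eq] at h1
      have : 0 ≤ 2 * ‖f‖ / δ ^ 2 * ‖x - y‖ ^ 2 := by positivity
      linarith
    · have h1 : |f y - f x| ≤ 2 * ‖f‖ := by
        have := abs_sub (f y) (f x)
        linarith [C0_abs_le f x, C0_abs_le f y]
      have h2 : 1 ≤ ‖x - y‖ ^ 2 / δ ^ 2 := by
        rw [one_le_div (by positivity)]
        exact pow_le_pow_left₀ hδ.le (not_lt.1 h) 2
      have h3 : 2 * ‖f‖ ≤ 2 * ‖f‖ * (‖x - y‖ ^ 2 / δ ^ 2) :=
        le_mul_of_one_le_right (by positivity) h2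
      have h4 : 2 * ‖f‖ / δ ^ 2 * ‖x - y‖ ^ 2 = 2 * ‖f‖ * (‖x - y‖ ^ 2 / δ ^ 2) := by ring
      rw [h4]; linarith
  have key : ∀ t : ℝ, ‖heatC0 t f - f‖ ≤ ε / 2 + C * |t| := by
    intro t
    rcases le_or_gt t 0 with ht | ht
    · rw [heatC0_of_nonpos ht, sub_self, norm_zero]; positivity
    refine C0_norm_le (by positivity) fun x => ?_
    have e : (heatC0 t f - f) x = ∫ y, gaussKernel t (x - y) * (f y - f x) := by
      simp_rw [mul_sub]
      rw [integral_sub (integrable_gaussKernel_mul ht f x)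
        ((integrable_gaussKernel_sub ht x).mul_const _), integral_mul_const,
        integral_gaussKernel_sub ht, one_mul, ← heatC0_apply ht]
      rfl
    have hi1 := (integrable_gaussKernel_sub ht x).const_mul (ε / 2)
    have hi2 := (integrable_gaussKernel_sub (show 0 < 2 * t by positivity) x).const_mul (C * t)
    rw [e, ← Real.norm_eq_abs]
    calc _ ≤ ∫ y, (ε / 2 * gaussKernel t (x - y) + C * t * gaussKernel (2 * t) (x - y)) := by
          refine norm_integral_le_of_norm_le (hi1.add hi2) (Eventually.of_forall fun y => ?_)
          have hg := gaussKernel_nonneg ht (x - y)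
          rw [norm_mul, Real.norm_of_nonneg hg, Real.norm_eq_abs]
          have h2 := norm_sq_mul_gaussKernel_le ht (x - y)
          calc _ ≤ gaussKernel t (x - y) * (ε / 2 + 2 * ‖f‖ / δ ^ 2 * ‖x - y‖ ^ 2) := by
                gcongr; exact hbound x y
            _ = ε / 2 * gaussKernel t (x - y) +
                2 * ‖f‖ / δ ^ 2 * (‖x - y‖ ^ 2 * gaussKernel t (x - y)) := by ring
            _ ≤ ε / 2 * gaussKernel t (x - y) +
                2 * ‖f‖ / δ ^ 2 * (8 * t * 2 ^ N * gaussKernel (2 * t) (x - y)) := by gcongr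
            _ = _ := by rw [hC]; ring
      _ = ε / 2 + C * |t| := by
          rw [integral_add hi1 hi2, integral_const_mul, integral_const_mul,
            integral_gaussKernel_sub ht, integral_gaussKernel_sub (by positivity), abs_of_pos ht]
          ring
  have h1 : Tendsto (fun t : ℝ => ε / 2 + C * |t|) (𝓝 0) (𝓝 (ε / 2)) := by
    have : Continuous fun t : ℝ => ε / 2 + C * |t| := by fun_prop
    simpa using this.tendsto 0
  filter_upwards [h1.eventually (eventually_lt_nhds (half_lt_self hε))] with t ht
  rw [Real.dist_eq, sub_zero, abs_of_nonneg (norm_nonneg _)]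
  exact (key t).trans_lt ht

theorem heatC0_map_add (t : ℝ) (f g : C₀(Eu N, ℝ)) :
    heatC0 t (f + g) = heatC0 t f + heatC0 t g := by
  rcases le_or_gt t 0 with ht | ht
  · simp [heatC0_of_nonpos ht]
  ext x
  rw [ZeroAtInftyContinuousMap.add_apply]
  simp only [heatC0_apply ht]
  rw [← integral_add (integrable_gaussKernel_mul ht f x) (integrable_gaussKernel_mul ht g x)]
  simp [mul_add]

theorem heatC0_map_smul (t c : ℝ) (f : C₀(Eu N, ℝ)) : heatC0 t (c • f) = c • heatC0 t f := by
  rcases le_or_gt t 0 with ht | ht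
  · simp [heatC0_of_nonpos ht]
  ext x
  rw [ZeroAtInftyContinuousMap.smul_apply]
  simp only [heatC0_apply ht]
  rw [smul_eq_mul, ← integral_const_mul]
  congr 1; ext y; simp; ring

theorem heatC0_max (t : ℝ) (f : C₀(Eu N, ℝ)) : heatC0 (max t 0) f = heatC0 t f := by
  rcases le_or_gt t 0 with ht | ht
  · rw [max_eq_right ht, heatC0_of_nonpos ht, heatC0_of_nonpos le_rfl]
  · rw [max_eq_left ht.le]

theorem heatC0_map_sub (t : ℝ) (f g : C₀(Eu N, ℝ)) :
    heatC0 t (f - g) = heatC0 t f - heatC0 t g := by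
  have h : heatC0 t (-g) = -heatC0 t g := by
    rw [← neg_one_smul ℝ g, heatC0_map_smul]
    exact neg_one_smul ℝ (heatC0 t g)
  rw [sub_eq_add_neg, heatC0_map_add, h, ← sub_eq_add_neg]

theorem norm_heatC0_sub_heatC0_le {s t : ℝ} (hs : 0 ≤ s) (hst : s ≤ t) (f : C₀(Eu N, ℝ)) :
    ‖heatC0 t f - heatC0 s f‖ ≤ ‖heatC0 (t - s) f - f‖ := by
  have h1 : heatC0 t f = heatC0 s (heatC0 (t - s) f) := by
    rw [← heatC0_add hs (sub_nonneg.2 hst)]; congr 1; ring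
  rw [h1, ← heatC0_map_sub]
  exact heatC0_norm_le _ _

/-- The heat semigroup on `C₀(ℝ^N)`. -/
def heatSemigroup (N : ℕ) : ContrSemigroup C₀(Eu N, ℝ) where
  toFun t := LinearMap.mkContinuous
    { toFun := heatC0 t, map_add' := heatC0_map_add t, map_smul' := heatC0_map_smul t } 1
    fun f => by simpa using heatC0_norm_le t f
  map_zero f := heatC0_of_nonpos le_rfl f
  map_add s t hs ht f := heatC0_add hs ht f
  norm_le t f := heatC0_norm_le t f
  continuous_apply f := by
    rw [continuous_iff_continuousAt]
    intro s
    rw [ContinuousAt, tendsto_iff_norm_sub_tendsto_zero]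
    have hc : Continuous fun t : ℝ => |max t 0 - max s 0| := by fun_prop
    have h1 : Tendsto (fun t => ‖heatC0 |max t 0 - max s 0| f - f‖) (𝓝 s) (𝓝 0) := by
      refine (tendsto_heatC0_sub f).comp ?_
      simpa using hc.tendsto s
    refine squeeze_zero (fun _ => norm_nonneg _) (fun t => ?_) h1
    change ‖heatC0 t f - heatC0 s f‖ ≤ _
    rw [← heatC0_max t, ← heatC0_max s]
    rcases le_total (max s 0) (max t 0) with h | h
    · rw [abs_of_nonneg (sub_nonneg.2 h)]
      exact norm_heatC0_sub_heatC0_le (le_max_right _ _) h f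
    · rw [abs_of_nonpos (sub_nonpos.2 h), norm_sub_rev, neg_sub]
      exact norm_heatC0_sub_heatC0_le (le_max_right _ _) h f

theorem heatSemigroup_apply (t : ℝ) (f : C₀(Eu N, ℝ)) : heatSemigroup N t f = heatC0 t f := rfl

end

section

variable {N : ℕ}

/-! ### Reflections and the heat semigroup on anti-symmetric functions -/

theorem reflect_apply (i j : Fin N) (x : Eu N) : reflect i x j = if j = i then -x i else x j := by
  simp [reflect, Function.update_apply]

theorem reflect_self (i : Fin N) (x : Eu N) : reflect i x i = -x i := by simp [reflect_apply]

theorem reflect_of_ne {i j : Fin N} (h : j ≠ i) (x : Eu N) : reflect i x j = x j := by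
  simp [reflect_apply, h]

theorem reflect_eq_self {i : Fin N} {x : Eu N} (h : x i = 0) : reflect i x = x := by
  ext j
  rcases eq_or_ne j i with rfl | h'
  · simp [reflect_self, h]
  · simp [reflect_of_ne h']

/-- The reflection in the `i`-th coordinate as a linear isometry. -/
def reflectL (i : Fin N) : Eu N ≃ₗᵢ[ℝ] Eu N :=
  LinearIsometryEquiv.piLpCongrRight 2
    fun j => if j = i then LinearIsometryEquiv.neg ℝ else LinearIsometryEquiv.refl ℝ ℝ

theorem reflectL_apply (i : Fin N) (x : Eu N) : reflectL i x = reflect i x := by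
  ext j
  rw [reflect_apply]
  simp only [reflectL, LinearIsometryEquiv.piLpCongrRight_apply]
  split_ifs with h
  · subst h; simp
  · simp

theorem reflect_sub (i : Fin N) (x y : Eu N) : reflect i (x - y) = reflect i x - reflect i y := by
  simp only [← reflectL_apply, map_sub]

theorem norm_reflect (i : Fin N) (x : Eu N) : ‖reflect i x‖ = ‖x‖ := by
  rw [← reflectL_apply, LinearIsometryEquiv.norm_map]

theorem measurePreserving_reflect (i : Fin N) :
    MeasurePreserving (reflect i : Eu N → Eu N) volume volume := by
  have : (reflect i : Eu N → Eu N) = reflectL i := funext fun x => (reflectL_apply i x).symm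
  rw [this]; exact (reflectL i).measurePreserving

theorem measurableEmbedding_reflect (i : Fin N) : MeasurableEmbedding (reflect i : Eu N → Eu N) := by
  have : (reflect i : Eu N → Eu N) = reflectL i := funext fun x => (reflectL_apply i x).symm
  rw [this]; exact (reflectL i).toHomeomorph.measurableEmbedding

theorem integral_comp_reflect {E : Type*} [NormedAddCommGroup E] [NormedSpace ℝ E] (i : Fin N)
    (f : Eu N → E) : ∫ x, f (reflect i x) = ∫ x, f x :=
  (measurePreserving_reflect i).integral_comp (measurableEmbedding_reflect i) f

theorem integrable_comp_reflect {E : Type*} [NormedAddCommGroup E] (i : Fin N) {f : Eu N → E}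
    (hf : Integrable f) : Integrable fun x => f (reflect i x) :=
  (measurePreserving_reflect i).integrable_comp_of_integrable hf

/-- The polynomial `x₁ ⋯ xₘ`. -/
def coordProd (m : ℕ) (x : Eu N) : ℝ := ∏ i : Fin N, if i.val < m then x i else 1

theorem continuous_coordProd (m : ℕ) : Continuous (coordProd m : Eu N → ℝ) := by
  unfold coordProd
  refine continuous_finsetProd _ fun i _ => ?_
  split_ifs <;> fun_prop

theorem coordProd_pos {m : ℕ} {x : Eu N} (hx : x ∈ sector N m) : 0 < coordProd m x := by
  refine Finset.prod_pos fun i _ => ?_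
  split_ifs with h
  · exact hx i h
  · exact one_pos

/-- A point with a vanishing coordinate is fixed by the reflection in that coordinate. -/
theorem AntiSymm.eq_zero {m : ℕ} {f : Eu N → ℝ} (hf : AntiSymm m f) {x : Eu N}
    (hx : coordProd m x = 0) : f x = 0 := by
  obtain ⟨i, -, hi⟩ := Finset.prod_eq_zero_iff.1 hx
  split_ifs at hi with h
  · have := hf i h x
    rw [reflect_eq_self hi] at this
    linarith
  · exact absurd hi one_ne_zero

theorem gaussKernel_reflect (i : Fin N) (t : ℝ) (x : Eu N) :
    gaussKernel t (reflect i x) = gaussKernel t x := by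
  simp [gaussKernel, norm_reflect]

/-- The Gauss kernel (anti-)symmetrized (`ε = ±1`) in the first `k` coordinates. -/
def foldKernel (ε : ℝ) (k : ℕ) (t : ℝ) (x y : Eu N) : ℝ :=
  ∏ i : Fin N, if i.val < k then (gauss t (x i - y i) + ε * gauss t (x i + y i)) / 2
    else gauss t (x i - y i)

theorem foldKernel_succ (ε : ℝ) {k : ℕ} (hk : k < N) (t : ℝ) (x y : Eu N) :
    foldKernel ε (k + 1) t x y =
      (foldKernel ε k t x y + ε * foldKernel ε k t x (reflect ⟨k, hk⟩ y)) / 2 := by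
  set i : Fin N := ⟨k, hk⟩ with hi
  have key : ∀ (k' : ℕ) (z : Eu N), foldKernel ε k' t x z = (if i.val < k' then
      (gauss t (x i - z i) + ε * gauss t (x i + z i)) / 2 else gauss t (x i - z i)) *
      ∏ j ∈ Finset.univ.erase i, if j.val < k' then
        (gauss t (x j - z j) + ε * gauss t (x j + z j)) / 2 else gauss t (x j - z j) :=
    fun k' z => (Finset.mul_prod_erase _ _ (Finset.mem_univ i)).symm
  have e1 : ∏ j ∈ Finset.univ.erase i, (if j.val < k + 1 then
        (gauss t (x j - y j) + ε * gauss t (x j + y j)) / 2 else gauss t (x j - y j)) =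
      ∏ j ∈ Finset.univ.erase i, if j.val < k then
        (gauss t (x j - y j) + ε * gauss t (x j + y j)) / 2 else gauss t (x j - y j) := by
    refine Finset.prod_congr rfl fun j hj => ?_
    have hne : j.val ≠ k := fun h => Finset.ne_of_mem_erase hj (Fin.ext h)
    have : j.val < k + 1 ↔ j.val < k := by omega
    simp only [this]
  have e2 : ∏ j ∈ Finset.univ.erase i, (if j.val < k then
        (gauss t (x j - reflect i y j) + ε * gauss t (x j + reflect i y j)) / 2
          else gauss t (x j - reflect i y j)) =
      ∏ j ∈ Finset.univ.erase i, if j.val < k then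
        (gauss t (x j - y j) + ε * gauss t (x j + y j)) / 2 else gauss t (x j - y j) := by
    refine Finset.prod_congr rfl fun j hj => ?_
    rw [reflect_of_ne (Finset.ne_of_mem_erase hj)]
  rw [key (k + 1) y, key k y, key k (reflect i y), e1, e2, if_pos (by simp [hi]),
    if_neg (by simp [hi]), if_neg (by simp [hi]), reflect_self, sub_neg_eq_add]
  ring

theorem foldKernel_zero (ε : ℝ) {t : ℝ} (ht : 0 < t) (x y : Eu N) :
    foldKernel ε 0 t x y = gaussKernel t (x - y) := by
  simp [foldKernel, gaussKernel_eq_prod ht]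

/-- Averaging the kernel over reflections does not change its integral against a function of
matching parity. On the sector and up to the factor `2 ^ m`, `ε = -1` gives the Dirichlet kernel and
`ε = 1` the Neumann kernel. -/
theorem integral_foldKernel_mul {ε : ℝ} (hε : ε * ε = 1) {m : ℕ} (hm : m ≤ N) {t : ℝ} (ht : 0 < t)
    (x : Eu N) {f : Eu N → ℝ} (hf : ∀ i : Fin N, i.val < m → ∀ y, f (reflect i y) = ε * f y)
    (hi : Integrable fun y => gaussKernel t (x - y) * f y) :
    Integrable (fun y => foldKernel ε m t x y * f y) ∧
      ∫ y, foldKernel ε m t x y * f y = ∫ y, gaussKernel t (x - y) * f y := by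
  suffices h : ∀ k ≤ m, Integrable (fun y => foldKernel ε k t x y * f y) ∧
      ∫ y, foldKernel ε k t x y * f y = ∫ y, gaussKernel t (x - y) * f y from h m le_rfl
  intro k
  induction k with
  | zero => intro _; exact ⟨by simpa only [foldKernel_zero ε ht] using hi, by simp only [foldKernel_zero ε ht]⟩
  | succ k ih =>
    intro hk
    obtain ⟨h1, h2⟩ := ih (by omega)
    have hkN : k < N := by omega
    set i : Fin N := ⟨k, hkN⟩
    have e : ∀ y, foldKernel ε (k + 1) t x y * f y = 1 / 2 * (foldKernel ε k t x y * f y +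
        (fun z => foldKernel ε k t x z * f z) (reflect i y)) := fun y => by
      have h3 : f y = ε * f (reflect i y) := by
        rw [hf i (by simpa [i] using hk), ← mul_assoc, hε, one_mul]
      dsimp only
      rw [foldKernel_succ ε hkN]
      linear_combination (ε * foldKernel ε k t x (reflect i y) / 2) * h3 +
        (foldKernel ε k t x (reflect i y) * f (reflect i y) / 2) * hε
    simp_rw [e]
    refine ⟨(h1.add (integrable_comp_reflect i h1)).const_mul _, ?_⟩
    rw [integral_const_mul, integral_add h1 (integrable_comp_reflect i h1),
      integral_comp_reflect i (fun z => foldKernel ε k t x z * f z), h2]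
    ring

theorem gauss_le_gauss {t : ℝ} (ht : 0 < t) {z w : ℝ} (h : z ^ 2 ≤ w ^ 2) : gauss t w ≤ gauss t z := by
  unfold gauss; gcongr

theorem foldKernel_nonneg {m : ℕ} {t : ℝ} (ht : 0 < t) (x y : Eu N) : 0 ≤ foldKernel 1 m t x y := by
  refine Finset.prod_nonneg fun i _ => ?_
  have := gauss_pos ht (x i - y i)
  have := gauss_pos ht (x i + y i)
  split_ifs <;> linarith

theorem abs_foldKernel_le {m : ℕ} {t : ℝ} (ht : 0 < t) (x y : Eu N) :
    |foldKernel (-1) m t x y| ≤ foldKernel 1 m t x y := by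
  unfold foldKernel
  rw [Finset.abs_prod]
  refine Finset.prod_le_prod (fun _ _ => abs_nonneg _) fun i _ => ?_
  have := gauss_pos ht (x i - y i)
  have := gauss_pos ht (x i + y i)
  split_ifs
  · rw [abs_le]; constructor <;> linarith
  · rw [abs_of_pos (by assumption)]

/-- Method of images: `|x i - y i| ≤ |x i + y i|` when `x i * y i ≥ 0`, and the reverse otherwise,
so each folded factor has the sign of `x i * y i`. -/
theorem foldKernel_sign {m : ℕ} {t : ℝ} (ht : 0 < t) (x y : Eu N) :
    0 ≤ coordProd m x * (foldKernel (-1) m t x y * coordProd m y) := by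
  unfold coordProd foldKernel
  rw [← Finset.prod_mul_distrib, ← Finset.prod_mul_distrib]
  refine Finset.prod_nonneg fun i _ => ?_
  split_ifs
  · have e : x i * ((gauss t (x i - y i) + -1 * gauss t (x i + y i)) / 2 * y i) =
        (x i * y i) * (gauss t (x i - y i) - gauss t (x i + y i)) / 2 := by ring
    rw [e]
    refine div_nonneg ?_ zero_le_two
    rcases le_total 0 (x i * y i) with h | h
    · exact mul_nonneg h (sub_nonneg.2 (gauss_le_gauss ht (by nlinarith)))
    · exact mul_nonneg_of_nonpos_of_nonpos h (sub_nonpos.2 (gauss_le_gauss ht (by nlinarith)))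
  · rw [one_mul, mul_one]; exact (gauss_pos ht _).le

theorem foldKernel_eq_zero {m : ℕ} {t : ℝ} {x y : Eu N} (hy : coordProd m y = 0) :
    foldKernel (-1) m t x y = 0 := by
  obtain ⟨i, -, hi⟩ := Finset.prod_eq_zero_iff.1 hy
  split_ifs at hi with h
  · refine Finset.prod_eq_zero (Finset.mem_univ i) ?_
    rw [if_pos h, hi]; simp
  · exact absurd hi one_ne_zero

theorem AntiSymm.heatC0 {m : ℕ} {f : C₀(Eu N, ℝ)} (hf : AntiSymm m f) (t : ℝ) :
    AntiSymm m (heatC0 t f) := by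
  rcases le_or_gt t 0 with ht | ht
  · rwa [heatC0_of_nonpos ht]
  intro i hi x
  rw [heatC0_apply ht, heatC0_apply ht, ← integral_comp_reflect i, ← integral_neg]
  refine integral_congr_ae (Eventually.of_forall fun y => ?_)
  dsimp only
  rw [← reflect_sub, gaussKernel_reflect, hf i hi]
  ring

/-- If `f` is anti-symmetric and `f ≥ -b` on the sector, then `e^{tΔ} f ≥ -b` on the sector. -/
theorem heatC0_lower_bound {m : ℕ} (hm : m ≤ N) {f : C₀(Eu N, ℝ)} (hf : AntiSymm m f) {b : ℝ}
    (hb : 0 ≤ b) (h : ∀ y, -(b * |coordProd m y|) ≤ coordProd m y * f y) (t : ℝ) (x : Eu N) :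
    -(b * |coordProd m x|) ≤ coordProd m x * heatC0 t f x := by
  rcases le_or_gt t 0 with ht | ht
  · rw [heatC0_of_nonpos ht]; exact h x
  obtain ⟨i1, e1⟩ := integral_foldKernel_mul (ε := -1) (by norm_num) hm ht x (f := f)
    (fun i hi y => by rw [hf i hi]; ring) (integrable_gaussKernel_mul ht f x)
  -- The constant function is even, so the even folded kernel has mass one; it dominates the odd
  -- kernel in absolute value.
  obtain ⟨i2, e2⟩ := integral_foldKernel_mul (ε := 1) (by norm_num) hm ht x (f := fun _ => 1)
    (fun i hi y => by ring) (by simpa using integrable_gaussKernel_sub ht x)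
  simp only [mul_one] at i2 e2
  rw [integral_gaussKernel_sub ht] at e2
  rw [heatC0_apply ht, ← e1, ← integral_const_mul]
  calc -(b * |coordProd m x|) = ∫ y, -(b * |coordProd m x|) * foldKernel 1 m t x y := by
        rw [integral_const_mul, e2, mul_one]
    _ ≤ _ := by
        refine integral_mono (i2.const_mul _) (i1.const_mul _) fun y => ?_
        dsimp only
        have hle := abs_foldKernel_le (m := m) ht x y
        have hs := foldKernel_sign (m := m) ht x y
        set W := foldKernel (-1) m t x y with hW
        by_cases hp : coordProd m y = 0
        · rw [hW, foldKernel_eq_zero hp]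
          have := mul_nonneg (mul_nonneg hb (abs_nonneg (coordProd m x)))
            (foldKernel_nonneg (m := m) ht x y)
          simp only [zero_mul, mul_zero]; linarith
        -- The hypothesis and the sign of the kernel both carry a factor `q`, so the inequality is
        -- proved after multiplication by `q ^ 2` and then divided.
        · have hp2 : 0 < coordProd m y ^ 2 := by positivity
          set q := coordProd m y
          set p := coordProd m x
          have e3 : p * (W * f y) * q ^ 2 = p * (W * q) * (q * f y) := by ring
          have e4 : -(b * |q|) * (p * (W * q)) ≤ p * (W * f y) * q ^ 2 := by
            rw [e3]; nlinarith [h y]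
          have e5 : p * (W * q) = |p| * |W| * |q| := by
            rw [← abs_of_nonneg hs, abs_mul, abs_mul]; ring
          rw [e5] at e4
          have e6 : -(b * |p| * |W|) ≤ p * (W * f y) := by
            have : -(b * |p| * |W|) * q ^ 2 ≤ p * (W * f y) * q ^ 2 := by
              refine le_trans (le_of_eq ?_) e4
              rw [← sq_abs q]; ring
            exact le_of_mul_le_mul_right this hp2
          have e7 : b * |p| * |W| ≤ b * |p| * foldKernel 1 m t x y := by gcongr
          linarith

theorem heatC0_sign {m : ℕ} (hm : m ≤ N) {f : C₀(Eu N, ℝ)} (hf : AntiSymm m f)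
    (h : ∀ y, 0 ≤ coordProd m y * f y) (t : ℝ) (x : Eu N) :
    0 ≤ coordProd m x * heatC0 t f x := by
  simpa using heatC0_lower_bound hm hf le_rfl (by simpa using h) t x

theorem AntiSymm.add {m : ℕ} {f g : Eu N → ℝ} (hf : AntiSymm m f) (hg : AntiSymm m g) :
    AntiSymm m (fun x => f x + g x) := fun i hi x => by
  simp only [hf i hi, hg i hi]; ring

theorem AntiSymm.const_mul {m : ℕ} {f : Eu N → ℝ} (hf : AntiSymm m f) (c : ℝ) :
    AntiSymm m (fun x => c * f x) := fun i hi x => by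
  simp only [hf i hi]; ring

/-- Comparison principle on the sector: positivity is applied to `g + f` and `g - f`. -/
theorem abs_heatC0_le {m : ℕ} (hm : m ≤ N) {f g : C₀(Eu N, ℝ)} (hf : AntiSymm m f)
    (hg : AntiSymm m g) (hgs : ∀ y, 0 ≤ coordProd m y * g y) (h : ∀ y, |f y| ≤ |g y|) (t : ℝ)
    (x : Eu N) : |heatC0 t f x| ≤ |heatC0 t g x| := by
  by_cases hp : coordProd m x = 0
  · rw [(hf.heatC0 t).eq_zero hp, abs_zero]; exact abs_nonneg _
  have key : ∀ y, |coordProd m y * f y| ≤ coordProd m y * g y := fun y => by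
    rw [abs_mul, ← abs_of_nonneg (hgs y), abs_mul]
    exact mul_le_mul_of_nonneg_left (h y) (abs_nonneg _)
  have h1 := heatC0_sign hm (f := g + f) (hg.add hf) (fun y => by
    rw [ZeroAtInftyContinuousMap.add_apply]; have := (abs_le.1 (key y)).1; linarith) t x
  have h2 := heatC0_sign hm (f := g - f) (fun i hi y => by
    simp only [ZeroAtInftyContinuousMap.sub_apply, hf i hi, hg i hi]; ring) (fun y => by
    rw [ZeroAtInftyContinuousMap.sub_apply]; have := (abs_le.1 (key y)).2; linarith) t x
  rw [heatC0_map_add, ZeroAtInftyContinuousMap.add_apply] at h1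
  rw [heatC0_map_sub, ZeroAtInftyContinuousMap.sub_apply] at h2
  have h3 : |coordProd m x * heatC0 t f x| ≤ |coordProd m x * heatC0 t g x| := by
    refine le_trans (abs_le.2 ⟨?_, ?_⟩) (le_abs_self _) <;> linarith
  rw [abs_mul, abs_mul] at h3
  exact le_of_mul_le_mul_left h3 (abs_pos.2 hp)

/-! ### The nonlinearity -/

/-- Bernoulli's inequality for `(y / x) ^ (α + 1)`. -/
theorem rpow_mul_sub_le {α : ℝ} (hα : 0 < α) {x y : ℝ} (hy : 0 ≤ y) (hyx : y ≤ x) :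
    x ^ α * x - y ^ α * y ≤ (α + 1) * x ^ α * (x - y) := by
  rcases hy.eq_or_lt with rfl | hy
  · have : 0 ≤ x ^ α * x := by positivity
    rw [mul_zero, sub_zero, sub_zero]
    nlinarith
  have hx : 0 < x := hy.trans_le hyx
  have h := one_add_mul_self_le_rpow_one_add (s := y / x - 1) (by linarith [div_pos hy hx])
    (p := α + 1) (by linarith)
  rw [add_sub_cancel, Real.div_rpow hy.le hx.le, Real.rpow_add_one hx.ne', Real.rpow_add_one hy.ne',
    le_div_iff₀ (by positivity)] at h
  have e : (1 + (α + 1) * (y / x - 1)) * (x ^ α * x) = x ^ α * x - (α + 1) * x ^ α * (x - y) := by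
    field_simp; ring
  rw [e] at h
  linarith

/-- By symmetry `x` is nonnegative and the larger in absolute value. Equal signs reduce to
`rpow_mul_sub_le`; for opposite signs the two terms are estimated separately. -/
theorem abs_rpow_mul_sub_le {α : ℝ} (hα : 0 < α) {R x y : ℝ} (hx : |x| ≤ R) (hy : |y| ≤ R) :
    |(|x| ^ α * x - |y| ^ α * y)| ≤ (α + 1) * R ^ α * |x - y| := by
  wlog hxy : |y| ≤ |x| generalizing x y
  · rw [abs_sub_comm, abs_sub_comm x]
    exact this hy hx (le_of_not_ge hxy)
  wlog hx0 : 0 ≤ x generalizing x y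
  · have := this (x := -x) (y := -y) (by rwa [abs_neg]) (by rwa [abs_neg])
      (by rwa [abs_neg, abs_neg]) (by linarith)
    rw [abs_neg, abs_neg] at this
    convert this using 1
    · rw [← abs_neg]; congr 1; ring
    · rw [← abs_neg (x - y)]; congr 2; ring
  rw [abs_of_nonneg hx0] at hxy hx ⊢
  have hR : x ^ α ≤ R ^ α := Real.rpow_le_rpow hx0 hx hα.le
  have hRx : 0 ≤ R ^ α := (Real.rpow_nonneg hx0 _).trans hR
  rcases le_or_gt 0 y with h | h
  · rw [abs_of_nonneg h] at hxy hy ⊢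
    have h1 := rpow_mul_sub_le hα h hxy
    have h2 : y ^ α * y ≤ x ^ α * x := by gcongr
    rw [abs_of_nonneg (by linarith), abs_of_nonneg (by linarith)]
    refine h1.trans ?_
    have : 0 ≤ x - y := by linarith
    gcongr
  · rw [abs_of_neg h] at hxy hy ⊢
    have hy' : (-y) ^ α ≤ R ^ α := Real.rpow_le_rpow (by linarith) hy hα.le
    have h3 : 0 ≤ (-y) ^ α := Real.rpow_nonneg (by linarith) _
    have h4 : 0 ≤ x ^ α := Real.rpow_nonneg hx0 _
    rw [abs_of_nonneg (by nlinarith), abs_of_nonneg (by linarith)]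
    have h5 : x ^ α * x - (-y) ^ α * y ≤ R ^ α * (x - y) := by nlinarith
    have h6 : 0 ≤ R ^ α * (x - y) := mul_nonneg hRx (by linarith)
    nlinarith

theorem nonlin_apply (α : ℝ) (hα : 0 < α) (f : C₀(Eu N, ℝ)) (x : Eu N) :
    nonlin α hα f x = |f x| ^ α * f x := rfl

theorem AntiSymm.nonlin {m : ℕ} {α : ℝ} (hα : 0 < α) {f : C₀(Eu N, ℝ)} (hf : AntiSymm m f) :
    AntiSymm m (nonlin α hα f) := fun i hi x => by
  simp only [nonlin_apply, hf i hi, abs_neg]; ring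

theorem isLocLip_nonlin {a α : ℝ} (hα : 0 < α) :
    IsLocLip fun f : C₀(Eu N, ℝ) => a • nonlin α hα f where
  map_zero := by ext x; simp [nonlin_apply]
  lip R := by
    refine ⟨|a| * ((α + 1) * |R| ^ α), by positivity, fun f g hf hg => ?_⟩
    have e : a • nonlin α hα f - a • nonlin α hα g = a • (nonlin α hα f - nonlin α hα g) :=
      (smul_sub a (nonlin α hα f) (nonlin α hα g)).symm
    rw [e, norm_smul, Real.norm_eq_abs, mul_assoc]
    refine mul_le_mul_of_nonneg_left (C0_norm_le (by positivity) fun x => ?_) (abs_nonneg a)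
    rw [ZeroAtInftyContinuousMap.sub_apply, nonlin_apply, nonlin_apply]
    refine (abs_rpow_mul_sub_le hα (R := |R|) ?_ ?_).trans ?_
    · exact (C0_abs_le f x).trans (hf.trans (le_abs_self R))
    · exact (C0_abs_le g x).trans (hg.trans (le_abs_self R))
    · gcongr
      exact C0_abs_le (f - g) x

/-- Evaluation at a point as a continuous functional on `C₀`. -/
def evalC0 (x : Eu N) : C₀(Eu N, ℝ) →L[ℝ] ℝ :=
  LinearMap.mkContinuous
    { toFun := fun f => f x
      map_add' := fun _ _ => rfl
      map_smul' := fun _ _ => rfl } 1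
    fun f => by simpa using C0_abs_le f x

theorem evalC0_apply (x : Eu N) (f : C₀(Eu N, ℝ)) : evalC0 x f = f x := rfl

theorem intervalIntegral_apply {g : ℝ → C₀(Eu N, ℝ)} {s t : ℝ} (hg : IntervalIntegrable g volume s t)
    (x : Eu N) : (∫ σ in s..t, g σ) x = ∫ σ in s..t, g σ x :=
  ((evalC0 x).intervalIntegral_comp_comm hg).symm

theorem intervalIntegrable_apply {g : ℝ → C₀(Eu N, ℝ)} {s t : ℝ}
    (hg : IntervalIntegrable g volume s t) (x : Eu N) :
    IntervalIntegrable (fun σ => g σ x) volume s t :=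
  ⟨(evalC0 x).integrable_comp hg.1, (evalC0 x).integrable_comp hg.2⟩

theorem AntiSymm.intervalIntegral {m : ℕ} {g : ℝ → C₀(Eu N, ℝ)} {s t : ℝ} (hst : s ≤ t)
    (hg : IntervalIntegrable g volume s t) (h : ∀ σ ∈ Ioo s t, AntiSymm m (g σ)) :
    AntiSymm m (∫ σ in s..t, g σ : C₀(Eu N, ℝ)) := fun i hi x => by
  rw [intervalIntegral_apply hg, intervalIntegral_apply hg, ← intervalIntegral.integral_neg]
  exact integral_congr_Ioo hst fun σ hσ => h σ hσ i hi x

theorem isClosed_antiSymm (m : ℕ) : IsClosed {f : C₀(Eu N, ℝ) | AntiSymm m f} := by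
  simp only [AntiSymm, ofPred_forall]
  refine isClosed_iInter fun i => isClosed_iInter fun _ => isClosed_iInter fun x => ?_
  exact isClosed_eq (evalC0 (reflect i x)).continuous (evalC0 x).continuous.neg

/-- Anti-symmetric functions, which for `a = 1` have the sign of `K x₁ ⋯ xₘ`. -/
def signCone (N m : ℕ) (a K : ℝ) : Set C₀(Eu N, ℝ) :=
  {f | AntiSymm m f ∧ (a = 1 → ∀ x, 0 ≤ K * (coordProd m x * f x))}

/-- The Duhamel map preserves the sign only when `a = 1`. For `a = -1` the added term has the
opposite sign, and the cone is merely the space of anti-symmetric functions. -/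
theorem isInvariantCone_signCone {m : ℕ} (hm : m ≤ N) {α : ℝ} (hα : 0 < α) (a K : ℝ) :
    IsInvariantCone (heatSemigroup N) (fun f => a • nonlin α hα f) (signCone N m a K) where
  closed := by
    have e : signCone N m a K = {f : C₀(Eu N, ℝ) | AntiSymm m f} ∩
        ⋂ (_ : a = 1), ⋂ x, {f : C₀(Eu N, ℝ) | 0 ≤ K * (coordProd m x * f x)} := by
      ext f; simp [signCone]
    rw [e]
    refine (isClosed_antiSymm m).inter ?_
    refine isClosed_iInter fun _ => isClosed_iInter fun x => ?_
    exact isClosed_le continuous_const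
      (continuous_const.mul (continuous_const.mul (evalC0 x).continuous))
  zero := ⟨fun i _ x => by simp, fun _ x => by simp⟩
  add f hf g hg := ⟨hf.1.add hg.1, fun ha x => by
    have := hf.2 ha x
    have := hg.2 ha x
    rw [ZeroAtInftyContinuousMap.add_apply]; linarith⟩
  heat t f hf := by
    refine ⟨hf.1.heatC0 t, fun ha x => ?_⟩
    have h := heatC0_sign hm (f := K • f) (hf.1.const_mul K) (fun y => by
      have := hf.2 ha y
      rw [ZeroAtInftyContinuousMap.smul_apply, smul_eq_mul]; linarith) t x
    rw [heatC0_map_smul, ZeroAtInftyContinuousMap.smul_apply, smul_eq_mul] at h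
    rw [heatSemigroup_apply]; linarith
  map f hf := by
    refine ⟨(hf.1.nonlin hα).const_mul a, fun ha x => ?_⟩
    rw [ZeroAtInftyContinuousMap.smul_apply, nonlin_apply, smul_eq_mul, ha]
    have := mul_nonneg (Real.rpow_nonneg (abs_nonneg (f x)) α) (hf.2 ha x)
    linarith
  integral g t ht hg h := by
    refine ⟨AntiSymm.intervalIntegral ht hg fun σ hσ => (h σ hσ).1, fun ha x => ?_⟩
    rw [intervalIntegral_apply hg, ← mul_assoc, ← intervalIntegral.integral_const_mul,
      intervalIntegral.integral_of_le ht, integral_Ioc_eq_integral_Ioo]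
    refine setIntegral_nonneg measurableSet_Ioo fun σ hσ => ?_
    rw [mul_assoc]
    exact (h σ hσ).2 ha x

end

section

variable {N : ℕ}

/-! ### The linear solution -/

theorem continuous_psi (m : ℕ) (t : ℝ) : Continuous (psi m t : Eu N → ℝ) := by
  unfold psi
  refine continuous_finsetProd _ fun i _ => ?_
  have h : Continuous fun x : Eu N => gauss t (x i) := (continuous_gauss t).comp (by fun_prop)
  split_ifs
  · exact Continuous.mul (by fun_prop) h
  · exact continuous_const.mul h

theorem abs_psi_le (m : ℕ) {t : ℝ} (ht : 0 < t) (x : Eu N) :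
    |psi m t x| ≤ (4 * (1 + 1 / t)) ^ N * gaussKernel (2 * t) x := by
  have e : (4 * (1 + 1 / t)) ^ N * gaussKernel (2 * t) x =
      ∏ i, 4 * (1 + 1 / t) * gauss (2 * t) (x i) := by
    rw [gaussKernel_eq_prod (by positivity)]; simp [Finset.prod_mul_distrib]
  rw [e, psi, Finset.abs_prod]
  refine Finset.prod_le_prod (fun _ _ => abs_nonneg _) fun i _ => ?_
  rw [abs_mul, abs_of_pos (gauss_pos ht (x i))]
  split_ifs
  · rw [abs_div, abs_of_pos (show 0 < 2 * t by positivity)]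
    linarith [abs_div_mul_gauss_le ht (x i)]
  · have h1 := gauss_le_two_mul ht (x i)
    have h2 : 0 < 1 / t * gauss (2 * t) (x i) :=
      mul_pos (by positivity) (gauss_pos (by positivity) (x i))
    have h3 := gauss_pos (show 0 < 2 * t by positivity) (x i)
    rw [abs_one, one_mul]; linarith

theorem gaussKernel_le {t : ℝ} (ht : 0 < t) (x : Eu N) :
    gaussKernel t x ≤ (4 * Real.pi * t) ^ (-(N : ℝ) / 2) := by
  unfold gaussKernel
  refine mul_le_of_le_one_right (by positivity) (Real.exp_le_one_iff.2 ?_)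
  rw [Left.neg_nonpos_iff]; positivity

theorem tendsto_gaussKernel_cocompact {t : ℝ} (ht : 0 < t) :
    Tendsto (gaussKernel t : Eu N → ℝ) (cocompact _) (𝓝 0) := by
  have h1 : Tendsto (fun x : Eu N => ‖x‖ ^ 2 / (4 * t)) (cocompact _) atTop :=
    ((tendsto_pow_atTop two_ne_zero).comp tendsto_norm_cocompact_atTop).atTop_div_const
      (by positivity)
  have h2 := (Real.tendsto_exp_neg_atTop_nhds_zero.comp h1).const_mul
    ((4 * Real.pi * t) ^ (-(N : ℝ) / 2))
  rw [mul_zero] at h2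
  exact h2

/-- `psi m t` as an element of `C₀`, for `t > 0`. -/
def psiC0 (N m : ℕ) (t : ℝ) : C₀(Eu N, ℝ) :=
  if ht : 0 < t then
    { toFun := psi m t
      continuous_toFun := continuous_psi m t
      zero_at_infty' := by
        refine squeeze_zero_norm (fun x => abs_psi_le m ht x) ?_
        simpa using (tendsto_gaussKernel_cocompact (N := N) (show 0 < 2 * t by positivity)).const_mul
          ((4 * (1 + 1 / t)) ^ N) }
  else 0

theorem psiC0_apply (m : ℕ) {t : ℝ} (ht : 0 < t) (x : Eu N) : psiC0 N m t x = psi m t x := by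
  unfold psiC0; rw [dif_pos ht]; rfl

theorem heatC0_psiC0 (m : ℕ) {s t : ℝ} (hs : 0 ≤ s) (ht : 0 < t) :
    heatC0 s (psiC0 N m t) = psiC0 N m (s + t) := by
  rcases hs.eq_or_lt with rfl | hs
  · rw [heatC0_of_nonpos le_rfl, zero_add]
  ext x
  rw [heatC0_apply hs, psiC0_apply m (by positivity)]
  simp_rw [psiC0_apply m ht]
  rw [integral_psi_mul_gaussKernel m ht hs, add_comm]

/-- Near `t` the curve is the semigroup orbit of its value at `t / 2`. -/
theorem continuousOn_of_heatC0 {w : ℝ → C₀(Eu N, ℝ)}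
    (h : ∀ s t, 0 ≤ s → 0 < t → heatC0 s (w t) = w (s + t)) : ContinuousOn w (Ioi 0) := by
  intro t ht
  have ht : 0 < t := ht
  have h1 : Continuous fun s => heatC0 (s - t / 2) (w (t / 2)) :=
    ((heatSemigroup N).continuous_apply (w (t / 2))).comp (continuous_id.sub continuous_const)
  refine ContinuousAt.continuousWithinAt (h1.continuousAt.congr ?_)
  filter_upwards [lt_mem_nhds (half_lt_self ht)] with s hs
  rw [h _ _ (sub_nonneg.2 hs.le) (half_pos ht), sub_add_cancel]

theorem continuousOn_psiC0 (N m : ℕ) : ContinuousOn (psiC0 N m) (Ioi 0) :=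
  continuousOn_of_heatC0 fun _ _ hs ht => heatC0_psiC0 m hs ht

theorem antiSymm_psiC0 (m : ℕ) (t : ℝ) : AntiSymm m (psiC0 N m t) := by
  intro i hi x
  rcases le_or_gt t 0 with ht | ht
  · simp [psiC0, not_lt.2 ht]
  rw [psiC0_apply m ht, psiC0_apply m ht]
  unfold psi
  rw [← Finset.mul_prod_erase _ _ (Finset.mem_univ i), ← Finset.mul_prod_erase _ _ (Finset.mem_univ i),
    if_pos hi, if_pos hi, reflect_self, gauss_neg, neg_div, neg_mul, neg_mul]
  congr 2
  refine Finset.prod_congr rfl fun j hj => ?_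
  rw [reflect_of_ne (Finset.ne_of_mem_erase hj)]

theorem coordProd_mul_psi_nonneg (m : ℕ) {t : ℝ} (ht : 0 < t) (x : Eu N) :
    0 ≤ coordProd m x * psi m t x := by
  unfold coordProd psi
  rw [← Finset.prod_mul_distrib]
  refine Finset.prod_nonneg fun i _ => ?_
  have := (gauss_pos ht (x i)).le
  split_ifs
  · have e : x i * (x i / (2 * t) * gauss t (x i)) = x i ^ 2 / (2 * t) * gauss t (x i) := by ring
    rw [e]; positivity
  · simpa using this

theorem psi_pos {m : ℕ} {t : ℝ} (ht : 0 < t) {x : Eu N} (hx : x ∈ sector N m) : 0 < psi m t x := by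
  refine Finset.prod_pos fun i _ => mul_pos ?_ (gauss_pos ht _)
  split_ifs with h
  · have := hx i h; positivity
  · exact one_pos

theorem gauss_mul_sqrt {l t : ℝ} (hl : 0 < l) (ht : 0 < t) (z : ℝ) :
    gauss (l * t) (√l * z) = (√l)⁻¹ * gauss t z := by
  unfold gauss
  rw [show 4 * Real.pi * (l * t) = l * (4 * Real.pi * t) by ring,
    Real.mul_rpow hl.le (by positivity), mul_pow, Real.sq_sqrt hl.le, Real.sqrt_eq_rpow,
    ← Real.rpow_neg hl.le, mul_assoc]
  congr 2
  · norm_num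
  · congr 2; field_simp

theorem prod_ite_lt {m : ℕ} (hm : m ≤ N) (c : Fin N → ℝ) :
    ∏ i : Fin N, (if i.val < m then c i else 1) = ∏ j : Fin m, c (Fin.castLE hm j) := by
  rw [Finset.prod_ite, Finset.prod_const_one, mul_one]
  have : (Finset.univ.filter fun i : Fin N => i.val < m) = Finset.univ.map (Fin.castLEEmb hm) := by
    ext i
    simp only [Finset.mem_filter, Finset.mem_univ, true_and, Finset.mem_map]
    exact ⟨fun h => ⟨⟨i, h⟩, rfl⟩, by rintro ⟨j, rfl⟩; exact j.2⟩
  rw [this, Finset.prod_map]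
  rfl

/-- Each of the `N` Gaussian factors and each of the `m` linear factors contributes `l ^ (-1 / 2)`.
-/
theorem psi_scale {m : ℕ} (hm : m ≤ N) {l t : ℝ} (hl : 0 < l) (ht : 0 < t) (x : Eu N) :
    psi m (l * t) (√l • x) = l ^ (-((m : ℝ) + N) / 2) * psi m t x := by
  have h0 : 0 < √l := Real.sqrt_pos.2 hl
  have e : ∀ i : Fin N, (if i.val < m then (√l • x) i / (2 * (l * t)) else 1) *
      gauss (l * t) ((√l • x) i) = ((if i.val < m then (√l)⁻¹ else 1) * (√l)⁻¹) *
      ((if i.val < m then x i / (2 * t) else 1) * gauss t (x i)) := fun i => by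
    rw [PiLp.smul_apply, smul_eq_mul, gauss_mul_sqrt hl ht]
    split_ifs
    · have : √l * x i / (2 * (l * t)) = (√l)⁻¹ * (x i / (2 * t)) := by
        field_simp; rw [Real.sq_sqrt hl.le]; ring
      rw [this]; ring
    · ring
  unfold psi
  rw [Finset.prod_congr rfl fun i _ => e i, Finset.prod_mul_distrib, Finset.prod_mul_distrib,
    prod_ite_lt hm, Finset.prod_const, Finset.prod_const, Finset.card_univ, Finset.card_univ,
    Fintype.card_fin, Fintype.card_fin]
  congr 1
  rw [← pow_add, Real.sqrt_eq_rpow, ← Real.rpow_neg hl.le, ← Real.rpow_mul_natCast hl.le]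
  congr 1
  push_cast; ring

/-- The prefactor is frozen at the lower time `t`, which leaves the decay `s ^ (-N / 2)` needed
against the subordination density at infinity. -/
theorem norm_psiC0_le (m : ℕ) {s t : ℝ} (ht : 0 < t) (hts : t ≤ s) :
    ‖psiC0 N m s‖ ≤ (4 * (1 + 1 / t)) ^ N * s ^ (-(N : ℝ) / 2) := by
  have hs := ht.trans_le hts
  refine C0_norm_le (by positivity) fun x => ?_
  rw [psiC0_apply m hs]
  refine (abs_psi_le m hs x).trans (mul_le_mul (by gcongr) ?_
    (gaussKernel_nonneg (by positivity) x) (by positivity))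
  refine (gaussKernel_le (by positivity) x).trans ?_
  refine Real.rpow_le_rpow_of_nonpos hs ?_ (by
    rw [neg_div]; exact neg_nonpos.2 (by positivity))
  have := Real.pi_gt_three
  nlinarith

/-! ### The linear solution as a subordinated integral -/

/-- The constant in the subordination formula for `|x|^{-γ}`. -/
def subConst (N : ℕ) (γ : ℝ) : ℝ :=
  (4 * Real.pi) ^ ((N : ℝ) / 2) / (4 ^ (γ / 2) * Real.Gamma (γ / 2))

/-- The density with `|x|^{-γ} = ∫₀^∞ ρ(τ) G_τ(x) dτ`. -/
def subDensity (N : ℕ) (γ τ : ℝ) : ℝ := subConst N γ * τ ^ (((N : ℝ) - γ) / 2 - 1)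

theorem subConst_pos {γ : ℝ} (hγ : 0 < γ) : 0 < subConst N γ := by
  have := Real.Gamma_pos_of_pos (half_pos hγ)
  unfold subConst; positivity

theorem subDensity_pos {γ τ : ℝ} (hγ : 0 < γ) (hτ : 0 < τ) : 0 < subDensity N γ τ :=
  mul_pos (subConst_pos hγ) (Real.rpow_pos_of_pos hτ _)

theorem continuousOn_subDensity (N : ℕ) (γ : ℝ) : ContinuousOn (subDensity N γ) (Ioi 0) :=
  continuousOn_const.mul (continuousOn_id.rpow_const fun _ hx => Or.inl (ne_of_gt hx))

/-- Integrability at `0` uses `γ < N`; at infinity the product is a multiple of `τ ^ (-γ / 2 - 1)`,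
integrable because `γ > 0`. This is the common majorant of all later `τ`-integrals. -/
theorem integrableOn_subDensity_mul {γ : ℝ} (hγ : 0 < γ) (hγN : γ < N) :
    IntegrableOn (fun τ => subDensity N γ τ * min 1 (τ ^ (-(N : ℝ) / 2))) (Ioi 0) := by
  have hm : ContinuousOn (fun τ => subDensity N γ τ * min 1 (τ ^ (-(N : ℝ) / 2))) (Ioi 0) :=
    (continuousOn_subDensity N γ).mul (continuous_min.comp_continuousOn
      (continuousOn_const.prodMk (continuousOn_id.rpow_const fun _ hx => Or.inl (ne_of_gt hx))))
  have hc := subConst_pos (N := N) hγ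
  rw [← Ioc_union_Ioi_eq_Ioi zero_le_one]
  refine IntegrableOn.union ?_ ?_
  · have h1 : IntegrableOn (fun τ : ℝ => subConst N γ * τ ^ (((N : ℝ) - γ) / 2 - 1)) (Ioc 0 1) := by
      have := intervalIntegral.intervalIntegrable_rpow' (a := 0) (b := 1)
        (r := ((N : ℝ) - γ) / 2 - 1) (by linarith)
      exact ((intervalIntegrable_iff_integrableOn_Ioc_of_le zero_le_one).1 this).const_mul _
    refine h1.mono' ((hm.mono fun x hx => hx.1).aestronglyMeasurable measurableSet_Ioc) ?_
    refine (ae_restrict_iff' measurableSet_Ioc).2 (Eventually.of_forall fun τ hτ => ?_)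
    have h2 := (subDensity_pos (N := N) hγ hτ.1).le
    have h3 : 0 ≤ min 1 (τ ^ (-(N : ℝ) / 2)) := le_min zero_le_one (Real.rpow_nonneg hτ.1.le _)
    rw [Real.norm_of_nonneg (mul_nonneg h2 h3)]
    exact mul_le_of_le_one_right h2 (min_le_left _ _)
  · have h1 : IntegrableOn (fun τ : ℝ => subConst N γ * τ ^ (-γ / 2 - 1)) (Ioi 1) :=
      (integrableOn_Ioi_rpow_of_lt (by linarith) one_pos).const_mul _
    refine h1.mono' ((hm.mono (Ioi_subset_Ioi zero_le_one)).aestronglyMeasurable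
      measurableSet_Ioi) ?_
    refine (ae_restrict_iff' measurableSet_Ioi).2 (Eventually.of_forall fun τ hτ => ?_)
    have hτ0 : 0 < τ := one_pos.trans (mem_Ioi.1 hτ)
    have h2 := (subDensity_pos (N := N) hγ hτ0).le
    have h3 : 0 ≤ min 1 (τ ^ (-(N : ℝ) / 2)) := le_min zero_le_one (Real.rpow_nonneg hτ0.le _)
    rw [Real.norm_of_nonneg (mul_nonneg h2 h3)]
    calc _ ≤ subDensity N γ τ * τ ^ (-(N : ℝ) / 2) := by gcongr; exact min_le_right _ _
      _ = _ := by
        unfold subDensity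
        rw [mul_assoc, ← Real.rpow_add hτ0]
        congr 2; ring

theorem rpow_add_le_min {b t τ : ℝ} (hb : 0 ≤ b) (ht : 0 < t) (hτ : 0 < τ) :
    (t + τ) ^ (-b) ≤ max 1 (t ^ (-b)) * min 1 (τ ^ (-b)) := by
  have h1 : (t + τ) ^ (-b) ≤ t ^ (-b) :=
    Real.rpow_le_rpow_of_nonpos ht (by linarith) (by linarith)
  have h2 : (t + τ) ^ (-b) ≤ τ ^ (-b) :=
    Real.rpow_le_rpow_of_nonpos hτ (by linarith) (by linarith)
  have h3 : 0 < τ ^ (-b) := Real.rpow_pos_of_pos hτ _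
  rcases min_choice 1 (τ ^ (-b)) with h | h
  · rw [h, mul_one]; exact h1.trans (le_max_right _ _)
  · rw [h]
    exact h2.trans (le_mul_of_one_le_left h3.le (le_max_left _ _))

theorem integrableOn_subDensity_smul_psiC0 {m : ℕ} {γ : ℝ} (hγ : 0 < γ) (hγN : γ < N) {t : ℝ}
    (ht : 0 < t) : IntegrableOn (fun τ => subDensity N γ τ • psiC0 N m (t + τ)) (Ioi 0) := by
  have hcont : ContinuousOn (fun τ => subDensity N γ τ • psiC0 N m (t + τ)) (Ioi 0) :=
    (continuousOn_subDensity N γ).smul ((continuousOn_psiC0 N m).comp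
      (continuous_const.add continuous_id).continuousOn fun τ hτ => add_pos ht hτ)
  refine ((integrableOn_subDensity_mul hγ hγN).const_mul
    ((4 * (1 + 1 / t)) ^ N * max 1 (t ^ (-((N : ℝ) / 2))))).mono'
    (hcont.aestronglyMeasurable measurableSet_Ioi) ?_
  refine (ae_restrict_iff' measurableSet_Ioi).2 (Eventually.of_forall fun τ hτ => ?_)
  have hτ : 0 < τ := hτ
  have h2 := (subDensity_pos (N := N) hγ hτ).le
  rw [norm_smul, Real.norm_of_nonneg h2]
  calc _ ≤ subDensity N γ τ * ((4 * (1 + 1 / t)) ^ N * (t + τ) ^ (-(N : ℝ) / 2)) := by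
        gcongr; exact norm_psiC0_le m ht (by linarith)
    _ ≤ subDensity N γ τ * ((4 * (1 + 1 / t)) ^ N *
        (max 1 (t ^ (-((N : ℝ) / 2))) * min 1 (τ ^ (-(N : ℝ) / 2)))) := by
        gcongr
        rw [neg_div]
        exact rpow_add_le_min (by positivity) ht hτ
    _ = _ := by ring

/-- `e^{tΔ}` applied to `(-1)^m ∂₁⋯∂ₘ |·|^{-γ}`. -/
def linSol (N m : ℕ) (γ t : ℝ) : C₀(Eu N, ℝ) :=
  ∫ τ in Ioi (0 : ℝ), subDensity N γ τ • psiC0 N m (t + τ)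

section linSol

variable {m : ℕ} {γ : ℝ}

/-- Evaluation, heat flow and pairing with test functions all pass under the Bochner integral, so
they need only be known on `psiC0`. -/
theorem clm_linSol {E : Type*} [NormedAddCommGroup E] [NormedSpace ℝ E] [CompleteSpace E]
    (hγ : 0 < γ) (hγN : γ < N) {t : ℝ} (ht : 0 < t) (L : C₀(Eu N, ℝ) →L[ℝ] E) :
    L (linSol N m γ t) = ∫ τ in Ioi (0 : ℝ), subDensity N γ τ • L (psiC0 N m (t + τ)) := by
  unfold linSol
  rw [← L.integral_comp_comm (integrableOn_subDensity_smul_psiC0 hγ hγN ht)]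
  simp_rw [map_smul]

theorem linSol_apply (hγ : 0 < γ) (hγN : γ < N) {t : ℝ} (ht : 0 < t) (x : Eu N) :
    linSol N m γ t x = ∫ τ in Ioi (0 : ℝ), subDensity N γ τ * psi m (t + τ) x := by
  rw [← evalC0_apply, clm_linSol hγ hγN ht]
  refine setIntegral_congr_fun measurableSet_Ioi fun τ hτ => ?_
  rw [evalC0_apply, psiC0_apply m (add_pos ht hτ), smul_eq_mul]

theorem integrableOn_subDensity_mul_psi (hγ : 0 < γ) (hγN : γ < N) {t : ℝ} (ht : 0 < t) (x : Eu N) :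
    IntegrableOn (fun τ => subDensity N γ τ * psi m (t + τ) x) (Ioi 0) := by
  have h : IntegrableOn (fun τ => evalC0 x (subDensity N γ τ • psiC0 N m (t + τ))) (Ioi 0) :=
    (evalC0 x).integrable_comp (integrableOn_subDensity_smul_psiC0 hγ hγN ht)
  refine h.congr_fun (fun τ hτ => ?_) measurableSet_Ioi
  dsimp only
  rw [map_smul, evalC0_apply, psiC0_apply m (add_pos ht hτ), smul_eq_mul]

theorem heatC0_linSol (hγ : 0 < γ) (hγN : γ < N) {s t : ℝ} (hs : 0 ≤ s) (ht : 0 < t) :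
    heatC0 s (linSol N m γ t) = linSol N m γ (s + t) := by
  rw [← heatSemigroup_apply, clm_linSol hγ hγN ht]
  refine setIntegral_congr_fun measurableSet_Ioi fun τ hτ => ?_
  rw [heatSemigroup_apply, heatC0_psiC0 m hs (add_pos ht hτ), add_assoc]

theorem continuousOn_linSol (hγ : 0 < γ) (hγN : γ < N) : ContinuousOn (linSol N m γ) (Ioi 0) :=
  continuousOn_of_heatC0 fun _ _ hs ht => heatC0_linSol hγ hγN hs ht

theorem antiSymm_linSol (hγ : 0 < γ) (hγN : γ < N) {t : ℝ} (ht : 0 < t) :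
    AntiSymm m (linSol N m γ t) := fun i hi x => by
  rw [linSol_apply hγ hγN ht, linSol_apply hγ hγN ht, ← integral_neg]
  refine setIntegral_congr_fun measurableSet_Ioi fun τ hτ => ?_
  have := antiSymm_psiC0 (N := N) m (t + τ) i hi x
  rw [psiC0_apply m (add_pos ht hτ), psiC0_apply m (add_pos ht hτ)] at this
  rw [this]; ring

theorem coordProd_mul_linSol_nonneg (hγ : 0 < γ) (hγN : γ < N) {t : ℝ} (ht : 0 < t) (x : Eu N) :
    0 ≤ coordProd m x * linSol N m γ t x := by
  rw [linSol_apply hγ hγN ht, ← integral_const_mul]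
  refine setIntegral_nonneg measurableSet_Ioi fun τ hτ => ?_
  have h1 := coordProd_mul_psi_nonneg m (add_pos ht hτ) x
  have h2 := mul_nonneg (subDensity_pos (N := N) hγ hτ).le h1
  linarith

theorem linSol_pos (hγ : 0 < γ) (hγN : γ < N) {t : ℝ} (ht : 0 < t) {x : Eu N}
    (hx : x ∈ sector N m) : 0 < linSol N m γ t x := by
  rw [linSol_apply hγ hγN ht]
  have hpos : ∀ τ ∈ Ioi (0 : ℝ), 0 < subDensity N γ τ * psi m (t + τ) x := fun τ hτ =>
    mul_pos (subDensity_pos hγ hτ) (psi_pos (add_pos ht hτ) hx)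
  rw [setIntegral_pos_iff_support_of_nonneg_ae ((ae_restrict_iff' measurableSet_Ioi).2
    (Eventually.of_forall fun τ hτ => (hpos τ hτ).le)) (integrableOn_subDensity_mul_psi hγ hγN ht x)]
  have : Function.support (fun τ => subDensity N γ τ * psi m (t + τ) x) ∩ Ioi 0 = Ioi 0 :=
    inter_eq_right.2 fun τ hτ => (hpos τ hτ).ne'
  rw [this]; simp

/-- The substitution `τ ↦ t * τ` contributes `t ^ ((N - γ) / 2)` and `psi_scale` contributes `t ^
(-(m + N) / 2)`. -/
theorem linSol_scale (hm : m ≤ N) (hγ : 0 < γ) (hγN : γ < N) {t : ℝ} (ht : 0 < t) (x : Eu N) :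
    linSol N m γ t (√t • x) = t ^ (-(γ + m) / 2) * linSol N m γ 1 x := by
  rw [linSol_apply hγ hγN ht, linSol_apply hγ hγN one_pos, ← integral_const_mul]
  have h := integral_comp_mul_left_Ioi (fun τ => subDensity N γ τ * psi m (t + τ) (√t • x)) 0 ht
  rw [mul_zero, smul_eq_mul, eq_inv_mul_iff_mul_eq₀ ht.ne', ← integral_const_mul] at h
  rw [← h]
  refine setIntegral_congr_fun measurableSet_Ioi fun τ hτ => ?_
  have hτ : 0 < τ := hτ
  rw [show t + t * τ = t * (1 + τ) by ring, psi_scale hm ht (by positivity)]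
  unfold subDensity
  rw [Real.mul_rpow ht.le hτ.le]
  have e : t * t ^ (((N : ℝ) - γ) / 2 - 1) * t ^ (-((m : ℝ) + N) / 2) = t ^ (-(γ + m) / 2) := by
    nth_rewrite 1 [← Real.rpow_one t]
    rw [← Real.rpow_add ht, ← Real.rpow_add ht]
    congr 1; ring
  rw [← e]; ring

theorem norm_linSol_le (hm : m ≤ N) (hγ : 0 < γ) (hγN : γ < N) {t : ℝ} (ht : 0 < t) :
    ‖linSol N m γ t‖ ≤ t ^ (-(γ + m) / 2) * ‖linSol N m γ 1‖ := by
  refine C0_norm_le (by positivity) fun x => ?_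
  have e : x = √t • ((√t)⁻¹ • x) := by
    rw [smul_smul, mul_inv_cancel₀ (Real.sqrt_pos.2 ht).ne', one_smul]
  rw [e, linSol_scale hm hγ hγN ht, abs_mul, abs_of_pos (Real.rpow_pos_of_pos ht _)]
  gcongr
  exact C0_abs_le _ _

end linSol

end

section

/-! ### Subordination of `|x|^{-γ}` to the Gauss kernels -/

variable {N : ℕ}

/-- The substitution `τ ↦ 1 / τ` turns the integral into a Gamma integral with rate `‖y‖ ^ 2 / 4`.
-/
theorem norm_rpow_eq_integral {γ : ℝ} (hγ : 0 < γ) {y : Eu N} (hy : y ≠ 0) :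
    ∫ τ in Ioi (0 : ℝ), subDensity N γ τ * gaussKernel τ y = ‖y‖ ^ (-γ) := by
  set r := ‖y‖ ^ 2 / 4 with hr
  have hy0 : 0 < ‖y‖ := norm_pos_iff.2 hy
  have hr0 : 0 < r := by positivity
  have h1 := integral_comp_rpow_Ioi (fun s : ℝ => s ^ (γ / 2 - 1) * Real.exp (-(r * s)))
    (p := -1) (by norm_num)
  rw [Real.integral_rpow_mul_exp_neg_mul_Ioi (by positivity) hr0] at h1
  have h2 : ∫ τ in Ioi (0 : ℝ), subDensity N γ τ * gaussKernel τ y =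
      ∫ τ in Ioi (0 : ℝ), (subConst N γ * (4 * Real.pi) ^ (-(N : ℝ) / 2)) *
        ((|(-1 : ℝ)| * τ ^ ((-1 : ℝ) - 1)) •
          ((τ ^ (-1 : ℝ)) ^ (γ / 2 - 1) * Real.exp (-(r * τ ^ (-1 : ℝ))))) := by
    refine setIntegral_congr_fun measurableSet_Ioi fun τ (hτ : 0 < τ) => ?_
    have e1 : ‖y‖ ^ 2 / (4 * τ) = r * τ ^ (-1 : ℝ) := by
      rw [Real.rpow_neg_one, hr]; field_simp
    have e2 : τ ^ (((N : ℝ) - γ) / 2 - 1) * τ ^ (-(N : ℝ) / 2) =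
        τ ^ ((-1 : ℝ) - 1) * (τ ^ (-1 : ℝ)) ^ (γ / 2 - 1) := by
      rw [← Real.rpow_mul hτ.le, ← Real.rpow_add hτ, ← Real.rpow_add hτ]
      congr 1; ring
    simp only [subDensity, gaussKernel]
    rw [e1, Real.mul_rpow (by positivity) hτ.le, abs_neg, abs_one, one_mul, smul_eq_mul]
    linear_combination subConst N γ * (4 * Real.pi) ^ (-(N : ℝ) / 2) *
      Real.exp (-(r * τ ^ (-1 : ℝ))) * e2
  rw [h2, integral_const_mul, h1, subConst]
  have hG := (Real.Gamma_pos_of_pos (half_pos hγ)).ne'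
  have e3 : (1 / r) ^ (γ / 2) = 4 ^ (γ / 2) * ‖y‖ ^ (-γ) := by
    rw [hr, one_div_div, Real.div_rpow (by norm_num) (by positivity), div_eq_mul_inv,
      ← Real.rpow_natCast, ← Real.rpow_mul hy0.le, Real.rpow_neg hy0.le]
    congr 3; push_cast; ring
  have e4 : (4 * Real.pi) ^ ((N : ℝ) / 2) * (4 * Real.pi) ^ (-(N : ℝ) / 2) = 1 := by
    rw [← Real.rpow_add (by positivity)]; simp [neg_div]
  rw [e3]
  have h4 : (4 : ℝ) ^ (γ / 2) ≠ 0 := by positivity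
  field_simp
  rw [← neg_div]; exact e4

/-- For small `s` the kernel has mass one; for large `s` its supremum is of order `s ^ (-N / 2)`. -/
theorem integral_gaussKernel_mul_le {E : Type*} [NormedAddCommGroup E] {χ : Eu N → E} {C : ℝ}
    (hC : ∀ y, ‖χ y‖ ≤ C) (hχ : Integrable χ) {s : ℝ} (hs : 0 < s) :
    ∫ y, gaussKernel s y * ‖χ y‖ ≤
      max C ((4 * Real.pi) ^ (-(N : ℝ) / 2) * ∫ y, ‖χ y‖) * min 1 (s ^ (-(N : ℝ) / 2)) := by
  have hi : Integrable fun y : Eu N => gaussKernel s y * ‖χ y‖ := by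
    refine (hχ.norm.const_mul ((4 * Real.pi * s) ^ (-(N : ℝ) / 2))).mono'
      ((gaussKernel_integrable hs).1.mul hχ.1.norm) (Eventually.of_forall fun y => ?_)
    rw [norm_mul, Real.norm_of_nonneg (gaussKernel_nonneg hs y), norm_norm]
    exact mul_le_mul_of_nonneg_right (gaussKernel_le hs y) (norm_nonneg _)
  have h1 : ∫ y, gaussKernel s y * ‖χ y‖ ≤ C := by
    calc _ ≤ ∫ y : Eu N, gaussKernel s y * C :=
          integral_mono hi ((gaussKernel_integrable hs).mul_const C) fun y =>
            mul_le_mul_of_nonneg_left (hC y) (gaussKernel_nonneg hs y)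
      _ = C := by rw [integral_mul_const, integral_gaussKernel hs, one_mul]
  have h2 : ∫ y, gaussKernel s y * ‖χ y‖ ≤
      (4 * Real.pi) ^ (-(N : ℝ) / 2) * (∫ y, ‖χ y‖) * s ^ (-(N : ℝ) / 2) := by
    calc _ ≤ ∫ y : Eu N, (4 * Real.pi * s) ^ (-(N : ℝ) / 2) * ‖χ y‖ :=
          integral_mono hi (hχ.norm.const_mul _) fun y =>
            mul_le_mul_of_nonneg_right (gaussKernel_le hs y) (norm_nonneg _)
      _ = _ := by
          rw [integral_const_mul, Real.mul_rpow (by positivity) hs.le]; ring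
  have hsp : 0 < s ^ (-(N : ℝ) / 2) := Real.rpow_pos_of_pos hs _
  rcases min_choice 1 (s ^ (-(N : ℝ) / 2)) with h | h <;> rw [h]
  · rw [mul_one]; exact h1.trans (le_max_left _ _)
  · exact h2.trans (mul_le_mul_of_nonneg_right (le_max_right _ _) hsp.le)

theorem exists_integral_gaussKernel_le {E : Type*} [NormedAddCommGroup E] {χ : Eu N → E} {C : ℝ}
    (hC : ∀ y, ‖χ y‖ ≤ C) (hχ : Integrable χ) :
    ∃ B, 0 ≤ B ∧ ∀ s : ℝ, 0 < s →
      ∫ y, gaussKernel s y * ‖χ y‖ ≤ B * min 1 (s ^ (-(N : ℝ) / 2)) :=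
  ⟨_, le_max_of_le_left ((norm_nonneg _).trans (hC 0)), fun _ hs =>
    integral_gaussKernel_mul_le hC hχ hs⟩

theorem schwartz_norm_le (χ : 𝓢(Eu N, ℂ)) : ∃ C, ∀ y, ‖χ y‖ ≤ C :=
  ⟨SchwartzMap.seminorm ℝ 0 0 χ, fun y => SchwartzMap.norm_le_seminorm ℝ χ y⟩

theorem integrable_gaussKernel_smul {E : Type*} [NormedAddCommGroup E] [NormedSpace ℝ E]
    {χ : Eu N → E} (hχ : Integrable χ) {s : ℝ} (hs : 0 < s) :
    Integrable fun y => gaussKernel s y • χ y := by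
  refine hχ.bdd_smul ((4 * Real.pi * s) ^ (-(N : ℝ) / 2)) (gaussKernel_integrable hs).1
    (Eventually.of_forall fun y => ?_)
  rw [Real.norm_of_nonneg (gaussKernel_nonneg hs y)]
  exact gaussKernel_le hs y

theorem norm_integral_gaussKernel_smul_le {E : Type*} [NormedAddCommGroup E] [NormedSpace ℝ E]
    (χ : Eu N → E) {s : ℝ} (hs : 0 < s) :
    ‖∫ y, gaussKernel s y • χ y‖ ≤ ∫ y, gaussKernel s y * ‖χ y‖ := by
  refine (norm_integral_le_integral_norm _).trans_eq (integral_congr_ae (.of_forall fun y => ?_))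
  simp only [norm_smul, Real.norm_of_nonneg (gaussKernel_nonneg hs y)]

/-- Fubini in the subordination formula, which fails only at the origin, a null set. -/
theorem powDistr_eq_integral {γ : ℝ} (hγ : 0 < γ) (hγN : γ < N) (χ : 𝓢(Eu N, ℂ)) :
    powDistr N γ hγ hγN χ =
      ∫ τ in Ioi (0 : ℝ), subDensity N γ τ • ∫ y, gaussKernel τ y • χ y := by
  have hN : 0 < N := by
    rcases Nat.eq_zero_or_pos N with rfl | h
    · simp at hγN; linarith
    · exact h
  have : Nonempty (Fin N) := ⟨⟨0, hN⟩⟩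
  have hmeas : Measurable fun x : Eu N => ‖x‖ ^ (-γ) := measurable_norm.pow_const _
  have h0 : powDistr N γ hγ hγN χ = ∫ y, ‖y‖ ^ (-γ) • χ y := by
    have := powMeasure_temperate hγ hγN
    have : powDistr N γ hγ hγN χ = ∫ y, χ y ∂(powMeasure N γ) := rfl
    rw [this, powMeasure, integral_withDensity_eq_integral_toReal_smul hmeas.ennreal_ofReal
      (Eventually.of_forall fun _ => ENNReal.ofReal_lt_top)]
    refine integral_congr_ae (.of_forall fun y => ?_)
    simp only [ENNReal.toReal_ofReal (Real.rpow_nonneg (norm_nonneg y) (-γ))]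
  obtain ⟨C, hC⟩ := schwartz_norm_le χ
  obtain ⟨B, hB0, hB⟩ := exists_integral_gaussKernel_le hC χ.integrable
  have hsm : Measurable fun τ : ℝ => subDensity N γ τ := by
    unfold subDensity; exact (measurable_id.pow_const _).const_mul _
  have hgm : Measurable fun z : ℝ × Eu N => gaussKernel z.1 z.2 := by
    unfold gaussKernel
    exact ((measurable_fst.const_mul _).pow_const _).mul (by fun_prop)
  have hm : AEStronglyMeasurable (Function.uncurry fun (τ : ℝ) (y : Eu N) =>
      subDensity N γ τ • gaussKernel τ y • χ y) ((volume.restrict (Ioi 0)).prod volume) :=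
    ((hsm.comp measurable_fst).aestronglyMeasurable).smul
      (hgm.aestronglyMeasurable.smul (χ.continuous.comp continuous_snd).aestronglyMeasurable)
  have hint : Integrable (Function.uncurry fun (τ : ℝ) (y : Eu N) =>
      subDensity N γ τ • gaussKernel τ y • χ y) ((volume.restrict (Ioi 0)).prod volume) := by
    rw [integrable_prod_iff hm]
    refine ⟨(ae_restrict_iff' measurableSet_Ioi).2 (.of_forall fun τ hτ =>
      (integrable_gaussKernel_smul χ.integrable hτ).smul (subDensity N γ τ)), ?_⟩
    refine ((integrableOn_subDensity_mul hγ hγN).mul_const B).mono'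
      hm.norm.integral_prod_right' ?_
    refine (ae_restrict_iff' measurableSet_Ioi).2 (.of_forall fun τ (hτ : 0 < τ) => ?_)
    have hs := subDensity_pos (N := N) hγ hτ
    have e : ∫ y, ‖subDensity N γ τ • gaussKernel τ y • χ y‖ =
        subDensity N γ τ * ∫ y, gaussKernel τ y * ‖χ y‖ := by
      rw [← integral_const_mul]
      refine integral_congr_ae (.of_forall fun y => ?_)
      simp only [norm_smul, Real.norm_of_nonneg (gaussKernel_nonneg hτ y),
        Real.norm_of_nonneg hs.le]
    have hnn : 0 ≤ ∫ y, ‖subDensity N γ τ • gaussKernel τ y • χ y‖ :=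
      integral_nonneg fun _ => norm_nonneg _
    simp only [Function.uncurry_apply_pair]
    rw [Real.norm_of_nonneg hnn, e]
    calc _ ≤ subDensity N γ τ * (B * min 1 (τ ^ (-(N : ℝ) / 2))) :=
          mul_le_mul_of_nonneg_left (hB τ hτ) hs.le
      _ = _ := by ring
  calc powDistr N γ hγ hγN χ = ∫ y, ‖y‖ ^ (-γ) • χ y := h0
    _ = ∫ y, ∫ τ in Ioi (0 : ℝ), subDensity N γ τ • gaussKernel τ y • χ y := by
        refine integral_congr_ae ?_
        filter_upwards [compl_mem_ae_iff.2 (measure_singleton (μ := volume) (0 : Eu N))] with y hy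
        rw [← norm_rpow_eq_integral hγ hy, ← integral_smul_const]
        simp_rw [smul_smul]
    _ = ∫ τ in Ioi (0 : ℝ), ∫ y, subDensity N γ τ • gaussKernel τ y • χ y :=
        (integral_integral_swap hint).symm
    _ = _ := by simp_rw [integral_smul]

/-! ### Derivatives -/

/-- `χ` does not depend on `T`, so the same test function serves for the Gauss kernels and for
`|x|^{-γ}`. -/
theorem exists_adjoint_iteratedLineDerivOp {k : ℕ} (s : Fin k → Eu N) (φ : 𝓢(Eu N, ℂ)) :
    ∃ χ : 𝓢(Eu N, ℂ), ∀ T : 𝓢'(Eu N, ℂ), (∂^{s} T) φ = T χ := by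
  induction k generalizing φ with
  | zero => exact ⟨φ, fun T => rfl⟩
  | succ k ih =>
    obtain ⟨χ, hχ⟩ := ih (Fin.tail s) (-∂_{s 0} φ)
    refine ⟨χ, fun T => ?_⟩
    rw [LineDeriv.iteratedLineDerivOp_succ_left, TemperedDistribution.lineDerivOp_apply_apply, hχ]

theorem iteratedLineDerivOp_toTemperedDistributionCLM {k : ℕ} (s : Fin k → Eu N)
    (g : 𝓢(Eu N, ℂ)) :
    ∂^{s} (SchwartzMap.toTemperedDistributionCLM (Eu N) ℂ volume g) =
      SchwartzMap.toTemperedDistributionCLM (Eu N) ℂ volume (∂^{s} g) := by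
  induction k with
  | zero => rfl
  | succ k ih =>
    rw [LineDeriv.iteratedLineDerivOp_succ_left, LineDeriv.iteratedLineDerivOp_succ_left, ih,
      TemperedDistribution.lineDerivOp_toTemperedDistributionCLM_eq]

theorem gaussSchwartz_apply {t : ℝ} (ht : 0 < t) (x y : Eu N) :
    gaussSchwartz t ht x y = ((gaussKernel t (x - y) : ℝ) : ℂ) := rfl

/-- By injectivity each coordinate is differentiated at most once, so the polynomial factors already
produced are constant along the next direction. -/
theorem iteratedLineDerivOp_gaussSchwartz {k : ℕ} {f : Fin k → Fin N} (hf : f.Injective) {t : ℝ}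
    (ht : 0 < t) (y : Eu N) :
    (∂^{fun j => (EuclideanSpace.single (f j) (1 : ℝ) : Eu N)} (gaussSchwartz t ht 0)) y =
      (((∏ j, -(y (f j) / (2 * t))) * gaussKernel t y : ℝ) : ℂ) := by
  induction k generalizing y with
  | zero => simp [gaussSchwartz_apply, gaussKernel_neg]
  | succ k ih =>
    have hf' : (fun j => f (Fin.succ j)).Injective := fun i j h => Fin.succ_injective _ (hf h)
    rw [LineDeriv.iteratedLineDerivOp_succ_left, SchwartzMap.lineDerivOp_apply]
    set e : Eu N := EuclideanSpace.single (f 0) 1 with he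
    refine HasDerivAt.deriv ?_
    have hg : HasDerivAt (fun s : ℝ => gaussKernel t (y + s • e))
        (-(y (f 0) / (2 * t)) * gaussKernel t y) 0 := by
      have h1 : HasDerivAt (fun s : ℝ => ‖y + s • e‖ ^ 2) (2 * y (f 0)) 0 := by
        have h2 : HasDerivAt (fun s : ℝ => y + s • e) e 0 := by
          simpa using ((hasDerivAt_id (0 : ℝ)).smul_const e).const_add y
        convert h2.norm_sq using 1
        simp [he, EuclideanSpace.inner_single_right]
      unfold gaussKernel
      refine (((h1.div_const (4 * t)).neg.exp).const_mul
        ((4 * Real.pi * t) ^ (-(N : ℝ) / 2))).congr_deriv ?_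
      simp only [Pi.neg_apply, zero_smul, add_zero]
      field_simp
      ring
    have hval : (fun s : ℝ => (∂^{Fin.tail fun j => (EuclideanSpace.single (f j) (1 : ℝ) : Eu N)}
        (gaussSchwartz t ht 0)) (y + s • e)) =
        fun s : ℝ => (((∏ j, -(y (f (Fin.succ j)) / (2 * t))) * gaussKernel t (y + s • e) : ℝ) : ℂ) := by
      funext s
      have := ih hf' (y + s • e)
      refine this.trans ?_
      congr 2
      refine Finset.prod_congr rfl fun j _ => ?_
      have : f (Fin.succ j) ≠ f 0 := fun h => Fin.succ_ne_zero j (hf h)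
      simp [he, this]
    change HasDerivAt (fun s : ℝ => (∂^{Fin.tail fun j =>
      (EuclideanSpace.single (f j) (1 : ℝ) : Eu N)} (gaussSchwartz t ht 0)) (y + s • e)) _ _
    rw [hval]
    convert (hg.const_mul (∏ j, -(y (f (Fin.succ j)) / (2 * t)))).ofReal_comp using 2
    rw [Fin.prod_univ_succ]; ring

theorem psi_eq_prod_mul {m : ℕ} (hm : m ≤ N) {t : ℝ} (ht : 0 < t) (y : Eu N) :
    psi m t y = (-1) ^ m * ((∏ j : Fin m, -(y (Fin.castLE hm j) / (2 * t))) * gaussKernel t y) := by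
  rw [psi, Finset.prod_mul_distrib, prod_ite_lt hm, ← gaussKernel_eq_prod ht, Finset.prod_neg,
    Finset.card_univ, Fintype.card_fin, ← mul_assoc, ← mul_assoc, ← mul_pow]
  simp

/-- Against each test function, `(-1)^m ∂₁⋯∂ₘ G_s` acts as `G_s` acts against some test function. -/
theorem exists_integral_psi_smul_eq {m : ℕ} (hm : m ≤ N) (φ : 𝓢(Eu N, ℂ)) :
    ∃ χ : 𝓢(Eu N, ℂ),
      (∀ s : ℝ, 0 < s → ∫ y, psi m s y • φ y = (-1 : ℝ) ^ m • ∫ y, gaussKernel s y • χ y) ∧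
      ∀ T : 𝓢'(Eu N, ℂ),
        (∂^{fun i : Fin m => (EuclideanSpace.single (Fin.castLE hm i) (1 : ℝ) : Eu N)} T) φ = T χ := by
  obtain ⟨χ, hχ⟩ := exists_adjoint_iteratedLineDerivOp
    (fun i : Fin m => (EuclideanSpace.single (Fin.castLE hm i) (1 : ℝ) : Eu N)) φ
  refine ⟨χ, fun s hs => ?_, hχ⟩
  -- The adjoint identity is tested on the distribution `G_s`, whose derivatives are known
  -- pointwise.
  have h := hχ (SchwartzMap.toTemperedDistributionCLM (Eu N) ℂ volume (gaussSchwartz s hs 0))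
  rw [iteratedLineDerivOp_toTemperedDistributionCLM] at h
  replace h := (SchwartzMap.toTemperedDistributionCLM_apply_apply volume _ φ).symm.trans
    (h.trans (SchwartzMap.toTemperedDistributionCLM_apply_apply volume _ χ))
  have h1 : ∫ y, gaussKernel s y • χ y = ∫ y, χ y • gaussSchwartz s hs 0 y := by
    refine integral_congr_ae (.of_forall fun y => ?_)
    simp [gaussSchwartz_apply, gaussKernel_neg, mul_comm]
  rw [h1, ← h, ← integral_smul]
  refine integral_congr_ae (.of_forall fun y => ?_)
  simp only
  rw [iteratedLineDerivOp_gaussSchwartz (Fin.castLE_injective hm) hs, psi_eq_prod_mul hm hs]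
  simp only [Complex.real_smul, smul_eq_mul]
  push_cast
  ring

/-- With the derivatives moved to the test function the `τ`-integral stays convergent at `0`; the
two signs `(-1) ^ m` cancel. -/
theorem initialDatum_eq_integral {m : ℕ} (hm : m ≤ N) {γ : ℝ} (hγ : 0 < γ) (hγN : γ < N) (K : ℝ)
    (φ : 𝓢(Eu N, ℂ)) :
    initialDatum N m hm γ hγ hγN K φ =
      K • ∫ τ in Ioi (0 : ℝ), subDensity N γ τ • ∫ y, psi m τ y • φ y := by
  obtain ⟨χ, h1, h2⟩ := exists_integral_psi_smul_eq hm φ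
  have e : initialDatum N m hm γ hγ hγN K φ =
      ((K * (-1) ^ m : ℝ) : ℂ) • powDistr N γ hγ hγN χ := by
    rw [← h2]; rfl
  rw [e, powDistr_eq_integral, Complex.coe_smul, mul_smul, ← integral_smul ((-1 : ℝ) ^ m)]
  congr 1
  refine setIntegral_congr_fun measurableSet_Ioi fun τ hτ => ?_
  rw [h1 τ hτ, smul_comm]

theorem heatDistr_initialDatum {m : ℕ} (hm : m ≤ N) {γ : ℝ} (hγ : 0 < γ) (hγN : γ < N) (K : ℝ)
    {t : ℝ} (ht : 0 < t) (x : Eu N) :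
    heatDistr (initialDatum N m hm γ hγ hγN K) t x = ((K * linSol N m γ t x : ℝ) : ℂ) := by
  rw [heatDistr, dif_pos ht, initialDatum_eq_integral, linSol_apply hγ hγN ht]
  have h : ∫ τ in Ioi (0 : ℝ), subDensity N γ τ • ∫ y, psi m τ y • gaussSchwartz t ht x y =
      ∫ τ in Ioi (0 : ℝ), ((subDensity N γ τ * psi m (t + τ) x : ℝ) : ℂ) := by
    refine setIntegral_congr_fun measurableSet_Ioi fun τ (hτ : 0 < τ) => ?_
    rw [add_comm t, ← integral_psi_mul_gaussKernel m hτ ht, Complex.ofReal_mul,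
      ← integral_complex_ofReal, Complex.real_smul]
    congr 1
    refine integral_congr_ae (.of_forall fun y => ?_)
    simp [gaussSchwartz_apply, mul_comm]
  rw [h, integral_complex_ofReal, Complex.real_smul, Complex.ofReal_mul]

end

section

variable {N : ℕ}

/-! ### Elements of `C₀` as distributions -/

/-- The pairing `f ↦ ∫ f χ` with an integrable function. -/
def pairC0 {E : Type*} [NormedAddCommGroup E] [NormedSpace ℝ E] {χ : Eu N → E}
    (hχ : Integrable χ) : C₀(Eu N, ℝ) →L[ℝ] E :=
  have hi (f : C₀(Eu N, ℝ)) : Integrable fun y => f y • χ y :=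
    hχ.bdd_smul ‖f‖ f.continuous.aestronglyMeasurable (.of_forall fun y => C0_abs_le f y)
  LinearMap.mkContinuous
    { toFun := fun f => ∫ y, f y • χ y
      map_add' := fun f g => by
        rw [← integral_add (hi f) (hi g)]
        simp_rw [← add_smul]
        rfl
      map_smul' := fun c f => by
        rw [← integral_smul]
        simp_rw [smul_smul]
        rfl }
    (∫ y, ‖χ y‖) fun f => by
      refine (norm_integral_le_integral_norm _).trans ?_
      rw [mul_comm, ← integral_const_mul]
      refine integral_mono (hi f).norm (hχ.norm.const_mul _) fun y => ?_
      simp only [norm_smul]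
      exact mul_le_mul_of_nonneg_right (C0_abs_le f y) (norm_nonneg _)

theorem pairC0_apply {E : Type*} [NormedAddCommGroup E] [NormedSpace ℝ E] {χ : Eu N → E}
    (hχ : Integrable χ) (f : C₀(Eu N, ℝ)) : pairC0 hχ f = ∫ y, f y • χ y := rfl

theorem c0Distr_apply (f : C₀(Eu N, ℝ)) (φ : 𝓢(Eu N, ℂ)) :
    c0Distr f φ = pairC0 φ.integrable f := by
  rw [c0Distr, Lp.toTemperedDistribution_apply, pairC0_apply]
  refine integral_congr_ae ?_
  filter_upwards [(c0_memLp f).coeFn_toLp] with y hy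
  rw [hy, smul_eq_mul, Complex.real_smul, mul_comm]

/-- Moving the derivatives to the test function bounds the pairing `J s` by `B * min 1 (s ^ (-N /
2))` without a singularity at `s = 0`, and dominated convergence applies as `t → 0`. -/
theorem tendsto_pairC0_linSol {m : ℕ} (hm : m ≤ N) {γ : ℝ} (hγ : 0 < γ) (hγN : γ < N)
    (φ : 𝓢(Eu N, ℂ)) :
    Tendsto (fun t => pairC0 φ.integrable (linSol N m γ t)) (𝓝[>] 0)
      (𝓝 (∫ τ in Ioi (0 : ℝ), subDensity N γ τ • ∫ y, psi m τ y • φ y)) := by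
  obtain ⟨χ, h1, -⟩ := exists_integral_psi_smul_eq hm φ
  obtain ⟨C, hC⟩ := schwartz_norm_le χ
  obtain ⟨B, hB0, hB⟩ := exists_integral_gaussKernel_le hC χ.integrable
  set J : ℝ → ℂ := fun s => pairC0 φ.integrable (psiC0 N m s) with hJ
  have hJe : ∀ s : ℝ, 0 < s → J s = ∫ y, psi m s y • φ y := fun s hs => by
    simp only [hJ, pairC0_apply, psiC0_apply m hs]
  have hJc : ContinuousOn J (Ioi 0) :=
    (pairC0 φ.integrable).continuous.comp_continuousOn (continuousOn_psiC0 N m)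
  have hJb : ∀ s : ℝ, 0 < s → ‖J s‖ ≤ B * min 1 (s ^ (-(N : ℝ) / 2)) := fun s hs => by
    rw [hJe s hs, h1 s hs, norm_smul]
    simp only [norm_pow, norm_neg, norm_one, one_pow, one_mul]
    exact (norm_integral_gaussKernel_smul_le _ hs).trans (hB s hs)
  have hlim : ∫ τ in Ioi (0 : ℝ), subDensity N γ τ • ∫ y, psi m τ y • φ y =
      ∫ τ in Ioi (0 : ℝ), subDensity N γ τ • J τ :=
    setIntegral_congr_fun measurableSet_Ioi fun τ hτ => by rw [hJe τ hτ]
  rw [hlim]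
  have hpos : ∀ᶠ t : ℝ in 𝓝[>] 0, 0 < t := eventually_mem_nhdsWithin
  have hev : (fun t => pairC0 φ.integrable (linSol N m γ t)) =ᶠ[𝓝[>] 0]
      fun t => ∫ τ in Ioi (0 : ℝ), subDensity N γ τ • J (t + τ) := by
    filter_upwards [hpos] with t ht
    rw [clm_linSol hγ hγN ht]
  refine Tendsto.congr' hev.symm ?_
  refine tendsto_integral_filter_of_dominated_convergence
    (fun τ => B * (subDensity N γ τ * min 1 (τ ^ (-(N : ℝ) / 2)))) ?_ ?_
    ((integrableOn_subDensity_mul hγ hγN).const_mul B) ?_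
  · filter_upwards [hpos] with t ht
    exact ((continuousOn_subDensity N γ).smul (hJc.comp
      (continuous_const.add continuous_id).continuousOn fun τ hτ =>
        add_pos ht hτ)).aestronglyMeasurable measurableSet_Ioi
  · filter_upwards [hpos] with t ht
    refine (ae_restrict_iff' measurableSet_Ioi).2 (.of_forall fun τ (hτ : 0 < τ) => ?_)
    have hs := subDensity_pos (N := N) hγ hτ
    rw [norm_smul, Real.norm_of_nonneg hs.le]
    have h3 : (t + τ) ^ (-(N : ℝ) / 2) ≤ τ ^ (-(N : ℝ) / 2) :=
      Real.rpow_le_rpow_of_nonpos hτ (by linarith)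
        (div_nonpos_of_nonpos_of_nonneg (by simp) (by norm_num))
    calc _ ≤ subDensity N γ τ * (B * min 1 (τ ^ (-(N : ℝ) / 2))) := by
          gcongr
          exact (hJb _ (add_pos ht hτ)).trans (by gcongr)
      _ = _ := by ring
  · refine (ae_restrict_iff' measurableSet_Ioi).2 (.of_forall fun τ (hτ : 0 < τ) => ?_)
    refine Tendsto.const_smul ?_ _
    have h4 : Tendsto (fun t : ℝ => t + τ) (𝓝[>] 0) (𝓝 τ) := by
      have : Tendsto (fun t : ℝ => t + τ) (𝓝 0) (𝓝 (0 + τ)) :=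
        (continuous_id.add continuous_const).tendsto 0
      rw [zero_add] at this
      exact this.mono_left nhdsWithin_le_nhds
    exact ((hJc.continuousAt (Ioi_mem_nhds hτ)).tendsto).comp h4

/-! ### The anti-symmetric part of a test function -/

/-- The part of `f` that is anti-symmetric in the first `k` variables. -/
def antiPart (f : Eu N → ℂ) : ℕ → Eu N → ℂ
  | 0 => f
  | k + 1 => fun x =>
    if h : k < N then (1 / 2 : ℂ) * (antiPart f k x - antiPart f k (reflect ⟨k, h⟩ x))
    else antiPart f k x

/-- Reflection-invariant weights commute with anti-symmetrization; a radial weight will be used to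
produce decay. -/
theorem antiPart_mul {q : Eu N → ℂ} (hq : ∀ i x, q (reflect i x) = q x) (f : Eu N → ℂ) (k : ℕ)
    (x : Eu N) : antiPart (fun y => q y * f y) k x = q x * antiPart f k x := by
  induction k generalizing x with
  | zero => rfl
  | succ k ih =>
    simp only [antiPart]
    split_ifs with h
    · rw [ih, ih, hq]; ring
    · exact ih x

theorem integrable_antiPart {f : Eu N → ℂ} (hf : Integrable f) (k : ℕ) :
    Integrable (antiPart f k) := by
  induction k with
  | zero => exact hf
  | succ k ih =>
    simp only [antiPart]
    split_ifs with h
    · exact (ih.sub (integrable_comp_reflect ⟨k, h⟩ ih)).const_mul _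
    · exact ih

theorem integral_antiPart {w : C₀(Eu N, ℝ)} {m : ℕ} (hw : AntiSymm m w) {f : Eu N → ℂ}
    (hf : Integrable f) {k : ℕ} (hk : k ≤ m) :
    ∫ y, w y • antiPart f k y = ∫ y, w y • f y := by
  have hi : ∀ {g : Eu N → ℂ}, Integrable g → Integrable fun y => w y • g y := fun hg =>
    hg.bdd_smul ‖w‖ w.continuous.aestronglyMeasurable (.of_forall fun y => C0_abs_le w y)
  induction k with
  | zero => rfl
  | succ k ih =>
    rw [← ih (by omega)]
    by_cases h : k < N
    · have hik := integrable_antiPart hf k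
      have e1 : ∫ y, w y • antiPart f k (reflect ⟨k, h⟩ y) = -∫ y, w y • antiPart f k y := by
        rw [← integral_comp_reflect ⟨k, h⟩ fun y => w y • antiPart f k y, ← integral_neg]
        refine integral_congr_ae (.of_forall fun y => ?_)
        simp only
        rw [hw ⟨k, h⟩ (by simp only; omega) y, neg_smul, neg_neg]
      have e2 : ∀ y, w y • antiPart f (k + 1) y =
          (1 / 2 : ℂ) * (w y • antiPart f k y - w y • antiPart f k (reflect ⟨k, h⟩ y)) := fun y => by
        simp only [antiPart, dif_pos h, Complex.real_smul]; ring
      simp_rw [e2]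
      rw [integral_const_mul, integral_sub (hi hik) (hi (integrable_comp_reflect ⟨k, h⟩ hik)), e1]
      ring
    · simp only [antiPart, dif_neg h]

/-- The direction `e` is fixed by the reflections involved, so anti-symmetrization commutes with the
derivative along `e`. -/
theorem hasDerivAt_antiPart {f f' : Eu N → ℂ} {e : Eu N}
    (hf : ∀ x, HasDerivAt (fun s : ℝ => f (x + s • e)) (f' x) 0) {k : ℕ}
    (he : ∀ i : Fin N, i.val < k → reflect i e = e) (x : Eu N) :
    HasDerivAt (fun s : ℝ => antiPart f k (x + s • e)) (antiPart f' k x) 0 := by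
  induction k generalizing x with
  | zero => exact hf x
  | succ k ih =>
    have ih := ih fun i hi => he i (by omega)
    simp only [antiPart]
    split_ifs with h
    · have h1 : ∀ s : ℝ, reflect ⟨k, h⟩ (x + s • e) = reflect ⟨k, h⟩ x + s • e := fun s => by
        rw [← reflectL_apply, map_add, map_smul, reflectL_apply, reflectL_apply,
          he ⟨k, h⟩ (by simp)]
      simp_rw [h1]
      exact ((ih x).sub (ih _)).const_mul _
    · exact ih x

/-- Induction on `k` over all test functions. The new anti-symmetrization is half the difference of
two values at distance `2 * |x i|`. The mean value inequality gains `|x i|`, and the derivative is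
the anti-symmetric part of `∂ᵢ φ`, bounded by the induction hypothesis. -/
theorem norm_antiPart_le {k : ℕ} (hk : k ≤ N) (φ : 𝓢(Eu N, ℂ)) :
    ∃ C, ∀ x, ‖antiPart φ k x‖ ≤ C * |coordProd k x| := by
  induction k generalizing φ with
  | zero =>
    obtain ⟨C, hC⟩ := schwartz_norm_le φ
    exact ⟨C, fun x => by simpa [coordProd, antiPart] using hC x⟩
  | succ k ih =>
    set i : Fin N := ⟨k, hk⟩ with hi
    set e : Eu N := EuclideanSpace.single i 1 with he
    obtain ⟨φ', hφ'⟩ : ∃ φ' : 𝓢(Eu N, ℂ), φ' = ∂_{e} φ := ⟨_, rfl⟩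
    obtain ⟨C, hC⟩ := ih (by omega) φ'
    refine ⟨C, fun x => ?_⟩
    have hd : ∀ x, HasDerivAt (fun s : ℝ => φ (x + s • e)) (φ' x) 0 := fun x => by
      rw [hφ', SchwartzMap.lineDerivOp_apply]
      exact (φ.differentiableAt.lineDifferentiableAt).hasLineDerivAt
    have hre : ∀ j : Fin N, j.val < k → reflect j e = e := fun j hj => by
      refine reflect_eq_self ?_
      have : j ≠ i := fun h => by rw [h] at hj; simp [hi] at hj
      simp [he, this]
    have hA := hasDerivAt_antiPart hd hre
    have hcp : ∀ s : ℝ, coordProd k (x + s • e) = coordProd k x := fun s => by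
      unfold coordProd
      refine Finset.prod_congr rfl fun j _ => ?_
      split_ifs with hj
      · have : j ≠ i := fun h => by rw [h] at hj; simp [hi] at hj
        simp [he, this]
      · rfl
    have hcp1 : coordProd (k + 1) x = coordProd k x * x i := by
      unfold coordProd
      rw [← Finset.mul_prod_erase _ _ (Finset.mem_univ i),
        ← Finset.mul_prod_erase _ (fun j : Fin N => if j.val < k then x j else 1)
          (Finset.mem_univ i)]
      have h1 : (if i.val < k + 1 then x i else 1) = x i := by simp [hi]
      have h2 : (if i.val < k then x i else 1) = 1 := by simp [hi]
      rw [h1, h2, one_mul, mul_comm]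
      congr 1
      refine Finset.prod_congr rfl fun j hj => ?_
      have h3 : j.val ≠ k := fun h => (Finset.ne_of_mem_erase hj) (Fin.ext h)
      have : (j.val < k + 1) ↔ j.val < k := by omega
      simp only [this]
    have hder : ∀ s : ℝ, HasDerivAt (fun s : ℝ => antiPart φ k (x + s • e))
        (antiPart φ' k (x + s • e)) s := fun s => by
      have h := hA (x + s • e)
      have h2 := HasDerivAt.comp_sub_const (f := fun r : ℝ => antiPart φ k (x + s • e + r • e)) s s
        (by rw [sub_self]; exact h)
      refine h2.congr_of_eventuallyEq (.of_forall fun r => ?_)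
      simp only
      rw [add_assoc, ← add_smul, add_sub_cancel]
    -- The segment from `x` to its reflection is `s ∈ [-2 * x i, 0]`; the first `k` coordinates,
    -- hence the derivative bound, are constant along it.
    have hmv := convex_univ.norm_image_sub_le_of_norm_hasDerivWithin_le
      (f := fun s : ℝ => antiPart φ k (x + s • e)) (C := C * |coordProd k x|)
      (fun s _ => (hder s).hasDerivWithinAt)
      (fun s _ => by rw [← hcp s]; exact hC _) (mem_univ (-(2 * x i))) (mem_univ 0)
    have hrx : x + (-(2 * x i)) • e = reflect i x := by
      ext j
      by_cases hj : j = i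
      · subst hj; simp [he, reflect_self]; ring
      · simp [he, reflect_of_ne hj, hj]
    rw [hrx, zero_smul, add_zero] at hmv
    have e3 : antiPart φ (k + 1) x = (1 / 2 : ℂ) * (antiPart φ k x - antiPart φ k (reflect i x)) := by
      have : k < N := hk
      simp only [antiPart, dif_pos this, hi]
    rw [e3, norm_mul, hcp1, abs_mul]
    have h0 : ‖(0 : ℝ) - -(2 * x i)‖ = 2 * |x i| := by
      rw [zero_sub, neg_neg, Real.norm_eq_abs, abs_mul]; norm_num
    rw [h0] at hmv
    have h5 : ‖(1 / 2 : ℂ)‖ = 1 / 2 := by norm_num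
    rw [h5]
    linarith

theorem coordProd_mul_psi_le (m : ℕ) {t : ℝ} (ht : 0 < t) (x : Eu N) :
    coordProd m x * psi m t x ≤ 8 ^ N * gaussKernel (2 * t) x := by
  have e : (8 : ℝ) ^ N * gaussKernel (2 * t) x = ∏ i, 8 * gauss (2 * t) (x i) := by
    rw [gaussKernel_eq_prod (by positivity)]; simp [Finset.prod_mul_distrib]
  rw [e, coordProd, psi, ← Finset.prod_mul_distrib]
  have hg := fun i => gauss_pos ht (x i)
  have hg2 := fun i => gauss_pos (t := 2 * t) (by positivity) (x i)
  refine Finset.prod_le_prod (fun i _ => ?_) fun i _ => ?_ <;> split_ifs with hi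
  · have : x i * (x i / (2 * t) * gauss t (x i)) = x i ^ 2 / (2 * t) * gauss t (x i) := by ring
    rw [this]
    have := hg i
    positivity
  · simpa using (hg i).le
  · have : x i * (x i / (2 * t) * gauss t (x i)) = x i ^ 2 / (2 * t) * gauss t (x i) := by ring
    rw [this]
    exact sq_div_mul_gauss_le ht (x i)
  · have := gauss_le_two_mul ht (x i)
    have := hg2 i
    linarith

/-! ### Weighted moments of the linear solution -/

/-- A polynomially decaying weight. -/
def decayWeight (x : Eu N) : ℝ := ((1 + ‖x‖ ^ 2) ^ (2 * N + 1))⁻¹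

theorem decayWeight_pos (x : Eu N) : 0 < decayWeight x := by unfold decayWeight; positivity

theorem continuous_decayWeight : Continuous (decayWeight : Eu N → ℝ) := by
  unfold decayWeight
  exact Continuous.inv₀ (by fun_prop) fun x => by positivity

theorem integrable_one_add_norm_sq_pow_inv :
    Integrable fun x : Eu N => ((1 + ‖x‖ ^ 2) ^ (N + 1))⁻¹ := by
  have h := integrable_rpow_neg_one_add_norm_sq (E := Eu N) (μ := volume) (r := 2 * N + 2)
    (by simp; linarith [(Nat.cast_nonneg N : (0 : ℝ) ≤ N)])
  refine h.congr (.of_forall fun x => ?_)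
  simp only
  rw [← Real.rpow_natCast _ (N + 1), ← Real.rpow_neg (by positivity)]
  congr 1; push_cast; ring

theorem decayWeight_le (x : Eu N) : decayWeight x ≤ ((1 + ‖x‖ ^ 2) ^ (N + 1))⁻¹ := by
  unfold decayWeight
  have h1 : (1 : ℝ) ≤ 1 + ‖x‖ ^ 2 := by simp
  exact inv_anti₀ (by positivity) (pow_le_pow_right₀ h1 (by omega))

theorem abs_coordProd_le (m : ℕ) (x : Eu N) : |coordProd m x| ≤ (1 + ‖x‖ ^ 2) ^ N := by
  have e : (1 + ‖x‖ ^ 2) ^ N = ∏ _i : Fin N, (1 + ‖x‖ ^ 2) := by simp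
  rw [coordProd, Finset.abs_prod, e]
  refine Finset.prod_le_prod (fun _ _ => abs_nonneg _) fun i _ => ?_
  have h1 : |x i| ≤ ‖x‖ := by simpa using PiLp.norm_apply_le x i
  split_ifs
  · nlinarith [sq_nonneg (‖x‖ - 1), norm_nonneg x]
  · simp

theorem integrable_decayWeight : Integrable (decayWeight : Eu N → ℝ) :=
  integrable_one_add_norm_sq_pow_inv.mono' continuous_decayWeight.aestronglyMeasurable
    (.of_forall fun x => by
      rw [Real.norm_of_nonneg (decayWeight_pos x).le]; exact decayWeight_le x)

/-- The exponent `2 * N + 1` of the weight splits into `N`, which absorbs the polynomial, and `N +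
1`, which ensures integrability. -/
theorem integrable_coordProd_mul_decayWeight (m : ℕ) :
    Integrable fun x : Eu N => coordProd m x * decayWeight x := by
  refine integrable_one_add_norm_sq_pow_inv.mono'
    ((continuous_coordProd m).mul continuous_decayWeight).aestronglyMeasurable
    (.of_forall fun x => ?_)
  rw [norm_mul, Real.norm_of_nonneg (decayWeight_pos x).le, Real.norm_eq_abs]
  calc _ ≤ (1 + ‖x‖ ^ 2) ^ N * decayWeight x :=
        mul_le_mul_of_nonneg_right (abs_coordProd_le m x) (decayWeight_pos x).le
    _ = _ := by
        rw [decayWeight, show 2 * N + 1 = N + (N + 1) by ring, pow_add (1 + ‖x‖ ^ 2) N]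
        have : (1 + ‖x‖ ^ 2) ≠ 0 := by positivity
        field_simp

/-- The inverse weight `q` is a radial polynomial, so `q * φ` is again Schwartz and its
anti-symmetric part is `q` times that of `φ`. -/
theorem norm_antiPart_le_decayWeight {m : ℕ} (hm : m ≤ N) (φ : 𝓢(Eu N, ℂ)) :
    ∃ C, ∀ x, ‖antiPart φ m x‖ ≤ C * (|coordProd m x| * decayWeight x) := by
  set q : Eu N → ℂ := fun x => (((1 + ‖x‖ ^ 2) ^ (2 * N + 1) : ℝ) : ℂ) with hq
  have hqt : q.HasTemperateGrowth := by
    have h1 : (fun x : Eu N => (1 + ‖x‖ ^ 2) ^ (2 * N + 1)).HasTemperateGrowth :=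
      ((Function.HasTemperateGrowth.const 1).add
        (Function.hasTemperateGrowth_norm_sq (H := Eu N))).pow _
    exact Complex.ofRealCLM.hasTemperateGrowth.comp h1
  obtain ⟨C, hC⟩ := norm_antiPart_le hm (SchwartzMap.smulLeftCLM ℂ q φ)
  refine ⟨C, fun x => ?_⟩
  have e1 : ⇑(SchwartzMap.smulLeftCLM ℂ q φ) = fun x => q x * φ x := by
    funext y; rw [SchwartzMap.smulLeftCLM_apply_apply hqt, smul_eq_mul]
  have h := hC x
  rw [e1, antiPart_mul (fun i y => by simp only [hq, norm_reflect]), norm_mul] at h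
  have e2 : ‖q x‖ = (decayWeight x)⁻¹ := by
    rw [hq, Complex.norm_real, decayWeight, inv_inv, Real.norm_of_nonneg (by positivity)]
  rw [e2, inv_mul_le_iff₀ (decayWeight_pos x)] at h
  linarith

/-- The product `x₁⋯xₘ ψ(s)` is at most `8 ^ N * G_{2s}`: each `x i ^ 2 / (2 * s)` is absorbed by
doubling the time. Hence the moment stays bounded as `t → 0` although `linSol` does not. -/
theorem exists_integral_coordProd_linSol_le (m : ℕ) {γ : ℝ} (hγ : 0 < γ) (hγN : γ < N) :
    ∃ B, ∀ t : ℝ, 0 < t →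
      pairC0 (integrable_coordProd_mul_decayWeight (N := N) m) (linSol N m γ t) ≤ B := by
  obtain ⟨B, hB0, hB⟩ := exists_integral_gaussKernel_le (χ := (decayWeight : Eu N → ℝ)) (C := 1)
    (fun y => by
      rw [Real.norm_of_nonneg (decayWeight_pos y).le]
      exact (decayWeight_le y).trans (inv_le_one_of_one_le₀ (one_le_pow₀ (by simp))))
    integrable_decayWeight
  refine ⟨∫ τ in Ioi (0 : ℝ), 8 ^ N * B * (subDensity N γ τ * min 1 (τ ^ (-(N : ℝ) / 2))),
    fun t ht => ?_⟩
  rw [clm_linSol hγ hγN ht]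
  refine (Real.le_norm_self _).trans (norm_integral_le_of_norm_le
    ((integrableOn_subDensity_mul hγ hγN).const_mul _) ?_)
  refine (ae_restrict_iff' measurableSet_Ioi).2 (.of_forall fun τ (hτ : 0 < τ) => ?_)
  have hs := subDensity_pos (N := N) hγ hτ
  have hs0 : 0 < 2 * (t + τ) := by positivity
  have h3 : (2 * (t + τ)) ^ (-(N : ℝ) / 2) ≤ τ ^ (-(N : ℝ) / 2) :=
    Real.rpow_le_rpow_of_nonpos hτ (by linarith)
      (div_nonpos_of_nonpos_of_nonneg (by simp) (by norm_num))
  have hnn : ∀ y : Eu N, 0 ≤ psiC0 N m (t + τ) y • (coordProd m y * decayWeight y) := fun y => by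
    rw [psiC0_apply m (by positivity), smul_eq_mul]
    have := mul_nonneg (coordProd_mul_psi_nonneg m (t := t + τ) (by positivity) y)
      (decayWeight_pos y).le
    linarith
  have h4 : pairC0 (integrable_coordProd_mul_decayWeight (N := N) m) (psiC0 N m (t + τ)) ≤
      8 ^ N * (B * min 1 (τ ^ (-(N : ℝ) / 2))) := by
    rw [pairC0_apply]
    calc _ ≤ ∫ y : Eu N, 8 ^ N * (gaussKernel (2 * (t + τ)) y * ‖decayWeight y‖) := by
          refine integral_mono_of_nonneg (.of_forall hnn)
            ((integrable_gaussKernel_smul integrable_decayWeight.norm hs0).const_mul _)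
            (.of_forall fun y => ?_)
          simp only
          rw [psiC0_apply m (by positivity), smul_eq_mul,
            Real.norm_of_nonneg (decayWeight_pos y).le]
          have := mul_le_mul_of_nonneg_right (coordProd_mul_psi_le m (t := t + τ) (by positivity) y)
            (decayWeight_pos y).le
          linarith
      _ ≤ _ := by
          rw [integral_const_mul]
          gcongr
          exact (hB _ hs0).trans (by gcongr)
  have h5 : 0 ≤ pairC0 (integrable_coordProd_mul_decayWeight (N := N) m) (psiC0 N m (t + τ)) :=
    integral_nonneg hnn
  rw [norm_smul, Real.norm_of_nonneg hs.le, Real.norm_of_nonneg h5]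
  calc _ ≤ subDensity N γ τ * (8 ^ N * (B * min 1 (τ ^ (-(N : ℝ) / 2)))) := by gcongr
    _ = _ := by ring

/-- Only the anti-symmetric part of `φ` is seen by `w`, and it is dominated by the weight of the
preceding bound. As `B` is independent of `t`, a relative error `ε` in the gauge is an error `O(ε)`
in the sense of distributions. -/
theorem norm_pairC0_le_of_abs_le_linSol {m : ℕ} (hm : m ≤ N) {γ : ℝ} (hγ : 0 < γ) (hγN : γ < N)
    (φ : 𝓢(Eu N, ℂ)) :
    ∃ B, ∀ (t : ℝ) (w : C₀(Eu N, ℝ)) (ε : ℝ), 0 < t → 0 ≤ ε → AntiSymm m w →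
      (∀ x, |w x| ≤ ε * |linSol N m γ t x|) → ‖pairC0 φ.integrable w‖ ≤ ε * B := by
  obtain ⟨C, hC⟩ := norm_antiPart_le_decayWeight hm φ
  obtain ⟨B, hB⟩ := exists_integral_coordProd_linSol_le (N := N) m hγ hγN
  have hC' : ∀ x, ‖antiPart φ m x‖ ≤ max C 0 * (|coordProd m x| * decayWeight x) := fun x =>
    (hC x).trans (mul_le_mul_of_nonneg_right (le_max_left _ _)
      (mul_nonneg (abs_nonneg _) (decayWeight_pos x).le))
  refine ⟨max C 0 * B, fun t w ε ht hε hw hle => ?_⟩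
  set hχ := integrable_coordProd_mul_decayWeight (N := N) m
  have hi : Integrable fun y => linSol N m γ t y • (coordProd m y * decayWeight y) :=
    hχ.bdd_smul ‖linSol N m γ t‖ (linSol N m γ t).continuous.aestronglyMeasurable
      (.of_forall fun y => C0_abs_le _ y)
  rw [pairC0_apply, ← integral_antiPart hw φ.integrable le_rfl]
  calc _ ≤ ∫ y, ε * (max C 0) * (linSol N m γ t y • (coordProd m y * decayWeight y)) := by
        refine norm_integral_le_of_norm_le (hi.const_mul _) (.of_forall fun y => ?_)
        rw [norm_smul, Real.norm_eq_abs]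
        have e : linSol N m γ t y • (coordProd m y * decayWeight y) =
            |linSol N m γ t y| * (|coordProd m y| * decayWeight y) := by
          rw [← mul_assoc, ← abs_mul, mul_comm (linSol N m γ t y),
            abs_of_nonneg (coordProd_mul_linSol_nonneg hγ hγN ht y), smul_eq_mul]
          ring
        rw [e]
        calc _ ≤ (ε * |linSol N m γ t y|) * (max C 0 * (|coordProd m y| * decayWeight y)) :=
              mul_le_mul (hle y) (hC' y) (norm_nonneg _) (by positivity)
          _ = _ := by ring
    _ = ε * (max C 0) * pairC0 hχ (linSol N m γ t) := by rw [integral_const_mul, pairC0_apply]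
    _ ≤ ε * (max C 0) * B := by
        have := hB t ht
        gcongr
    _ = _ := by ring

end

section

variable {N : ℕ}

/-! ### The integral equation in `C₀` -/

theorem isSolution_iff_isMild {m : ℕ} (hm : m ≤ N) {γ : ℝ} (hγ : 0 < γ) (hγN : γ < N) {K a α : ℝ}
    (ha : a ≠ 0) (hα : 0 < α) {I : Set ℝ} (hI : I ⊆ Ioi 0) (u : ℝ → C₀(Eu N, ℝ)) :
    IsSolution a α hα (initialDatum N m hm γ hγ hγN K) I u ↔
      IsMild (heatSemigroup N) (fun f => a • nonlin α hα f) (fun t => K • linSol N m γ t) I u := by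
  unfold IsSolution IsMild
  refine and_congr_right fun _ => forall₂_congr fun t ht => ?_
  have e : (fun σ => heatSemigroup N (t - σ) (a • nonlin α hα (u σ))) =
      fun σ => a • heatC0 (t - σ) (nonlin α hα (u σ)) := by
    funext σ; exact heatC0_map_smul _ _ _
  simp only [e]
  have hint : (∫ σ in (0 : ℝ)..t, a • heatC0 (t - σ) (nonlin α hα (u σ))) =
      a • ∫ σ in (0 : ℝ)..t, heatC0 (t - σ) (nonlin α hα (u σ)) := intervalIntegral.integral_smul _ _
  have hii : IntervalIntegrable (fun σ => a • heatC0 (t - σ) (nonlin α hα (u σ))) volume 0 t ↔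
      IntervalIntegrable (fun σ => heatC0 (t - σ) (nonlin α hα (u σ))) volume 0 t := by
    refine ⟨fun h => ?_, fun h => h.smul a⟩
    have := h.smul a⁻¹
    simpa [smul_smul, Pi.smul_def, inv_mul_cancel₀ ha] using this
  rw [hint, hii]
  refine and_congr_right fun _ => ?_
  constructor
  · intro h
    ext x
    have h1 := h x
    rw [heatDistr_initialDatum hm hγ hγN K (hI ht)] at h1
    exact_mod_cast h1
  · intro h x
    rw [heatDistr_initialDatum hm hγ hγN K (hI ht), h]
    push_cast [ZeroAtInftyContinuousMap.add_apply, ZeroAtInftyContinuousMap.smul_apply, smul_eq_mul]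
    rfl

/-! ### The gauge given by the linear solution -/

/-- `f` is anti-symmetric and bounded by `c` times the linear solution at time `t`. -/
def LinBound (N m : ℕ) (γ t c : ℝ) (f : C₀(Eu N, ℝ)) : Prop :=
  AntiSymm m f ∧ 0 ≤ c ∧ ∀ x, |f x| ≤ c * |linSol N m γ t x|

/-- The Lipschitz constant of the nonlinearity on functions bounded by `M` times the linear
solution. -/
def lipConst (N m : ℕ) (γ α M t : ℝ) : ℝ := (α + 1) * (M * ‖linSol N m γ t‖) ^ α

theorem lipConst_nonneg {m : ℕ} {γ α M : ℝ} (hα : 0 < α) (hM : 0 ≤ M) (t : ℝ) :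
    0 ≤ lipConst N m γ α M t := by unfold lipConst; positivity

/-- The condition on `α` says exactly that the exponent `-(γ + m) / 2 * α` exceeds `-1`. -/
theorem intervalIntegrable_lipConst {m : ℕ} (hm : m ≤ N) {γ : ℝ} (hγ : 0 < γ) (hγN : γ < N)
    {α : ℝ} (hα : 0 < α) (hαc : α < 2 / (γ + m)) {M : ℝ} (hM : 0 ≤ M) {T : ℝ} (hT : 0 ≤ T) :
    IntervalIntegrable (lipConst N m γ α M) volume 0 T := by
  have hγm : 0 < γ + m := by positivity
  have hb : -1 < -(γ + m) / 2 * α := by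
    rw [lt_div_iff₀ hγm] at hαc; linarith
  refine intervalIntegrable_of_continuousOn_Ioo hT ?_ ((intervalIntegral.intervalIntegrable_rpow' hb
    ).const_mul ((α + 1) * (M * ‖linSol N m γ 1‖) ^ α)) fun σ hσ => ?_
  · have h1 : ContinuousOn (fun t => ‖linSol N m γ t‖) (Ioo 0 T) :=
      ((continuousOn_linSol hγ hγN).mono fun t ht => ht.1).norm
    exact continuousOn_const.mul ((continuousOn_const.mul h1).rpow_const fun _ _ => Or.inr hα.le)
  · rw [Real.norm_of_nonneg (lipConst_nonneg hα hM σ), lipConst, mul_assoc]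
    have h0 := norm_linSol_le hm hγ hγN hσ.1
    have h1 : (M * ‖linSol N m γ 1‖) ^ α * σ ^ (-(γ + m) / 2 * α) =
        (M * (σ ^ (-(γ + m) / 2) * ‖linSol N m γ 1‖)) ^ α := by
      rw [Real.rpow_mul hσ.1.le, ← Real.mul_rpow (by positivity)
        (Real.rpow_nonneg hσ.1.le _)]
      congr 1; ring
    rw [h1]
    gcongr

/-- The heat axiom is the comparison principle together with `heatC0_linSol`. In the Lipschitz axiom
the power `α` of the linear solution is estimated in sup norm, while the remaining factor is kept
pointwise so that the gauge is reproduced. -/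
theorem isGauge_linBound {m : ℕ} (hm : m ≤ N) {γ : ℝ} (hγ : 0 < γ) (hγN : γ < N) {a α : ℝ}
    (ha : |a| = 1) (hα : 0 < α) (hαc : α < 2 / (γ + m)) {M : ℝ} (hM : 0 ≤ M) {T : ℝ} (hT : 0 ≤ T) :
    IsGauge (heatSemigroup N) (fun f => a • nonlin α hα f) T M (lipConst N m γ α M)
      (fun t => ‖linSol N m γ t‖) (LinBound N m γ) where
  norm_le t ht c f hf := by
    refine C0_norm_le (mul_nonneg hf.2.1 (norm_nonneg _)) fun x => (hf.2.2 x).trans ?_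
    exact mul_le_mul_of_nonneg_left (C0_abs_le _ x) hf.2.1
  cont_bound := ((continuousOn_linSol hγ hγN).mono fun t ht => ht.1).norm
  mono t ht c d f hcd hf := ⟨hf.1, hf.2.1.trans hcd, fun x => (hf.2.2 x).trans
    (mul_le_mul_of_nonneg_right hcd (abs_nonneg _))⟩
  add t ht c d f g hf hg := ⟨hf.1.add hg.1, add_nonneg hf.2.1 hg.2.1, fun x => by
    rw [add_mul]
    exact (abs_add_le _ _).trans (add_le_add (hf.2.2 x) (hg.2.2 x))⟩
  neg t ht c f hf := ⟨fun i hi x => by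
    simp [hf.1 i hi], hf.2.1, fun x => by simpa using hf.2.2 x⟩
  closed t ht c := by
    have e : {f : C₀(Eu N, ℝ) | LinBound N m γ t c f} = {f : C₀(Eu N, ℝ) | AntiSymm m f} ∩
        ({_f : C₀(Eu N, ℝ) | 0 ≤ c} ∩
        ⋂ x, {f : C₀(Eu N, ℝ) | |f x| ≤ c * |linSol N m γ t x|}) := by
      ext f; simp [LinBound]
    rw [e]
    refine (isClosed_antiSymm m).inter (isClosed_const.inter (isClosed_iInter fun x => ?_))
    exact isClosed_le (evalC0 x).continuous.abs continuous_const
  zero t ht := ⟨fun i _ x => by simp, le_rfl, fun x => by simp⟩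
  heat σ t c f hσ hσt htT hf := by
    refine ⟨hf.1.heatC0 _, hf.2.1, fun x => ?_⟩
    have h := abs_heatC0_le hm hf.1 (g := c • linSol N m γ σ)
      ((antiSymm_linSol hγ hγN hσ).const_mul c)
      (fun y => by
        have := mul_nonneg hf.2.1 (coordProd_mul_linSol_nonneg (m := m) hγ hγN hσ y)
        rw [ZeroAtInftyContinuousMap.smul_apply, smul_eq_mul]
        linarith)
      (fun y => by
        rw [ZeroAtInftyContinuousMap.smul_apply, smul_eq_mul, abs_mul, abs_of_nonneg hf.2.1]
        exact hf.2.2 y) (t - σ) x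
    rw [heatC0_map_smul, heatC0_linSol hγ hγN (by linarith) hσ, sub_add_cancel,
      ZeroAtInftyContinuousMap.smul_apply, smul_eq_mul, abs_mul, abs_of_nonneg hf.2.1] at h
    exact h
  integral t ht g c hc hg h := by
    have hℓ : IntervalIntegrable (lipConst N m γ α M) volume 0 t :=
      intervalIntegrable_lipConst hm hγ hγN hα hαc hM ht.1.le
    refine ⟨AntiSymm.intervalIntegral ht.1.le hg fun σ hσ => (h σ hσ).1,
      mul_nonneg (intervalIntegral.integral_nonneg ht.1.le fun σ _ => lipConst_nonneg hα hM σ) hc,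
      fun x => ?_⟩
    rw [intervalIntegral_apply hg, ← Real.norm_eq_abs, mul_assoc,
      ← intervalIntegral.integral_mul_const]
    refine intervalIntegral.norm_integral_le_of_norm_le ht.1.le ?_ (hℓ.mul_const _)
    filter_upwards [compl_mem_ae_iff.2 (measure_singleton (μ := volume) t)] with σ hσ hσ'
    have := (h σ ⟨hσ'.1, lt_of_le_of_ne hσ'.2 hσ⟩).2.2 x
    rw [Real.norm_eq_abs]
    linarith
  lip_nonneg σ _ := lipConst_nonneg hα hM σ
  lip_integrable := intervalIntegrable_lipConst hm hγ hγN hα hαc hM hT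
  lip σ hσ f g d hd hf hg hfg := by
    refine ⟨fun i hi x => ?_, mul_nonneg (lipConst_nonneg hα hM σ) hd, fun x => ?_⟩
    · have h1 := (hf.1.nonlin hα) i hi x
      have h2 := (hg.1.nonlin hα) i hi x
      simp only [ZeroAtInftyContinuousMap.sub_apply, ZeroAtInftyContinuousMap.smul_apply,
        smul_eq_mul, h1, h2]
      ring
    · have h1 := abs_rpow_mul_sub_le hα (hf.2.2 x) (hg.2.2 x)
      have h2 := hfg.2.2 x
      have h3 := C0_abs_le (linSol N m γ σ) x
      have h4 : |(a • nonlin α hα f - a • nonlin α hα g) x| =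
          |(|f x| ^ α * f x - |g x| ^ α * g x)| := by
        rw [ZeroAtInftyContinuousMap.sub_apply, ZeroAtInftyContinuousMap.smul_apply,
          ZeroAtInftyContinuousMap.smul_apply, ← smul_sub, smul_eq_mul, abs_mul, ha, one_mul]
        rfl
      rw [h4]
      calc _ ≤ (α + 1) * (M * |linSol N m γ σ x|) ^ α * |f x - g x| := h1
        _ ≤ (α + 1) * (M * ‖linSol N m γ σ‖) ^ α * (d * |linSol N m γ σ x|) := by
            gcongr
            exact h2
        _ = _ := by unfold lipConst; ring
  map_zero := (isLocLip_nonlin (N := N) (a := a) hα).map_zero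

/-! ### Finite time blow-up for the source nonlinearity -/

/-- Weighted AM-GM with weights `α / (1 + α)` and `1 / (1 + α)`; it places the convex power above
its tangent at `z`. -/
theorem tangent_le_rpow {α r z : ℝ} (hα : 0 < α) (hr : 0 ≤ r) (hz : 0 ≤ z) :
    (1 + α) * z ^ α * r - α * z ^ (1 + α) ≤ r ^ (1 + α) := by
  have h := Real.geom_mean_le_arith_mean2_weighted (w₁ := α / (1 + α)) (w₂ := 1 / (1 + α))
    (p₁ := z ^ (1 + α)) (p₂ := r ^ (1 + α)) (by positivity) (by positivity) (by positivity)
    (by positivity) (by field_simp; ring)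
  have h0 : (1 + α) ≠ 0 := by positivity
  rw [← Real.rpow_mul hz, ← Real.rpow_mul hr, mul_div_cancel₀ _ h0, mul_one_div_cancel h0,
    Real.rpow_one] at h
  have h1 : 0 < 1 + α := by positivity
  have h2 := mul_le_mul_of_nonneg_left h h1.le
  have h3 : (1 + α) * (α / (1 + α) * z ^ (1 + α) + 1 / (1 + α) * r ^ (1 + α)) =
      α * z ^ (1 + α) + r ^ (1 + α) := by field_simp
  rw [h3] at h2
  linarith

/-- Jensen's inequality for the heat flow on the sector, whose kernel has mass at most one. The
tangent is taken at `z`, the heat flow value itself, and the constant lower bound `-α * z ^ (1 + α)`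
is preserved by `heatC0_lower_bound`. -/
theorem rpow_heatC0_le_heatC0_nonlin {m : ℕ} (hm : m ≤ N) {α : ℝ} (hα : 0 < α) {f : C₀(Eu N, ℝ)}
    (hf : AntiSymm m f) (hs : ∀ y, 0 ≤ coordProd m y * f y) (t : ℝ) {x : Eu N}
    (hx : x ∈ sector N m) :
    0 ≤ heatC0 t f x ∧ heatC0 t f x ^ (1 + α) ≤ heatC0 t (nonlin α hα f) x := by
  have hp := coordProd_pos hx
  set z := heatC0 t f x with hz
  have hz0 : 0 ≤ z := nonneg_of_mul_nonneg_right (heatC0_sign hm hf hs t x) hp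
  refine ⟨hz0, ?_⟩
  have hg : AntiSymm m (nonlin α hα f - ((1 + α) * z ^ α) • f : C₀(Eu N, ℝ)) := fun i hi y => by
    have h1 := (hf.nonlin hα) i hi y
    have h2 := hf i hi y
    simp only [ZeroAtInftyContinuousMap.sub_apply, ZeroAtInftyContinuousMap.smul_apply,
      smul_eq_mul, h1, h2]
    ring
  have h := heatC0_lower_bound hm hg (b := α * z ^ (1 + α)) (by positivity) (fun y => by
    have e : coordProd m y * (nonlin α hα f - ((1 + α) * z ^ α) • f : C₀(Eu N, ℝ)) y =
        |coordProd m y| * (|f y| ^ (1 + α) - (1 + α) * z ^ α * |f y|) := by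
      have e1 : coordProd m y * f y = |coordProd m y| * |f y| := by
        rw [← abs_mul, abs_of_nonneg (hs y)]
      have e2 : |f y| ^ (1 + α) = |f y| ^ α * |f y| := by
        rw [add_comm, Real.rpow_add_one' (abs_nonneg _) (by positivity)]
      simp only [ZeroAtInftyContinuousMap.sub_apply, ZeroAtInftyContinuousMap.smul_apply,
        smul_eq_mul, nonlin_apply]
      rw [e2]
      linear_combination (|f y| ^ α - (1 + α) * z ^ α) * e1
    rw [e]
    have := tangent_le_rpow hα (abs_nonneg (f y)) hz0
    nlinarith [abs_nonneg (coordProd m y)]) t x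
  rw [heatC0_map_sub, heatC0_map_smul, ZeroAtInftyContinuousMap.sub_apply,
    ZeroAtInftyContinuousMap.smul_apply, smul_eq_mul, abs_of_pos hp, ← hz] at h
  have e2 : z ^ (1 + α) = z ^ α * z := by
    rw [add_comm, Real.rpow_add_one' hz0 (by positivity)]
  have h5 : 0 ≤ heatC0 t (nonlin α hα f) x - (1 + α) * z ^ α * z + α * z ^ (1 + α) := by
    refine nonneg_of_mul_nonneg_right ?_ hp
    linarith
  rw [e2] at h5 ⊢
  linarith

/-- The primitive `Y` satisfies `Y' ≥ Y ^ (1 + α)`, so `Y ^ (-α) + α * s` is nonincreasing; `y`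
itself need not be differentiable. -/
theorem mul_le_rpow_neg_of_integral_le {α A t : ℝ} (hα : 0 < α) (hA : 0 < A) (ht : 0 ≤ t)
    {y : ℝ → ℝ} (hy : ContinuousOn y (Icc 0 t)) (hy0 : ∀ s ∈ Icc 0 t, 0 ≤ y s)
    (h : ∀ s ∈ Icc 0 t, A + ∫ σ in (0 : ℝ)..s, y σ ^ (1 + α) ≤ y s) : α * t ≤ A ^ (-α) := by
  set g : ℝ → ℝ := fun σ => y σ ^ (1 + α) with hg
  have hgc : ContinuousOn g (Icc 0 t) := hy.rpow_const fun _ _ => Or.inr (by positivity)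
  have hgi : IntervalIntegrable g volume 0 t := by
    refine ContinuousOn.intervalIntegrable ?_; rwa [uIcc_of_le ht]
  set Y : ℝ → ℝ := fun s => A + ∫ σ in (0 : ℝ)..s, g σ with hY
  have hYA : ∀ s ∈ Icc 0 t, A ≤ Y s := fun s hs => by
    have : 0 ≤ ∫ σ in (0 : ℝ)..s, g σ := intervalIntegral.integral_nonneg hs.1 fun σ hσ =>
      Real.rpow_nonneg (hy0 σ ⟨hσ.1, hσ.2.trans hs.2⟩) _
    simp only [hY]; linarith
  have hYc : ContinuousOn Y (Icc 0 t) := by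
    have := intervalIntegral.continuousOn_primitive_interval' hgi left_mem_uIcc
    rw [uIcc_of_le ht] at this
    exact continuousOn_const.add this
  have hYd : ∀ s ∈ Ioo 0 t, HasDerivAt Y (g s) s := fun s hs => by
    have h1 : ContinuousAt g s := hgc.continuousAt (Icc_mem_nhds hs.1 hs.2)
    have h2 : IntervalIntegrable g volume 0 s := hgi.mono_set (by
      rw [uIcc_of_le hs.1.le, uIcc_of_le ht]; exact Icc_subset_Icc_right hs.2.le)
    exact (intervalIntegral.integral_hasDerivAt_right h2
      ((hgc.mono Ioo_subset_Icc_self).stronglyMeasurableAtFilter isOpen_Ioo s hs) h1).const_add A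
  set Z : ℝ → ℝ := fun s => Y s ^ (-α) + α * s with hZ
  have hZa : AntitoneOn Z (Icc 0 t) := by
    refine antitoneOn_of_deriv_nonpos (convex_Icc 0 t)
      ((hYc.rpow_const fun s hs => Or.inl (hA.trans_le (hYA s hs)).ne').add (by fun_prop)) ?_ ?_
    · rw [interior_Icc]
      intro s hs
      have := hA.trans_le (hYA s (Ioo_subset_Icc_self hs))
      exact (((hYd s hs).rpow_const (p := -α) (Or.inl this.ne')).add
        ((hasDerivAt_id s).const_mul α)).differentiableAt.differentiableWithinAt
    · rw [interior_Icc]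
      intro s hs
      have h0 := hA.trans_le (hYA s (Ioo_subset_Icc_self hs))
      have hd := ((hYd s hs).rpow_const (p := -α) (Or.inl h0.ne')).add
        ((hasDerivAt_id s).const_mul α)
      have hd' : deriv Z s = g s * -α * Y s ^ (-α - 1) + α * 1 := hd.deriv
      rw [hd']
      have h1 : Y s ^ (1 + α) ≤ g s :=
        Real.rpow_le_rpow h0.le (h s (Ioo_subset_Icc_self hs)) (by positivity)
      have h2 : Y s ^ (1 + α) * Y s ^ (-α - 1) = 1 := by
        rw [← Real.rpow_add h0, show 1 + α + (-α - 1) = 0 by ring, Real.rpow_zero]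
      have h3 : 0 < Y s ^ (-α - 1) := Real.rpow_pos_of_pos h0 _
      have h4 := mul_le_mul_of_nonneg_right h1 h3.le
      rw [h2] at h4
      nlinarith
  have h6 := hZa (left_mem_Icc.2 ht) (right_mem_Icc.2 ht) ht
  have h7 : 0 < Y t ^ (-α) := Real.rpow_pos_of_pos (hA.trans_le (hYA t (right_mem_Icc.2 ht))) _
  have h8 : Y 0 = A := by simp [hY]
  simp only [hZ, h8, add_zero, mul_zero] at h6
  linarith

end

/-! ### No global solution with a source term; dissipation with an absorption term -/

section

variable {N : ℕ}

theorem nonlin_smul_of_abs_eq_one {α c : ℝ} (hα : 0 < α) (hc : |c| = 1) (f : C₀(Eu N, ℝ)) :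
    nonlin α hα (c • f) = c • nonlin α hα f := by
  ext x
  simp only [nonlin_apply, ZeroAtInftyContinuousMap.smul_apply, smul_eq_mul, abs_mul, hc, one_mul]
  ring

section blowup

variable {m : ℕ} {γ α K : ℝ} {v : ℝ → C₀(Eu N, ℝ)}

/-- For fixed `t` and `x`, the quantity followed in `s` is the signed solution at time `s` carried
by the linear flow to time `t` and evaluated at `x`. Jensen's inequality makes it a supersolution of
`y' = y ^ (1 + α)`. -/
theorem mul_le_rpow_linSol (hm : m ≤ N) (hγ : 0 < γ) (hγN : γ < N) (hα : 0 < α) (hK : K ≠ 0)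
    {t : ℝ} (ht : 0 < t)
    (h : IsMild (heatSemigroup N) (fun f => (1 : ℝ) • nonlin α hα f) (fun t => K • linSol N m γ t)
      (Ioc 0 t) v)
    (hv : ∀ s ∈ Ioc 0 t, v s ∈ signCone N m 1 K) {x : Eu N} (hx : x ∈ sector N m) :
    α * t ≤ (|K| * linSol N m γ t x) ^ (-α) := by
  -- `c` is the sign of `K`; multiplication by it reduces negative `K` to the positive case.
  set c := K / |K| with hc
  have hK0 : 0 < |K| := abs_pos.2 hK
  have hcK : c * K = |K| := by
    rw [hc, div_mul_eq_mul_div, ← abs_mul_abs_self, mul_div_assoc, div_self hK0.ne', mul_one]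
  have hc1 : |c| = 1 := by rw [hc, abs_div, abs_abs, div_self hK0.ne']
  set g : ℝ → ℝ := fun σ => c * heatC0 (t - σ) (nonlin α hα (v σ)) x with hg
  have hone : ∀ s σ : ℝ, heatSemigroup N (s - σ) ((1 : ℝ) • nonlin α hα (v σ)) =
      heatC0 (s - σ) (nonlin α hα (v σ)) := fun s σ => by
    rw [one_smul, heatSemigroup_apply]
  simp only [IsMild, hone] at h
  have hgi : IntervalIntegrable g volume 0 t :=
    (intervalIntegrable_apply (h.2 t ⟨ht, le_rfl⟩).1 x).const_mul c
  -- Defining `y` by the integral gives it the right value at `s = 0`, where the solution is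
  -- singular; `hyv` recovers its meaning for `s > 0`.
  set y : ℝ → ℝ := fun s => |K| * linSol N m γ t x + ∫ σ in (0 : ℝ)..s, g σ with hy
  have hA : 0 < |K| * linSol N m γ t x := mul_pos hK0 (linSol_pos hγ hγN ht hx)
  have hyc : ContinuousOn y (Icc 0 t) := by
    have := intervalIntegral.continuousOn_primitive_interval' hgi left_mem_uIcc
    rw [uIcc_of_le ht.le] at this
    exact continuousOn_const.add this
  have hyv : ∀ s ∈ Ioc 0 t, y s = heatC0 (t - s) (c • v s) x := fun s hs => by
    have h1 := (h.2 s hs).1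
    have hts : 0 ≤ t - s := sub_nonneg.2 hs.2
    have e1 : heatC0 (t - s) (∫ σ in (0 : ℝ)..s, heatC0 (s - σ) (nonlin α hα (v σ))) =
        ∫ σ in (0 : ℝ)..s, heatC0 (t - s) (heatC0 (s - σ) (nonlin α hα (v σ))) :=
      ((heatSemigroup N (t - s)).intervalIntegral_comp_comm h1).symm
    have h2 : IntervalIntegrable (fun σ => heatC0 (t - s) (heatC0 (s - σ) (nonlin α hα (v σ))))
        volume 0 s :=
      ⟨(heatSemigroup N (t - s)).integrable_comp h1.1, (heatSemigroup N (t - s)).integrable_comp h1.2⟩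
    rw [heatC0_map_smul, (h.2 s hs).2, heatC0_map_add, heatC0_map_smul, heatC0_linSol hγ hγN hts hs.1,
      sub_add_cancel, e1, ZeroAtInftyContinuousMap.smul_apply, ZeroAtInftyContinuousMap.add_apply,
      ZeroAtInftyContinuousMap.smul_apply, intervalIntegral_apply h2, smul_eq_mul, smul_eq_mul,
      mul_add, ← mul_assoc, hcK, ← intervalIntegral.integral_const_mul]
    simp only [hy]
    congr 1
    refine integral_congr_Ioo hs.1.le fun σ hσ => ?_
    rw [← heatC0_add hts (sub_nonneg.2 hσ.2.le), sub_add_sub_cancel]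
  have hJ : ∀ s ∈ Ioc 0 t, 0 ≤ y s ∧ y s ^ (1 + α) ≤ g s := fun s hs => by
    have h3 := rpow_heatC0_le_heatC0_nonlin hm hα (f := c • v s) ((hv s hs).1.const_mul c)
      (fun z => by
        have h4 := (hv s hs).2 rfl z
        rw [ZeroAtInftyContinuousMap.smul_apply, smul_eq_mul]
        have h5 : coordProd m z * (c * v s z) = K * (coordProd m z * v s z) / |K| := by
          rw [hc]; ring
        rw [h5]; positivity) (t - s) hx
    rw [nonlin_smul_of_abs_eq_one hα hc1, ← hyv s hs, heatC0_map_smul] at h3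
    exact h3
  have hy0 : y 0 = |K| * linSol N m γ t x := by simp [hy]
  refine mul_le_rpow_neg_of_integral_le hα hA ht.le hyc (fun s hs => ?_) fun s hs => ?_
  · rcases hs.1.eq_or_lt with h0 | h0
    · rw [← h0, hy0]; exact hA.le
    · exact (hJ s ⟨h0, hs.2⟩).1
  · have hsub : Icc 0 s ⊆ Icc 0 t := Icc_subset_Icc_right hs.2
    have hi1 : IntervalIntegrable (fun σ => y σ ^ (1 + α)) volume 0 s := by
      refine ContinuousOn.intervalIntegrable ?_
      rw [uIcc_of_le hs.1]
      exact (hyc.mono hsub).rpow_const fun _ _ => Or.inr (by positivity)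
    have hi2 : IntervalIntegrable g volume 0 s := hgi.mono_set (by
      rw [uIcc_of_le hs.1, uIcc_of_le ht.le]; exact hsub)
    have := intervalIntegral.integral_mono_on_of_le_Ioo hs.1 hi1 hi2 fun σ hσ =>
      (hJ σ ⟨hσ.1, hσ.2.le.trans hs.2⟩).2
    exact add_le_add_right this _

/-- At `√t • e`, inside the sector, self-similarity turns the bound into `α * t ≤ C * t ^ ((γ + m) /
2 * α)`, impossible for large `t` since the exponent is below `1`. -/
theorem not_isMild_Ioi (hm : m ≤ N) (hγ : 0 < γ) (hγN : γ < N) (hα : 0 < α)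
    (hαc : α < 2 / (γ + m)) (hK : K ≠ 0)
    (h : IsMild (heatSemigroup N) (fun f => (1 : ℝ) • nonlin α hα f) (fun t => K • linSol N m γ t)
      (Ioi 0) v) (hv : ∀ s ∈ Ioi (0 : ℝ), v s ∈ signCone N m 1 K) : False := by
  set e : Eu N := WithLp.toLp 2 fun _ => 1 with he
  have hes : ∀ r : ℝ, 0 < r → r • e ∈ sector N m := fun r hr i _ => by simpa [he] using hr
  have hγm : 0 < γ + m := by positivity
  have hA0 : 0 < |K| * linSol N m γ 1 e :=
    mul_pos (abs_pos.2 hK) (linSol_pos hγ hγN one_pos (by simpa using hes 1 one_pos))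
  set C := (|K| * linSol N m γ 1 e) ^ (-α) with hC
  have key : ∀ t : ℝ, 0 < t → α * t ≤ t ^ ((γ + m) / 2 * α) * C := fun t ht => by
    have h1 := mul_le_rpow_linSol hm hγ hγN hα hK ht (h.mono fun _ hs => hs.1)
      (fun s hs => hv s hs.1) (hes _ (Real.sqrt_pos.2 ht))
    rw [linSol_scale hm hγ hγN ht, mul_left_comm,
      Real.mul_rpow (Real.rpow_nonneg ht.le _) hA0.le, ← Real.rpow_mul ht.le] at h1
    convert h1 using 3
    ring
  have hb : 0 < 1 - (γ + m) / 2 * α := by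
    rw [lt_div_iff₀ hγm] at hαc; linarith
  obtain ⟨t, ht1, ht0⟩ := (((tendsto_rpow_atTop hb).eventually_gt_atTop (C / α)).and
    (eventually_gt_atTop 0)).exists
  have h2 := key t ht0
  rw [Real.rpow_sub ht0, Real.rpow_one, div_lt_div_iff₀ hα (Real.rpow_pos_of_pos ht0 _)] at ht1
  linarith

end blowup

/-- Once `h * ‖f‖ ^ α < 1`, the Euler step multiplies `f` pointwise by a factor in `[0, 1]`. -/
theorem norm_add_smul_nonlin_le {α : ℝ} (hα : 0 < α) (f : C₀(Eu N, ℝ)) :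
    ∀ᶠ h in 𝓝[>] (0 : ℝ), ‖f + h • ((-1 : ℝ) • nonlin α hα f)‖ ≤ ‖f‖ := by
  have h1 : Tendsto (fun h : ℝ => h * ‖f‖ ^ α) (𝓝[>] 0) (𝓝 0) := by
    have : Continuous fun h : ℝ => h * ‖f‖ ^ α := by fun_prop
    simpa using (this.tendsto 0).mono_left nhdsWithin_le_nhds
  filter_upwards [h1.eventually (eventually_lt_nhds one_pos), eventually_mem_nhdsWithin]
    with h hh (h0 : 0 < h)
  refine C0_norm_le (norm_nonneg _) fun x => ?_
  have h2 : |f x| ^ α ≤ ‖f‖ ^ α := Real.rpow_le_rpow (abs_nonneg _) (C0_abs_le f x) hα.le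
  have h3 : 0 ≤ h * |f x| ^ α := by positivity
  have h4 : h * |f x| ^ α ≤ h * ‖f‖ ^ α := by gcongr
  have e : (f + h • ((-1 : ℝ) • nonlin α hα f)) x = (1 - h * |f x| ^ α) * f x := by
    simp only [ZeroAtInftyContinuousMap.add_apply, ZeroAtInftyContinuousMap.smul_apply, smul_eq_mul,
      nonlin_apply]
    ring
  rw [e, abs_mul, abs_of_nonneg (by linarith)]
  exact (mul_le_of_le_one_left (abs_nonneg _) (by linarith)).trans (C0_abs_le f x)

theorem openInterval_subset (T : EReal) : openInterval T ⊆ Ioi 0 := fun _ ht => ht.1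

theorem Ioc_subset_openInterval {T : EReal} {t : ℝ} (ht : t ∈ openInterval T) :
    Ioc 0 t ⊆ openInterval T := fun _ hs =>
  ⟨hs.1, (EReal.coe_le_coe_iff.2 hs.2).trans_lt ht.2⟩

/-! ### Local existence, attainment of the datum, uniqueness in the class -/

section main

variable {m : ℕ} {γ α K a : ℝ}

theorem tendsto_integral_lipConst (hm : m ≤ N) (hγ : 0 < γ) (hγN : γ < N) (hα : 0 < α)
    (hαc : α < 2 / (γ + m)) {M : ℝ} (hM : 0 ≤ M) :
    Tendsto (fun t => ∫ σ in (0 : ℝ)..t, lipConst N m γ α M σ) (𝓝[>] 0) (𝓝 0) := by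
  have h := intervalIntegral.continuousOn_primitive_interval'
    (intervalIntegrable_lipConst hm hγ hγN hα hαc hM zero_le_one) left_mem_uIcc
  rw [uIcc_of_le zero_le_one] at h
  have h1 := (h 0 (left_mem_Icc.2 zero_le_one)).tendsto
  rw [intervalIntegral.integral_same] at h1
  refine h1.mono_left ?_
  rw [← nhdsWithin_Ioc_eq_nhdsGT (zero_lt_one (α := ℝ))]
  exact nhdsWithin_mono _ Ioc_subset_Icc_self

theorem exists_integral_lipConst_le (hm : m ≤ N) (hγ : 0 < γ) (hγN : γ < N) (hα : 0 < α)
    (hαc : α < 2 / (γ + m)) {M : ℝ} (hM : 0 ≤ M) {ε : ℝ} (hε : 0 < ε) :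
    ∃ T > 0, ∀ t ∈ Ioc 0 T, ∫ σ in (0 : ℝ)..t, lipConst N m γ α M σ ≤ ε := by
  have h := (tendsto_integral_lipConst hm hγ hγN hα hαc hM).eventually (eventually_le_nhds hε)
  obtain ⟨T, hT, hs⟩ := mem_nhdsGT_iff_exists_Ioc_subset.1 h
  exact ⟨T, hT, fun t ht => hs ht⟩

theorem norm_heatDistr_initialDatum (hm : m ≤ N) (hγ : 0 < γ) (hγN : γ < N) {t : ℝ} (ht : 0 < t)
    (x : Eu N) :
    ‖heatDistr (initialDatum N m hm γ hγ hγN K) t x‖ = |K| * |linSol N m γ t x| := by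
  rw [heatDistr_initialDatum hm hγ hγN K ht, Complex.norm_real, Real.norm_eq_abs, abs_mul]

theorem linBound_smul_linSol (hγ : 0 < γ) (hγN : γ < N) {t : ℝ} (ht : 0 < t) :
    LinBound N m γ t |K| (K • linSol N m γ t) :=
  ⟨(antiSymm_linSol hγ hγN ht).const_mul K, abs_nonneg K, fun x => by
    rw [ZeroAtInftyContinuousMap.smul_apply, smul_eq_mul, abs_mul]⟩

theorem smul_linSol_mem_signCone (hγ : 0 < γ) (hγN : γ < N) {t : ℝ} (ht : 0 < t) :
    K • linSol N m γ t ∈ signCone N m a K :=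
  ⟨(antiSymm_linSol hγ hγN ht).const_mul K, fun _ x => by
    have h := mul_nonneg (mul_self_nonneg K) (coordProd_mul_linSol_nonneg (m := m) hγ hγN ht x)
    rw [ZeroAtInftyContinuousMap.smul_apply, smul_eq_mul]
    linarith⟩

theorem heatSemigroup_smul_linSol (hγ : 0 < γ) (hγN : γ < N) (s t : ℝ) (hs : 0 ≤ s) (ht : 0 < t) :
    heatSemigroup N s (K • linSol N m γ t) = K • linSol N m γ (s + t) := by
  rw [heatSemigroup_apply, heatC0_map_smul, heatC0_linSol hγ hγN hs ht]

/-- Local existence. -/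
theorem exists_local_solution (hm : m ≤ N) (hγ : 0 < γ) (hγN : γ < N) (hα : 0 < α)
    (hαc : α < 2 / (γ + m)) (ha : |a| = 1) :
    ∃ (T : ℝ) (u : ℝ → C₀(Eu N, ℝ)), 0 < T ∧
      IsMild (heatSemigroup N) (fun f => a • nonlin α hα f) (fun t => K • linSol N m γ t)
        (Ioc 0 T) u ∧
      ∀ t ∈ Ioc 0 T, u t ∈ signCone N m a K ∧ LinBound N m γ t (2 * |K|) (u t) ∧
        (∫ σ in (0 : ℝ)..t, lipConst N m γ α (2 * |K|) σ) ≤ 1 / 4 ∧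
        LinBound N m γ t ((∫ σ in (0 : ℝ)..t, lipConst N m γ α (2 * |K|) σ) * (2 * |K|))
          (u t - K • linSol N m γ t) := by
  have hM : 0 ≤ 2 * |K| := by positivity
  -- The contraction needs only `1 / 2`; with `1 / 4` the deviation from `K • linSol` is at most
  -- half of it, which yields positivity.
  obtain ⟨T, hT, hℓ⟩ := exists_integral_lipConst_le (N := N) hm hγ hγN hα hαc hM
    (ε := 1 / 4) (by norm_num)
  have hD := isInvariantCone_signCone (N := N) hm hα a K
  obtain ⟨u, hu, hu'⟩ := IsGauge.exists_isMild (M₀ := |K|)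
    (isGauge_linBound hm hγ hγN ha hα hαc hM hT.le) (isLocLip_nonlin hα).continuous (abs_nonneg K)
    ((hℓ T ⟨hT, le_rfl⟩).trans (by norm_num)) (F := fun t => K • linSol N m γ t)
    (((continuousOn_linSol hγ hγN).mono fun t ht => ht.1).const_smul K)
    (fun t ht => linBound_smul_linSol hγ hγN ht.1) hD.closed hD.zero
    (fun t ht u hu hi => hD.duhamel_mem ht.1.le (F := fun t => K • linSol N m γ t)
      (smul_linSol_mem_signCone hγ hγN ht.1) u hu hi)
  exact ⟨T, u, hT, hu, fun t ht => ⟨(hu' t ht).1, (hu' t ht).2.1, hℓ t ht, (hu' t ht).2.2⟩⟩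

/-- The linear part converges to the datum, and the remainder is bounded in the gauge by a multiple
of `∫ lipConst`, which tends to `0`. -/
theorem tendsto_c0Distr (hm : m ≤ N) (hγ : 0 < γ) (hγN : γ < N) (hα : 0 < α)
    (hαc : α < 2 / (γ + m)) {T : ℝ} (hT : 0 < T) {u : ℝ → C₀(Eu N, ℝ)}
    (hu : ∀ t ∈ Ioc 0 T,
      LinBound N m γ t ((∫ σ in (0 : ℝ)..t, lipConst N m γ α (2 * |K|) σ) * (2 * |K|))
          (u t - K • linSol N m γ t)) :
    Tendsto (fun t => c0Distr (u t)) (𝓝[>] 0) (𝓝 (initialDatum N m hm γ hγ hγN K)) := by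
  rw [PointwiseConvergenceCLM.tendsto_iff_forall_tendsto]
  intro φ
  obtain ⟨B, hB⟩ := norm_pairC0_le_of_abs_le_linSol hm hγ hγN φ
  set L := pairC0 φ.integrable
  have h1 : Tendsto (fun t => K • L (linSol N m γ t)) (𝓝[>] 0)
      (𝓝 (initialDatum N m hm γ hγ hγN K φ)) := by
    rw [initialDatum_eq_integral]
    exact (tendsto_pairC0_linSol hm hγ hγN φ).const_smul K
  have h2 : Tendsto (fun t => L (u t - K • linSol N m γ t)) (𝓝[>] 0) (𝓝 0) := by
    have h3 := ((tendsto_integral_lipConst (N := N) hm hγ hγN hα hαc (M := 2 * |K|)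
      (by positivity)).mul_const (2 * |K|)).mul_const B
    rw [zero_mul, zero_mul] at h3
    refine squeeze_zero_norm' ?_ h3
    filter_upwards [Ioc_mem_nhdsGT hT] with t ht
    have h4 := hu t ht
    exact hB t _ _ ht.1 h4.2.1 h4.1 h4.2.2
  have h5 := h1.add h2
  rw [add_zero] at h5
  refine h5.congr fun t => ?_
  rw [c0Distr_apply, map_sub, map_smul, add_sub_cancel]

/-- The radius `M` is arbitrary, at the price of a time `T` depending on it; this accommodates any
constant in the uniqueness class. -/
theorem eq_of_linBound (hm : m ≤ N) (hγ : 0 < γ) (hγN : γ < N) (hα : 0 < α)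
    (hαc : α < 2 / (γ + m)) (ha : |a| = 1) {M : ℝ} (hM : 0 ≤ M) :
    ∃ T > 0, ∀ t ∈ Ioc 0 T, ∀ u w : ℝ → C₀(Eu N, ℝ),
      IsMild (heatSemigroup N) (fun f => a • nonlin α hα f) (fun t => K • linSol N m γ t)
        (Ioc 0 t) u →
      IsMild (heatSemigroup N) (fun f => a • nonlin α hα f) (fun t => K • linSol N m γ t)
        (Ioc 0 t) w →
      (∀ s ∈ Ioc 0 t, LinBound N m γ s M (u s)) → (∀ s ∈ Ioc 0 t, LinBound N m γ s M (w s)) →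
      u t = w t := by
  obtain ⟨T, hT, hℓ⟩ := exists_integral_lipConst_le (N := N) hm hγ hγN hα hαc hM
    (ε := 1 / 2) (by norm_num)
  exact ⟨T, hT, fun t ht u w hu hw hBu hBw =>
    (isGauge_linBound hm hγ hγN ha hα hαc hM ht.1.le).eq_of_isMild
      (isLocLip_nonlin hα).continuous hM (hℓ t ht) hu hw hBu hBw t ⟨ht.1, le_rfl⟩⟩

end main

end

end HeatSing

end

/-! ### Assembly of the main theorem -/

open HeatSing in
theorem mainTheorem3 (N m : ℕ) (hm1 : 1 ≤ m) (hmN : m ≤ N) (γ : ℝ) (hγ0 : 0 < γ) (hγN : γ < N)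
    (α : ℝ) (hα0 : 0 < α) (hα : α < 2 / (γ + m)) (K : ℝ) (hK : K ≠ 0)
    (a : ℝ) (ha : a = 1 ∨ a = -1) (u₀ : 𝓢'(Eu N, ℂ))
    (hu₀ : u₀ = initialDatum N m hmN γ hγ0 hγN K) :
    ∃ (T : ℝ) (u : ℝ → C₀(Eu N, ℝ)), 0 < T ∧
      IsSolution a α hα0 u₀ (Ioc 0 T) u ∧
      Tendsto (fun t => c0Distr (u t)) (𝓝[>] 0) (𝓝 u₀) ∧
      InUniquenessClass m u₀ (Ioc 0 T) u ∧
      (0 < K → ∀ t ∈ Ioc 0 T, ∀ x ∈ sector N m, 0 < u t x) ∧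
      ∃ (Tmax : EReal) (v : ℝ → C₀(Eu N, ℝ)), (T : EReal) < Tmax ∧
        (∀ t ∈ Ioc 0 T, v t = u t) ∧
        IsMaximalSolution a α hα0 u₀ Tmax v ∧
        InUniquenessClass m u₀ (openInterval Tmax) v ∧
        (∀ (T' : EReal) (w : ℝ → C₀(Eu N, ℝ)),
          IsSolution a α hα0 u₀ (openInterval T') w →
          InUniquenessClass m u₀ (openInterval T') w →
          T' ≤ Tmax ∧ ∀ t ∈ openInterval T', w t = v t) ∧
        (a = -1 → Tmax = ⊤) ∧
        (a = 1 → Tmax < ⊤ ∧ Tendsto (fun t => ‖v t‖) (𝓝[<] Tmax.toReal) atTop) := by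
  subst hu₀
  have ha1 : |a| = 1 := by rcases ha with rfl | rfl <;> simp
  have ha0 : a ≠ 0 := by rintro rfl; simp at ha1
  have hsol : ∀ {I : Set ℝ}, I ⊆ Ioi 0 → ∀ w : ℝ → C₀(Eu N, ℝ), _ := fun {I} hI w =>
    isSolution_iff_isMild (I := I) hmN hγ0 hγN (K := K) ha0 hα0 hI w
  have hIoc : ∀ T : ℝ, Ioc 0 T ⊆ Ioi 0 := fun T t ht => ht.1
  have hf := isLocLip_nonlin (N := N) (a := a) hα0
  have hF := heatSemigroup_smul_linSol (N := N) (m := m) (K := K) hγ0 hγN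
  have hhd : ∀ {t : ℝ}, 0 < t → ∀ x, _ := fun {t} ht x =>
    norm_heatDistr_initialDatum (K := K) (t := t) hmN hγ0 hγN ht x
  obtain ⟨T, u, hT, hu, hu'⟩ := exists_local_solution (N := N) (K := K) hmN hγ0 hγN hα0 hα ha1
  have huM : ∀ t ∈ Ioc 0 T, ∀ x,
      |u t x| ≤ 2 * ‖heatDistr (initialDatum N m hmN γ hγ0 hγN K) t x‖ := fun t ht x => by
    rw [hhd ht.1, ← mul_assoc]
    exact (hu' t ht).2.1.2.2 x
  refine ⟨T, u, hT, (hsol (hIoc T) u).2 hu,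
    tendsto_c0Distr hmN hγ0 hγN hα0 hα hT fun t ht => (hu' t ht).2.2.2,
    ⟨fun t ht => (hu' t ht).1.1, 1, one_pos, 2, fun t ht _ => huM t ht⟩, ?_, ?_⟩
  -- Here `u ≥ K * linSol - (1 / 4) * (2 * K) * linSol = K * linSol / 2`, for either sign of `a`.
  · intro hK0 t ht x hx
    obtain ⟨-, -, h1, -, -, h2⟩ := hu' t ht
    have h3 := linSol_pos hγ0 hγN ht.1 hx
    have h4 := h2 x
    rw [abs_of_pos hK0, abs_of_pos h3, ZeroAtInftyContinuousMap.sub_apply,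
      ZeroAtInftyContinuousMap.smul_apply, smul_eq_mul] at h4
    rw [abs_of_pos hK0] at h1
    have h5 := (abs_le.1 h4).1
    have h6 := mul_pos hK0 h3
    have h7 := mul_le_mul_of_nonneg_right h1 h6.le
    linarith
  obtain ⟨Tm, v, hTm, hvu, hv, hvD, hmax, hblow⟩ := exists_maximal hf
    (isInvariantCone_signCone hmN hα0 a K) hF hT hu fun t ht => (hu' t ht).1
  have hmax' : ∀ (T' : EReal) (w : ℝ → C₀(Eu N, ℝ)),
      IsSolution a α hα0 (initialDatum N m hmN γ hγ0 hγN K) (openInterval T') w →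
      (∃ ε > 0, ∀ t ∈ openInterval T', t < ε → w t = v t) →
      T' ≤ Tm ∧ ∀ t ∈ openInterval T', w t = v t := fun T' w hw =>
    hmax T' w ((hsol (openInterval_subset T') w).1 hw)
  have hTm0 : (0 : EReal) < Tm := (EReal.coe_pos.2 hT).trans hTm
  have hTm_bot : Tm ≠ ⊥ := fun h => by simp [h] at hTm
  have hTI : T ∈ openInterval Tm := ⟨hT, hTm⟩
  refine ⟨Tm, v, hTm, hvu, ⟨hTm0, (hsol (openInterval_subset Tm) v).2 hv, hmax'⟩,
    ⟨fun t ht => (hvD t ht).1, T, hT, 2, fun t ht htT x => ?_⟩, ?_, ?_, ?_⟩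
  · rw [hvu t ⟨ht.1, htT.le⟩]
    exact huM t ⟨ht.1, htT.le⟩ x
  -- By maximality only agreement for small times is needed; there both solutions lie in one gauge
  -- ball, of radius the larger of the two constants.
  · rintro T' w hw ⟨hwa, δ, hδ, M', hwM⟩
    refine hmax' T' w hw ?_
    obtain ⟨T₁, hT₁, huniq⟩ := eq_of_linBound (N := N) (K := K) hmN hγ0 hγN hα0 hα ha1
      (M := max (2 * |K|) (M' * |K|)) (le_max_of_le_left (by positivity))
    refine ⟨min δ (min T T₁), by positivity, fun t ht hlt => ?_⟩
    obtain ⟨hlt1, hlt2, hlt3⟩ : t < δ ∧ t < T ∧ t < T₁ := by simpa using hlt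
    have hsub : Ioc 0 t ⊆ Ioc 0 T := Ioc_subset_Ioc_right hlt2.le
    have hM0 : 0 ≤ max (2 * |K|) (M' * |K|) := le_max_of_le_left (by positivity)
    rw [hvu t ⟨ht.1, hlt2.le⟩]
    refine huniq t ⟨ht.1, hlt3.le⟩ w u
      (((hsol (openInterval_subset T') w).1 hw).mono (Ioc_subset_openInterval ht)) (hu.mono hsub)
      (fun s hs => ?_) (fun s hs => ?_)
    · have hs' := Ioc_subset_openInterval ht hs
      refine ⟨hwa s hs', hM0, fun x => (hwM s hs' (hs.2.trans_lt hlt1) x).trans ?_⟩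
      rw [hhd hs.1, ← mul_assoc]
      exact mul_le_mul_of_nonneg_right (le_max_right _ _) (abs_nonneg _)
    · have h := (hu' s (hsub hs)).2.1
      exact ⟨h.1, hM0, fun x => (h.2.2 x).trans
        (mul_le_mul_of_nonneg_right (le_max_left _ _) (abs_nonneg _))⟩
  -- A finite `Tm` would force blow-up, but after time `T` the norm never exceeds `‖v T‖`.
  · rintro rfl
    by_contra htop
    have hTs := EReal.coe_toReal htop hTm_bot
    have hTT : T < Tm.toReal := by rw [← hTs] at hTm; exact EReal.coe_lt_coe_iff.1 hTm
    have h1 := hblow Tm.toReal hTs.symm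
    have h2 : ∀ᶠ t in 𝓝[<] Tm.toReal, ‖v t‖ ≤ ‖v T‖ := by
      filter_upwards [Ioo_mem_nhdsLT hTT] with t ht
      have htI : t ∈ openInterval Tm :=
        ⟨hT.trans ht.1, by rw [← hTs]; exact EReal.coe_lt_coe_iff.2 ht.2⟩
      exact hv.norm_le_of_dissipative hf.continuous hF (norm_add_smul_nonlin_le hα0) hT ht.1.le
        fun s hs => Ioc_subset_openInterval htI ⟨hT.trans_le hs.1, hs.2⟩
    obtain ⟨t, ht1, ht2⟩ := ((h1.eventually_gt_atTop ‖v T‖).and h2).exists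
    exact absurd ht1 (not_lt.2 ht2)
  · rintro rfl
    have htop : Tm ≠ ⊤ := by
      rintro rfl
      have hI : openInterval ⊤ = Ioi 0 := by
        ext t; simp [openInterval, EReal.coe_lt_top]
      rw [hI] at hv hvD
      exact not_isMild_Ioi hmN hγ0 hγN hα0 hα hK hv hvD
    exact ⟨lt_top_iff_ne_top.2 htop, hblow _ (EReal.coe_toReal htop hTm_bot).symm⟩
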